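/- Let $\mathcal{P}=(X,\prec)$ be a finite partially ordered set ($\prec$ irreflexive and transitive) with $|X|=n$. A linear extension of $\mathcal{P}$ is a total order $x_1<\dots<x_n$ of $X$ such that $x_i\prec x_j$ implies $i<j$; a neighbouring pair $(x_i,x_{i+1})$ with $x_i\not\prec x_{i+1}$ (equivalently, an adjacent incomparable pair) is called a jump. The jump number problem asks, given $\mathcal{P}$, for the minimum number of jumps of a linear extension of $\mathcal{P}$, together with a linear extension that attains this minimum. Theorem. The jump number problem can be solved, on arbitrary posets with $n$ elements, in time $O(1.824^n)$. That is, there are a single random access machine program (with addition, truncated subtraction, indirect addressing, conditionals and loops) and a function $T(n)=O(1.824^n)$ such that, for every $n$ and every poset on $\{0,\dots,n-1\}$, given as $n$ and the $0$-$1$ table of the relation $\prec$, the program halts within time $T(n)$ under the logarithmic cost criterion, and outputs the minimum number of jumps and a linear extension that attains it. -/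

import Mathlib

/-! ## Linear extensions and jumps -/

/-- The enumeration `x 0, x 1, …, x (n - 1)` of the ground set `X` lists it in the order of a linear
extension of the strict partial order `r`: the total order "is listed before" contains `r`. -/
def IsLinearExtension {X : Type*} {n : ℕ} (r : X → X → Prop) (x : Fin n ≃ X) : Prop :=
  ∀ i j : Fin n, r (x i) (x j) → i < j

/-- The number of jumps of an enumeration: the number of pairs of neighbours `x i`, `x (i + 1)`
with `x i ⊀ x (i + 1)`. -/
noncomputable def jumpCount {X : Type*} {n : ℕ} (r : X → X → Prop) (x : Fin n ≃ X) : ℕ :=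
  {p : Fin n × Fin n | (p.2 : ℕ) = (p.1 : ℕ) + 1 ∧ ¬ r (x p.1) (x p.2)}.ncard

/-- The linear extension `x` of `r` has the minimum number of jumps among all linear extensions. -/
def IsJumpOptimal {X : Type*} {n : ℕ} (r : X → X → Prop) (x : Fin n ≃ X) : Prop :=
  IsLinearExtension r x ∧
    ∀ y : Fin n ≃ X, IsLinearExtension r y → jumpCount r x ≤ jumpCount r y

/-! ## Random access machines with logarithmic cost -/

/-- Programs of a random access machine. The memory consists of cells `M 0, M 1, M 2, …`, each
holding a natural number. The arithmetic operations are addition and truncated subtraction;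
`load` and `store` are the two instructions with indirect addressing. -/
inductive RAMProg : Type
  /-- do nothing -/
  | skip : RAMProg
  /-- `M d := c` -/
  | const (d c : ℕ) : RAMProg
  /-- `M d := M a + M b` -/
  | add (d a b : ℕ) : RAMProg
  /-- `M d := M a - M b` (`0` if `M a < M b`) -/
  | sub (d a b : ℕ) : RAMProg
  /-- `M d := M (M a)` -/
  | load (d a : ℕ) : RAMProg
  /-- `M (M d) := M a` -/
  | store (d a : ℕ) : RAMProg
  /-- first `p`, then `q` -/
  | seq (p q : RAMProg) : RAMProg
  /-- if `M a ≠ 0` then `p` else `q` -/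
  | ite (a : ℕ) (p q : RAMProg) : RAMProg
  /-- while `M a ≠ 0` do `p` -/
  | loop (a : ℕ) (p : RAMProg) : RAMProg

/-- The length of the binary representation of `k`, where `0` has length `1`. -/
def bitLen (k : ℕ) : ℕ := Nat.log 2 k + 1

/-- `RAMProg.Run p M M' t`: started with memory `M`, the program `p` halts with memory `M'`, and the
time used is `t`. Time is measured by the logarithmic cost criterion: an instruction costs the sum
of the lengths of all numbers it handles, addresses and contents alike. -/
inductive RAMProg.Run : RAMProg → (ℕ → ℕ) → (ℕ → ℕ) → ℕ → Prop
  | skip (M : ℕ → ℕ) : Run .skip M M 1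
  | const (d c : ℕ) (M : ℕ → ℕ) :
      Run (.const d c) M (Function.update M d c) (bitLen d + bitLen c)
  | add (d a b : ℕ) (M : ℕ → ℕ) :
      Run (.add d a b) M (Function.update M d (M a + M b))
        (bitLen d + bitLen a + bitLen (M a) + bitLen b + bitLen (M b))
  | sub (d a b : ℕ) (M : ℕ → ℕ) :
      Run (.sub d a b) M (Function.update M d (M a - M b))
        (bitLen d + bitLen a + bitLen (M a) + bitLen b + bitLen (M b))
  | load (d a : ℕ) (M : ℕ → ℕ) :
      Run (.load d a) M (Function.update M d (M (M a)))
        (bitLen d + bitLen a + bitLen (M a) + bitLen (M (M a)))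
  | store (d a : ℕ) (M : ℕ → ℕ) :
      Run (.store d a) M (Function.update M (M d) (M a))
        (bitLen d + bitLen (M d) + bitLen a + bitLen (M a))
  | seq {p q : RAMProg} {M M' M'' : ℕ → ℕ} {s t : ℕ} (hp : Run p M M' s) (hq : Run q M' M'' t) :
      Run (.seq p q) M M'' (s + t)
  | ite_pos {a : ℕ} {p q : RAMProg} {M M' : ℕ → ℕ} {t : ℕ} (ha : M a ≠ 0) (hp : Run p M M' t) :
      Run (.ite a p q) M M' (bitLen a + bitLen (M a) + t)
  | ite_neg {a : ℕ} {p q : RAMProg} {M M' : ℕ → ℕ} {t : ℕ} (ha : M a = 0) (hq : Run q M M' t) :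
      Run (.ite a p q) M M' (bitLen a + bitLen (M a) + t)
  | loop_done {a : ℕ} {p : RAMProg} {M : ℕ → ℕ} (ha : M a = 0) :
      Run (.loop a p) M M (bitLen a + bitLen (M a))
  | loop_step {a : ℕ} {p : RAMProg} {M M' M'' : ℕ → ℕ} {s t : ℕ} (ha : M a ≠ 0)
      (hp : Run p M M' s) (hl : Run (.loop a p) M' M'' t) :
      Run (.loop a p) M M'' (bitLen a + bitLen (M a) + s + t)

/-! ## Input and output of the jump number problem -/

open Classical in
/-- The input memory for a poset with ground set `{0, …, n - 1}` and order `r`: cell `0` holds `n`,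
cell `1 + (n * i + j)` holds `1` if `i ≺ j` and `0` otherwise, and all other cells hold `0`. -/
noncomputable def posetInput {n : ℕ} (r : Fin n → Fin n → Prop) : ℕ → ℕ := fun k =>
  if k = 0 then n
  else if ∃ i j : Fin n, k = 1 + (n * (i : ℕ) + (j : ℕ)) ∧ r i j then 1 else 0

/-- The memory `M` holds a solution of the jump number problem for `r`: for some linear extension
`x` with the minimum number of jumps, cell `0` holds its number of jumps and the cells `1, …, n`
hold its elements in order. -/
def IsJumpSolution {n : ℕ} (r : Fin n → Fin n → Prop) (M : ℕ → ℕ) : Prop :=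
  ∃ x : Fin n ≃ Fin n, IsJumpOptimal r x ∧ M 0 = jumpCount r x ∧
    ∀ i : Fin n, M (1 + (i : ℕ)) = (x i : ℕ)

/-- The program `p` solves the jump number problem within time `T`: on every poset with `n` elements
it halts after time at most `T n` and its final memory holds a solution. -/
def SolvesJumpNumberInTime (p : RAMProg) (T : ℕ → ℕ) : Prop :=
  ∀ (n : ℕ) (r : Fin n → Fin n → Prop), IsStrictOrder (Fin n) r →
    ∃ (M : ℕ → ℕ) (t : ℕ), p.Run (posetInput r) M t ∧ t ≤ T n ∧ IsJumpSolution r M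

/-!
The jump number of a linear extension `y` is `n - 1` minus the number of its comparable neighbours,
so a linear extension with the maximum number of comparable neighbours is to be found. The algorithm
is a dynamic program over down-sets that ignores most of the down-sets.

A state is a linear extension `s` of a down-set. For every pair `a ≺ t` with `a ∉ s` there is a
transition: append the elements below `t` that are still missing, those in the interval from `a` to
`t` last. If two states have the same elements and the same number of comparable neighbours, only
one is kept. In the end, a state with the most comparable neighbours is completed arbitrarily.

*Optimality* (`SearchClosed.exists_ge`). For every prefix of a linear extension `y`, some state
consists of elements of the prefix and has at least as many comparable neighbours. Indeed, let
`c₁ ≺ ⋯ ≺ c_m` be the maximal run of comparable neighbours at the end of the prefix, and take a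
state `s` for the prefix before it. If `m = 1`, then `s` serves again. Otherwise, whatever lies
between `c₁` and `c_m` stands between them in `y`, so the interval from `c₁` to `c_m` is the run
itself, and no element of it is in `s`. The transition from `s` along `c₁ ≺ c_m` thus appends the
whole run in one piece, gains at least `m - 1` comparable neighbours, and appends no element outside
the prefix.

*The number of states* (`card_fewTops_le`). Each transition adds one generator `t` to the down-set,
and `a`, `t` are both new. So a down-set reached by `k` transitions is generated by `k` elements,
and the comparability graph has a matching of `k` pairs. If a maximum matching has `m` pairs, then
the maximal elements of a visited down-set form an antichain of at most `m` elements, which contains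
at most one element of each pair. For `0 < x ≤ 1` the number of such antichains is at most
`x ^ (-m) * (1 + 2 * x) ^ m * (1 + x) ^ (n - 2 * m)`, and for `x = 0.802` this is at most
`1.802 ^ n`, because `1 + 2 * x ≤ x * (1 + x) ^ 2`. There are at most `n + 1` values for the number
of comparable neighbours, hence at most `(n + 1) * 1.802 ^ n` states.

*The machine*. The states stand in a queue in memory, each as the table of the positions of its
elements. A table indexed by the number of comparable neighbours and the characteristic vector of
the down-set shows which states have occurred. All addresses and contents are at most
`2 ^ (3 * n + 7)`, so an instruction costs `O(n)`, and one state is expanded in polynomial time. The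
running time is a polynomial times `1.802 ^ n`, which is `O(1.824 ^ n)`. Correctness and running
time of the programs are proved together, by the rules of a Hoare logic for `WP`.
-/

open scoped Classical

set_option linter.unusedSimpArgs false

namespace JumpNumber

/-! ### Linear extensions of down-sets as lists -/

/-- `r` is a strict partial order whose field is contained in `{0, …, n - 1}`. -/
structure PosetOn (n : ℕ) (r : ℕ → ℕ → Prop) : Prop where
  lt_left : ∀ {i j}, r i j → i < n
  lt_right : ∀ {i j}, r i j → j < n
  irrefl : ∀ i, ¬ r i i
  trans : ∀ {i j k}, r i j → r j k → r i k

/-- The reflexive closure of `r`. -/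
def Le (r : ℕ → ℕ → Prop) (i j : ℕ) : Prop := i = j ∨ r i j

/-- The list `s`, read from its last entry to its first, is a linear extension of the restriction
of `r` to a down-set. The newest element stands at the head. -/
def Ext (r : ℕ → ℕ → Prop) : List ℕ → Prop
  | [] => True
  | c :: s => Ext r s ∧ c ∉ s ∧ ∀ d, r d c → d ∈ s

/-- The number of neighbours in `s` that are comparable; the value `n` stands for the missing
predecessor of the oldest element. -/
noncomputable def asc (r : ℕ → ℕ → Prop) (n : ℕ) : List ℕ → ℕ
  | [] => 0
  | c :: s => asc r n s + if Le r (s.headD n) c then 1 else 0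

/-- The position of `x` in `s`, counted from `1` at the oldest element, or `0` if `x` is not in `s`. -/
def pos : List ℕ → ℕ → ℕ
  | [], _ => 0
  | c :: s, x => if x = c then s.length + 1 else pos s x

variable {n : ℕ} {r : ℕ → ℕ → Prop}

theorem Le.refl (i : ℕ) : Le r i i := Or.inl rfl

theorem Le.trans (hr : PosetOn n r) {i j k : ℕ} (h : Le r i j) (h' : Le r j k) : Le r i k := by
  rcases h with rfl | h
  · exact h'
  · rcases h' with rfl | h'
    · exact Or.inr h
    · exact Or.inr (hr.trans h h')

theorem Le.lt_left (hr : PosetOn n r) {i j : ℕ} (h : Le r i j) (hj : j < n) : i < n := by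
  rcases h with rfl | h
  · exact hj
  · exact hr.lt_left h

theorem Le.trans_lt (hr : PosetOn n r) {i j k : ℕ} (h : Le r i j) (h' : r j k) : r i k := by
  rcases h with rfl | h
  · exact h'
  · exact hr.trans h h'

theorem Ext.nodup : ∀ {s : List ℕ}, Ext r s → s.Nodup
  | [], _ => List.nodup_nil
  | _ :: _, h => List.nodup_cons.2 ⟨h.2.1, h.1.nodup⟩

theorem Ext.mem_of_lt : ∀ {s : List ℕ}, Ext r s → ∀ {c d}, c ∈ s → r d c → d ∈ s
  | [], _, _, _, hc, _ => by simp at hc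
  | b :: s, h, c, d, hc, hd => by
    rcases List.mem_cons.1 hc with rfl | hc
    · exact List.mem_cons_of_mem _ (h.2.2 d hd)
    · exact List.mem_cons_of_mem _ (h.1.mem_of_lt hc hd)

theorem length_le_of_lt {s : List ℕ} (h : s.Nodup) (hn : ∀ c ∈ s, c < n) : s.length ≤ n := by
  rw [← List.toFinset_card_of_nodup h]
  calc s.toFinset.card ≤ (Finset.range n).card :=
        Finset.card_le_card fun c hc => Finset.mem_range.2 (hn c (List.mem_toFinset.1 hc))
    _ = n := Finset.card_range n

theorem asc_le_length (s : List ℕ) : asc r n s ≤ s.length := by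
  induction s with
  | nil => simp [asc]
  | cons c s ih => simp only [asc, List.length_cons]; split_ifs <;> omega

theorem pos_eq_zero : ∀ {s : List ℕ} {x : ℕ}, pos s x = 0 ↔ x ∉ s
  | [], x => by simp [pos]
  | c :: s, x => by
    by_cases h : x = c
    · simp [pos, h]
    · simp [pos, h, pos_eq_zero]

theorem pos_le_length : ∀ (s : List ℕ) (x : ℕ), pos s x ≤ s.length
  | [], x => by simp [pos]
  | c :: s, x => by
    have := pos_le_length s x
    simp only [pos, List.length_cons]
    split_ifs <;> omega

theorem pos_inj : ∀ {s : List ℕ} {x y : ℕ}, x ∈ s → y ∈ s → pos s x = pos s y → x = y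
  | [], x, _, hx, _, _ => by simp at hx
  | c :: s, x, y, hx, hy, h => by
    have h1 := pos_le_length s x
    have h2 := pos_le_length s y
    by_cases hxc : x = c <;> by_cases hyc : y = c
    · rw [hxc, hyc]
    · simp [pos, hxc, hyc] at h; omega
    · simp [pos, hxc, hyc] at h; omega
    · simp only [pos, hxc, hyc, if_false] at h
      exact pos_inj ((List.mem_cons.1 hx).resolve_left hxc) ((List.mem_cons.1 hy).resolve_left hyc) h

theorem Ext.pos_lt : ∀ {s : List ℕ}, Ext r s → ∀ {c d}, c ∈ s → r d c → pos s d < pos s c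
  | [], _, _, _, hc, _ => by simp at hc
  | b :: s, h, c, d, hc, hd => by
    by_cases hcb : c = b
    · subst hcb
      have hds := h.2.2 d hd
      have hdc : d ≠ c := fun e => h.2.1 (e ▸ hds)
      have := pos_le_length s d
      simp [pos, hdc]; omega
    · have hcs := (List.mem_cons.1 hc).resolve_left hcb
      have hds := h.1.mem_of_lt hcs hd
      have hdb : d ≠ b := fun e => h.2.1 (e ▸ hds)
      simpa [pos, hcb, hdb] using h.1.pos_lt hcs hd

/-! ### Appending an interval -/

/-- `s'` arises from `s` by appending, in an order compatible with `r`, all elements below `t` that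
are missing in `s` and do not lie above `a`. -/
structure Pass (r : ℕ → ℕ → Prop) (a t : ℕ) (s s' : List ℕ) : Prop where
  suffix : s <:+ s'
  ext : Ext r s'
  mem : ∀ c, c ∈ s' ↔ c ∈ s ∨ (Le r c t ∧ ¬ Le r a c)

/-- `s'` arises from `s` by appending the missing elements below `t`, those above `a` last. So the
interval from `a` to `t` stands at the end of `s'`. -/
def Transition (r : ℕ → ℕ → Prop) (n a t : ℕ) (s s' : List ℕ) : Prop :=
  ∃ s₁, Pass r a t s s₁ ∧ Pass r n t s₁ s'

theorem not_le_top (hr : PosetOn n r) {c : ℕ} (hc : c < n) : ¬ Le r n c := by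
  rintro (rfl | h)
  · omega
  · exact absurd (hr.lt_left h) (lt_irrefl _)

theorem Transition.mem (hr : PosetOn n r) {a t : ℕ} (ht : t < n) {s s' : List ℕ}
    (h : Transition r n a t s s') (c : ℕ) : c ∈ s' ↔ c ∈ s ∨ Le r c t := by
  obtain ⟨s₁, h1, h2⟩ := h
  rw [h2.mem, h1.mem]
  constructor
  · rintro ((h | h) | h)
    · exact Or.inl h
    · exact Or.inr h.1
    · exact Or.inr h.1
  · rintro (h | h)
    · exact Or.inl (Or.inl h)
    · exact Or.inr ⟨h, not_le_top hr (h.lt_left hr ht)⟩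

theorem asc_append_of_chain (hr : PosetOn n r) : ∀ (u : List ℕ) {s : List ℕ}, Ext r (u ++ s) →
    (∀ c ∈ u, ∀ d ∈ u, r c d ∨ c = d ∨ r d c) →
    asc r n s + (u.length - 1) ≤ asc r n (u ++ s)
  | [], s, _, _ => by simp
  | [c], s, _, _ => by simp [asc]
  | c :: d :: u, s, h, hu => by
    have ih := asc_append_of_chain hr (d :: u) (s := s) h.1
      (fun x hx y hy => hu x (List.mem_cons_of_mem _ hx) y (List.mem_cons_of_mem _ hy))
    have hne : c ≠ d := fun e => h.2.1 (by simp [e])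
    have hdc : r d c := by
      rcases hu c (by simp) d (by simp) with hcd | e | hdc
      · exact absurd (List.mem_cons_of_mem _ (h.1.2.2 c hcd)) h.2.1
      · exact absurd e hne
      · exact hdc
    have hle : Le r (((d :: u) ++ s).headD n) c := Or.inr hdc
    have : asc r n (c :: d :: u ++ s) = asc r n ((d :: u) ++ s) + 1 := by
      change asc r n ((d :: u) ++ s) + (if Le r (((d :: u) ++ s).headD n) c then 1 else 0) = _
      rw [if_pos hle]
    rw [this]
    simp only [List.length_cons] at ih ⊢
    omega

theorem asc_le_append (u s : List ℕ) : asc r n s ≤ asc r n (u ++ s) := by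
  induction u with
  | nil => simp
  | cons c u ih =>
    rw [List.cons_append, asc]
    omega

theorem Pass.asc_le {a t : ℕ} {s s' : List ℕ} (h : Pass r a t s s') : asc r n s ≤ asc r n s' := by
  obtain ⟨u, rfl⟩ := h.suffix
  exact asc_le_append u s

/-- If the interval from `a` to `t` is a chain of `m` elements, none of them in `s`, then the
transition gains at least `m - 1` comparable neighbours. -/
theorem Transition.asc_ge (hr : PosetOn n r) {a t : ℕ} (ht : t < n) {s s' : List ℕ}
    (h : Transition r n a t s s') (I : Finset ℕ) (hI : ∀ c ∈ I, Le r a c ∧ Le r c t)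
    (hI' : ∀ c, Le r a c → Le r c t → c ∈ I) (hIs : ∀ c ∈ I, c ∉ s)
    (hchain : ∀ c ∈ I, ∀ d ∈ I, r c d ∨ c = d ∨ r d c) :
    asc r n s + (I.card - 1) ≤ asc r n s' := by
  obtain ⟨s₁, h1, h2⟩ := h
  obtain ⟨u, rfl⟩ := h2.suffix
  have hnd : (u ++ s₁).Nodup := h2.ext.nodup
  have hdisj := List.disjoint_of_nodup_append hnd
  have hu : ∀ c, c ∈ u ↔ c ∈ I := by
    intro c
    constructor
    · intro hc
      have hcs : c ∉ s₁ := fun h => hdisj hc h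
      have h3 := ((h2.mem c).1 (List.mem_append_left _ hc)).resolve_left hcs
      refine hI' c ?_ h3.1
      by_contra hac
      exact hcs ((h1.mem c).2 (Or.inr ⟨h3.1, hac⟩))
    · intro hc
      have hcs : c ∉ s₁ := fun h => by
        rcases (h1.mem c).1 h with h | h
        · exact hIs c hc h
        · exact h.2 (hI c hc).1
      have h3 : c ∈ u ++ s₁ := (h2.mem c).2
        (Or.inr ⟨(hI c hc).2, not_le_top hr ((hI c hc).2.lt_left hr ht)⟩)
      exact (List.mem_append.1 h3).resolve_right hcs
  have hcard : u.length = I.card := by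
    rw [← List.toFinset_card_of_nodup (List.nodup_append.1 hnd).1]
    congr 1
    ext c
    rw [List.mem_toFinset, hu]
  have h4 := asc_append_of_chain hr u h2.ext
    (fun c hc d hd => hchain c ((hu c).1 hc) d ((hu d).1 hd))
  have h5 : asc r n s ≤ asc r n s₁ := h1.asc_le
  omega

/-! ### The search reaches an optimal linear extension -/

/-- The number of `i` with `i + 1 < p` such that `f i` and `f (i + 1)` are comparable. -/
noncomputable def rises (r : ℕ → ℕ → Prop) (f : ℕ → ℕ) (p : ℕ) : ℕ :=
  ((Finset.range (p - 1)).filter fun i => r (f i) (f (i + 1))).card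

/-- The family `𝒬` of lists contains the empty list and is closed under transitions, up to
exchanging a list by one with the same elements and the same number of comparable neighbours. -/
structure SearchClosed (r : ℕ → ℕ → Prop) (n : ℕ) (𝒬 : Set (List ℕ)) : Prop where
  nil_mem : [] ∈ 𝒬
  step : ∀ s ∈ 𝒬, ∀ a t, r a t → a ∉ s → ∃ s' ∈ 𝒬, ∃ s'', Transition r n a t s s'' ∧
    asc r n s' = asc r n s'' ∧ ∀ c, c ∈ s' ↔ c ∈ s''

theorem rises_succ (f : ℕ → ℕ) (p : ℕ) :
    rises r f (p + 2) = rises r f (p + 1) + if r (f p) (f (p + 1)) then 1 else 0 := by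
  unfold rises
  simp only [Nat.add_sub_cancel, show p + 2 - 1 = p + 1 from rfl]
  rw [Finset.range_add_one, Finset.filter_insert]
  split_ifs with h
  · rw [Finset.card_insert_of_notMem (by simp)]
  · rfl

/-- Within a run `f s, …, f p` of consecutive comparable elements, `rises` grows by one per step. -/
theorem exists_run (f : ℕ → ℕ) (p : ℕ) : ∃ s ≤ p, (∀ i, s ≤ i → i < p → r (f i) (f (i + 1))) ∧
    rises r f (p + 1) = rises r f s + (p - s) := by
  induction p with
  | zero => exact ⟨0, le_rfl, fun i h1 h2 => by omega, by simp [rises]⟩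
  | succ p ih =>
    by_cases h : r (f p) (f (p + 1))
    · obtain ⟨s, hs, h1, h2⟩ := ih
      refine ⟨s, by omega, fun i hi hip => ?_, ?_⟩
      · by_cases hi' : i < p
        · exact h1 i hi hi'
        · have : i = p := by omega
          rw [this]; exact h
      · rw [rises_succ, if_pos h, h2]; omega
    · refine ⟨p + 1, le_rfl, fun i h1 h2 => by omega, ?_⟩
      rw [rises_succ, if_neg h]; omega

theorem run_lt (hr : PosetOn n r) {f : ℕ → ℕ} {s p : ℕ}
    (h : ∀ i, s ≤ i → i < p → r (f i) (f (i + 1))) {i j : ℕ} (hi : s ≤ i) (hij : i < j)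
    (hj : j ≤ p) : r (f i) (f j) := by
  induction j with
  | zero => omega
  | succ j ih =>
    rcases Nat.lt_or_ge i j with h1 | h1
    · exact hr.trans (ih h1 (by omega)) (h j (by omega) (by omega))
    · have : i = j := by omega
      rw [this]; exact h j (by omega) (by omega)

/-- Every prefix of a linear extension `f` is matched by a list of the family: it contains only
elements of the prefix and has at least as many comparable neighbours. -/
theorem SearchClosed.exists_ge (hr : PosetOn n r) {𝒬 : Set (List ℕ)} (hQ : SearchClosed r n 𝒬)
    {f : ℕ → ℕ} (hlt : ∀ i, i < n → f i < n) (hinj : ∀ i j, i < n → j < n → f i = f j → i = j)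
    (hsurj : ∀ c, c < n → ∃ i, i < n ∧ f i = c)
    (hext : ∀ i j, i < n → j < n → r (f i) (f j) → i < j) (p : ℕ) (hp : p ≤ n) :
    ∃ s ∈ 𝒬, (∀ c ∈ s, ∃ i, i < p ∧ f i = c) ∧ rises r f p ≤ asc r n s := by
  induction p using Nat.strong_induction_on with
  | _ p ih =>
    rcases p with _ | p
    · exact ⟨[], hQ.nil_mem, by simp, by simp [rises]⟩
    obtain ⟨k, hkp, hrun, hk⟩ := exists_run (r := r) f p
    obtain ⟨s, hs, hsm, hsa⟩ := ih k (by omega) (by omega)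
    rcases Nat.eq_or_lt_of_le hkp with rfl | hkp
    · refine ⟨s, hs, fun c hc => ?_, by omega⟩
      obtain ⟨i, hi, hc⟩ := hsm c hc
      exact ⟨i, by omega, hc⟩
    have hat : r (f k) (f p) := run_lt hr hrun le_rfl hkp le_rfl
    have hnot : ∀ i, k ≤ i → i ≤ p → f i ∉ s := by
      intro i hki hip hc
      obtain ⟨j, hj, he⟩ := hsm _ hc
      have := hinj j i (by omega) (by omega) he
      omega
    obtain ⟨s', hs', s'', htr, ha, hm⟩ := hQ.step s hs (f k) (f p) hat (hnot k le_rfl hkp.le)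
    have hft := hlt p (by omega)
    refine ⟨s', hs', fun c hc => ?_, ?_⟩
    · rcases (htr.mem hr hft c).1 ((hm c).1 hc) with h | h
      · obtain ⟨i, hi, hc⟩ := hsm c h
        exact ⟨i, by omega, hc⟩
      · obtain ⟨i, hi, rfl⟩ := hsurj c (h.lt_left hr hft)
        refine ⟨i, ?_, rfl⟩
        rcases h with h | h
        · have := hinj i p hi (by omega) h
          omega
        · have := hext i p hi (by omega) h
          omega
    · have hI := htr.asc_ge hr hft ((Finset.Icc k p).image f) ?_ ?_ ?_ ?_
      · rw [Finset.card_image_of_injOn] at hI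
        · simp only [Nat.card_Icc] at hI
          omega
        · intro i hi j hj he
          simp only [Finset.coe_Icc, Set.mem_Icc] at hi hj
          exact hinj i j (by omega) (by omega) he
      · intro c hc
        obtain ⟨i, hi, rfl⟩ := Finset.mem_image.1 hc
        rw [Finset.mem_Icc] at hi
        constructor
        · rcases Nat.eq_or_lt_of_le hi.1 with rfl | h
          · exact Le.refl _
          · exact Or.inr (run_lt hr hrun le_rfl h hi.2)
        · rcases Nat.eq_or_lt_of_le hi.2 with rfl | h
          · exact Le.refl _
          · exact Or.inr (run_lt hr hrun hi.1 h le_rfl)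
      · intro c hac hct
        obtain ⟨i, hi, rfl⟩ := hsurj c (hct.lt_left hr hft)
        refine Finset.mem_image.2 ⟨i, Finset.mem_Icc.2 ⟨?_, ?_⟩, rfl⟩
        · rcases hac with h | h
          · exact (hinj k i (by omega) hi h).le
          · exact (hext k i (by omega) hi h).le
        · rcases hct with h | h
          · exact (hinj i p hi (by omega) h).le
          · exact (hext i p hi (by omega) h).le
      · intro c hc
        obtain ⟨i, hi, rfl⟩ := Finset.mem_image.1 hc
        rw [Finset.mem_Icc] at hi
        exact hnot i hi.1 hi.2
      · intro c hc d hd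
        obtain ⟨i, hi, rfl⟩ := Finset.mem_image.1 hc
        obtain ⟨j, hj, rfl⟩ := Finset.mem_image.1 hd
        rw [Finset.mem_Icc] at hi hj
        rcases lt_trichotomy i j with h | rfl | h
        · exact Or.inl (run_lt hr hrun hi.1 h hj.2)
        · exact Or.inr (Or.inl rfl)
        · exact Or.inr (Or.inr (run_lt hr hrun hj.1 h hi.2))

end JumpNumber

namespace JumpNumber

variable {n : ℕ} {r : ℕ → ℕ → Prop}

/-! ### The number of sets the search visits -/

/-- A list of pairwise disjoint comparable pairs, that is, a matching of the comparability graph. -/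
structure IsMatching (r : ℕ → ℕ → Prop) (L : List (ℕ × ℕ)) : Prop where
  lt : ∀ p ∈ L, r p.1 p.2
  nodup : (L.flatMap fun p => [p.1, p.2]).Nodup

/-- `D` is the down-set generated by a set `T` of at most as many elements as there are pairs in
some matching inside `D`. -/
def FewTops (r : ℕ → ℕ → Prop) (D : Set ℕ) : Prop :=
  ∃ (T : Finset ℕ) (L : List (ℕ × ℕ)), T.card ≤ L.length ∧ (∀ c, c ∈ D ↔ ∃ t ∈ T, Le r c t) ∧
    IsMatching r L ∧ ∀ p ∈ L, p.1 ∈ D ∧ p.2 ∈ D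

theorem fewTops_empty : FewTops r ∅ :=
  ⟨∅, [], by simp, by simp, ⟨by simp, by simp⟩, by simp⟩

/-- A transition adds the generator `t` and the disjoint pair `(a, t)`. -/
theorem FewTops.transition (hr : PosetOn n r) {a t : ℕ} {s s' : List ℕ}
    (hs : FewTops r {c | c ∈ s}) (hext : Ext r s) (hat : r a t) (ha : a ∉ s)
    (h : Transition r n a t s s') : FewTops r {c | c ∈ s'} := by
  obtain ⟨T, L, hTL, hT, hL, hLs⟩ := hs
  have ht : t ∉ s := fun ht => ha (hext.mem_of_lt ht hat)
  have hmem := h.mem hr (hr.lt_right hat)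
  refine ⟨insert t T, (a, t) :: L, (Finset.card_insert_le _ _).trans (by simpa using hTL), ?_,
    ⟨?_, ?_⟩, ?_⟩
  · intro c
    rw [Set.mem_ofPred_eq, hmem, ← Set.mem_ofPred_eq (p := fun c => c ∈ s), hT]
    simp only [Finset.mem_insert, exists_eq_or_imp]
    exact or_comm
  · intro p hp
    rcases List.mem_cons.1 hp with rfl | hp
    · exact hat
    · exact hL.lt p hp
  · have hne : a ≠ t := fun e => hr.irrefl _ (e ▸ hat)
    have hout : ∀ x, x ∉ s → x ∉ L.flatMap fun p => [p.1, p.2] := by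
      intro x hx hx'
      obtain ⟨p, hp, hxp⟩ := List.mem_flatMap.1 hx'
      have h1 := hLs p hp
      simp only [List.mem_cons, List.not_mem_nil, or_false] at hxp
      rcases hxp with rfl | rfl
      · exact hx h1.1
      · exact hx h1.2
    rw [List.flatMap_cons]
    simp only [List.cons_append, List.nil_append, List.nodup_cons, List.mem_cons]
    exact ⟨by rintro (h | h); exacts [hne h, hout a ha h], hout t ht, hL.nodup⟩
  · intro p hp
    rcases List.mem_cons.1 hp with rfl | hp
    · exact ⟨(hmem _).2 (Or.inr (Or.inr hat)), (hmem _).2 (Or.inr (Le.refl _))⟩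
    · exact ⟨(hmem _).2 (Or.inl (hLs p hp).1), (hmem _).2 (Or.inl (hLs p hp).2)⟩

theorem IsMatching.length_le (hr : PosetOn n r) {L : List (ℕ × ℕ)} (hL : IsMatching r L) :
    2 * L.length ≤ n := by
  have h : (L.flatMap fun p => [p.1, p.2]).length ≤ n := by
    refine length_le_of_lt hL.nodup fun c hc => ?_
    obtain ⟨p, hp, hc⟩ := List.mem_flatMap.1 hc
    simp only [List.mem_cons, List.not_mem_nil, or_false] at hc
    rcases hc with rfl | rfl
    · exact hr.lt_left (hL.lt p hp)
    · exact hr.lt_right (hL.lt p hp)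
  simp only [List.length_flatMap, List.length_cons, List.length_nil] at h
  simp at h
  omega

/-- A down-set generated by `T` is generated by an antichain of at most as many elements. -/
theorem exists_antichain (hr : PosetOn n r) {D : Set ℕ} (k : ℕ) : ∀ T : Finset ℕ, T.card ≤ k →
    (∀ c, c ∈ D ↔ ∃ t ∈ T, Le r c t) → ∃ T' : Finset ℕ, T'.card ≤ k ∧
      (∀ c, c ∈ D ↔ ∃ t ∈ T', Le r c t) ∧ ∀ a ∈ T', ∀ b ∈ T', ¬ r a b := by
  induction k with
  | zero =>
    intro T hT h
    have : T = ∅ := by simpa using hT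
    subst this
    exact ⟨∅, by simp, h, by simp⟩
  | succ k ih =>
    intro T hT h
    by_cases hanti : ∀ a ∈ T, ∀ b ∈ T, ¬ r a b
    · exact ⟨T, hT, h, hanti⟩
    push Not at hanti
    obtain ⟨a, ha, b, hb, hab⟩ := hanti
    have hne : b ≠ a := fun e => hr.irrefl _ (e ▸ hab)
    obtain ⟨T', h1, h2, h3⟩ := ih (T.erase a)
      (by rw [Finset.card_erase_of_mem ha]; omega) (by
        intro c
        rw [h]
        constructor
        · rintro ⟨t, ht, hct⟩
          by_cases hta : t = a
          · subst hta
            exact ⟨b, Finset.mem_erase.2 ⟨hne, hb⟩, hct.trans hr (Or.inr hab)⟩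
          · exact ⟨t, Finset.mem_erase.2 ⟨hta, ht⟩, hct⟩
        · rintro ⟨t, ht, hct⟩
          exact ⟨t, Finset.mem_of_mem_erase ht, hct⟩)
    exact ⟨T', h1.trans (Nat.le_succ k), h2, h3⟩

/-- The set `A` contains at most one element of each pair in `L`. -/
def AvoidsPairs (L : List (ℕ × ℕ)) (A : Finset ℕ) : Prop := ∀ p ∈ L, ¬ (p.1 ∈ A ∧ p.2 ∈ A)

/-- The generating function, by cardinality, of the subsets of `X` that contain at most one element
of each pair of a matching `L`: a pair contributes the factor `1 + 2 * x`, any other element the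
factor `1 + x`. -/
theorem sum_pow_card_le {x : ℝ} (hx : 0 ≤ x) (L : List (ℕ × ℕ)) : ∀ X : Finset ℕ,
    (∀ p ∈ L, p.1 ∈ X ∧ p.2 ∈ X) → (L.flatMap fun p => [p.1, p.2]).Nodup →
    (∑ A ∈ X.powerset.filter (AvoidsPairs L), x ^ A.card) *
      ((1 + x) ^ 2) ^ L.length ≤ (1 + 2 * x) ^ L.length * (1 + x) ^ X.card := by
  induction L with
  | nil =>
    intro X _ _
    have h := Finset.sum_pow_mul_eq_add_pow x (1 : ℝ) X
    simp only [one_pow, mul_one] at h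
    rw [Finset.filter_true_of_mem fun A _ => by simp [AvoidsPairs]]
    simp [h, add_comm]
  | cons p L ih =>
    intro X hX hnd
    obtain ⟨a, b⟩ := p
    have hab := hX (a, b) (by simp)
    simp only [List.flatMap_cons, List.cons_append, List.nil_append, List.nodup_cons,
      List.mem_cons, not_or] at hnd
    obtain ⟨⟨hne, haL⟩, hbL, hndL⟩ := hnd
    set Y := (X.erase a).erase b with hY
    have haY : a ∉ Y := by simp [hY]
    have hbY : b ∉ Y := by simp [hY]
    have hXY : X = insert a (insert b Y) := by
      rw [hY, Finset.insert_erase (Finset.mem_erase.2 ⟨fun e => hne e.symm, hab.2⟩),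
        Finset.insert_erase hab.1]
    have hYL : ∀ p ∈ L, p.1 ∈ Y ∧ p.2 ∈ Y := by
      intro p hp
      have hpX := hX p (List.mem_cons_of_mem _ hp)
      have h1 : p.1 ∈ L.flatMap fun p => [p.1, p.2] := List.mem_flatMap.2 ⟨p, hp, by simp⟩
      have h2 : p.2 ∈ L.flatMap fun p => [p.1, p.2] := List.mem_flatMap.2 ⟨p, hp, by simp⟩
      refine ⟨?_, ?_⟩
      · exact Finset.mem_erase.2 ⟨fun e => hbL (e ▸ h1),
          Finset.mem_erase.2 ⟨fun e => haL (e ▸ h1), hpX.1⟩⟩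
      · exact Finset.mem_erase.2 ⟨fun e => hbL (e ▸ h2),
          Finset.mem_erase.2 ⟨fun e => haL (e ▸ h2), hpX.2⟩⟩
    have ih' := ih Y hYL hndL
    set Z := ∑ A ∈ Y.powerset.filter (AvoidsPairs L), x ^ A.card
    have hsum : ∑ A ∈ X.powerset.filter (AvoidsPairs ((a, b) :: L)),
        x ^ A.card ≤ (1 + 2 * x) * Z := by
      have habY : a ∉ insert b Y := by simp [hne, haY]
      rw [Finset.sum_filter, hXY, Finset.sum_powerset_insert habY,
        Finset.sum_powerset_insert hbY, Finset.sum_powerset_insert hbY]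
      have hZ : Z = ∑ A ∈ Y.powerset,
          if AvoidsPairs L A then x ^ A.card else 0 := Finset.sum_filter _ _
      have e : (1 + 2 * x) * Z = (Z + x * Z) + (x * Z + 0) := by ring
      rw [e, hZ, Finset.mul_sum]
      have key : ∀ A ∈ Y.powerset, ∀ B : Finset ℕ, A ⊆ B → ∀ y : ℝ, 0 ≤ y →
          (if AvoidsPairs ((a, b) :: L) B then y else 0) ≤
          if AvoidsPairs L A then y else 0 := by
        intro A _ B hAB y hy
        by_cases h : AvoidsPairs ((a, b) :: L) B
        · have h' : AvoidsPairs L A := fun p hp hpA =>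
            h p (List.mem_cons_of_mem _ hp) ⟨hAB hpA.1, hAB hpA.2⟩
          rw [if_pos h, if_pos h']
        · rw [if_neg h]
          split_ifs <;> simp [hy]
      have cardb : ∀ A ∈ Y.powerset, (insert b A).card = A.card + 1 := fun A hA =>
        Finset.card_insert_of_notMem fun h => hbY (Finset.mem_powerset.1 hA h)
      have carda : ∀ A ∈ Y.powerset, (insert a A).card = A.card + 1 := fun A hA =>
        Finset.card_insert_of_notMem fun h => haY (Finset.mem_powerset.1 hA h)
      refine add_le_add (add_le_add ?_ ?_) (add_le_add ?_ (le_of_eq ?_))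
      · refine Finset.sum_le_sum fun A hA => ?_
        exact key A hA A subset_rfl _ (by positivity)
      · refine Finset.sum_le_sum fun A hA => ?_
        rw [cardb A hA, pow_succ', mul_ite, mul_zero]
        exact key A hA _ (Finset.subset_insert _ _) _ (by positivity)
      · refine Finset.sum_le_sum fun A hA => ?_
        rw [carda A hA, pow_succ', mul_ite, mul_zero]
        exact key A hA _ (Finset.subset_insert _ _) _ (by positivity)
      · refine Finset.sum_eq_zero fun A _ => if_neg fun h => ?_
        exact h (a, b) (by simp) ⟨by simp, by simp⟩
    have hcard : X.card = Y.card + 2 := by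
      rw [hXY, Finset.card_insert_of_notMem (by simp [hne, haY]), Finset.card_insert_of_notMem hbY]
    rw [hcard, List.length_cons]
    calc _ ≤ ((1 + 2 * x) * Z) * ((1 + x) ^ 2) ^ (L.length + 1) := by gcongr
      _ = ((1 + 2 * x) * (1 + x) ^ 2) * (Z * ((1 + x) ^ 2) ^ L.length) := by ring
      _ ≤ ((1 + 2 * x) * (1 + x) ^ 2) * ((1 + 2 * x) ^ L.length * (1 + x) ^ Y.card) := by gcongr
      _ = _ := by ring

/-- Compare every set with a maximum matching of `m` pairs: each of the sets is generated by an
antichain of at most `m` elements, which contains at most one element of each pair. For `x = 0.802`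
the weight `x ^ m` of such an antichain compensates the factors `1 + 2 * x ≤ x * (1 + x) ^ 2` of the
pairs, so that `(1 + x) ^ n` bounds their number whatever `m` is. -/
theorem card_fewTops_le (hr : PosetOn n r) (𝓓 : Finset (Finset ℕ))
    (h𝓓 : ∀ D ∈ 𝓓, (∀ c ∈ D, c < n) ∧ FewTops r (D : Set ℕ)) :
    (𝓓.card : ℝ) ≤ (1.802 : ℝ) ^ n := by
  obtain ⟨L, hL, hmax⟩ : ∃ L, IsMatching r L ∧ ∀ L', IsMatching r L' → L'.length ≤ L.length := by
    let P : ℕ → Prop := fun k => ∃ L, IsMatching r L ∧ L.length = k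
    have h0 : P 0 := ⟨[], ⟨by simp, by simp⟩, rfl⟩
    obtain ⟨L, hL, hl⟩ := Nat.findGreatest_spec (Nat.zero_le n) h0
    refine ⟨L, hL, fun L' hL' => ?_⟩
    rw [hl]
    have := hL'.length_le hr
    exact Nat.le_findGreatest (by omega) ⟨L', hL', rfl⟩
  have hT : ∀ D ∈ 𝓓, ∃ T : Finset ℕ, T.card ≤ L.length ∧ (∀ c, c ∈ D ↔ ∃ t ∈ T, Le r c t) ∧
      ∀ a ∈ T, ∀ b ∈ T, ¬ r a b := by
    intro D hD
    obtain ⟨T, L', h1, h2, h3, -⟩ := (h𝓓 D hD).2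
    exact exists_antichain hr L.length T (h1.trans (hmax L' h3)) h2
  choose! T hTc hTD hTa using hT
  set F := (Finset.range n).powerset.filter (AvoidsPairs L)
  have hTF : ∀ D ∈ 𝓓, T D ∈ F := by
    intro D hD
    refine Finset.mem_filter.2 ⟨Finset.mem_powerset.2 fun t ht => ?_, fun p hp h => ?_⟩
    · exact Finset.mem_range.2 ((h𝓓 D hD).1 t ((hTD D hD t).2 ⟨t, ht, Le.refl t⟩))
    · exact hTa D hD _ h.1 _ h.2 (hL.lt p hp)
  have hinj : Set.InjOn T 𝓓 := by
    intro D hD D' hD' h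
    ext c
    rw [hTD D hD, hTD D' hD', h]
  have hsum := sum_pow_card_le (x := 0.802) (by norm_num) L (Finset.range n)
    (fun p hp => ⟨Finset.mem_range.2 (hr.lt_left (hL.lt p hp)),
      Finset.mem_range.2 (hr.lt_right (hL.lt p hp))⟩) hL.nodup
  rw [Finset.card_range] at hsum
  have hle : (𝓓.card : ℝ) * 0.802 ^ L.length ≤ ∑ A ∈ F, (0.802 : ℝ) ^ A.card := by
    calc (𝓓.card : ℝ) * 0.802 ^ L.length = ∑ D ∈ 𝓓, (0.802 : ℝ) ^ L.length := by simp
      _ ≤ ∑ D ∈ 𝓓, (0.802 : ℝ) ^ (T D).card := by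
          refine Finset.sum_le_sum fun D hD => ?_
          exact pow_le_pow_of_le_one (by norm_num) (by norm_num) (hTc D hD)
      _ = ∑ A ∈ 𝓓.image T, (0.802 : ℝ) ^ A.card := by rw [Finset.sum_image hinj]
      _ ≤ _ := Finset.sum_le_sum_of_subset_of_nonneg
          (fun A hA => by
            obtain ⟨D, hD, rfl⟩ := Finset.mem_image.1 hA
            exact hTF D hD) (fun _ _ _ => by positivity)
  have hpos : (0 : ℝ) < (0.802 * (1 + 0.802) ^ 2) ^ L.length := by positivity
  refine le_of_mul_le_mul_right ?_ hpos
  calc (𝓓.card : ℝ) * (0.802 * (1 + 0.802) ^ 2) ^ L.length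
      = (𝓓.card * 0.802 ^ L.length) * ((1 + 0.802) ^ 2) ^ L.length := by rw [mul_pow]; ring
    _ ≤ (∑ A ∈ F, (0.802 : ℝ) ^ A.card) * ((1 + 0.802) ^ 2) ^ L.length := by gcongr
    _ ≤ (1 + 2 * 0.802) ^ L.length * (1 + 0.802) ^ n := hsum
    _ ≤ (0.802 * (1 + 0.802) ^ 2) ^ L.length * (1 + 0.802) ^ n := by gcongr; norm_num
    _ = 1.802 ^ n * (0.802 * (1 + 0.802) ^ 2) ^ L.length := by rw [mul_comm]; norm_num

end JumpNumber

/-! ### Verification of random access machine programs -/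

infixr:60 " ;; " => RAMProg.seq

/- The cells used as variables: the number `n` of elements, the constants `1` and `0`, the addresses
of the order table, of the table of visited sets, of the list being expanded, of the free space
behind the last list and of the best list, the number of cells from the expanded list to the free
space, and the pair `(a, t)` of the current transition. -/
notation "rN" => 0
notation "rOne" => 1
notation "rZero" => 2
notation "rTab" => 3
notation "rVis" => 4
notation "rHead" => 5
notation "rTail" => 6
notation "rBest" => 7
notation "rMain" => 8
notation "rA" => 9
notation "rT" => 10

/- The list under construction: its number of comparable neighbours, its length, its newest element;
then the loop variables, the result of `countProg`, the shared loop counter, the result of `leProg`,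
and auxiliary variables. -/
notation "rAsc" => 11
notation "rLen" => 12
notation "rLast" => 13
notation "rKey" => 14
notation "rC" => 15
notation "rD" => 16
notation "rCnt" => 17
notation "rLoop" => 18
notation "rLe" => 19
notation "rU" => 20
notation "rV" => 21
notation "rW" => 22

namespace JumpNumber

/-- The largest number that occurs in the text of a program. -/
def maxConst : RAMProg → ℕ
  | .skip => 0
  | .const d c => max d c
  | .add d a b => max d (max a b)
  | .sub d a b => max d (max a b)
  | .load d a => max d a
  | .store d a => max d a
  | .seq p q => max (maxConst p) (maxConst q)
  | .ite a p q => max a (max (maxConst p) (maxConst q))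
  | .loop a p => max a (maxConst p)

/-- The number of instructions and tests that a run of the program performs at most, when every
execution of a loop has at most `N` rounds. -/
def cost (N : ℕ) : RAMProg → ℕ
  | .seq p q => cost N p + cost N q
  | .ite _ p q => cost N p + cost N q + 1
  | .loop _ p => N * (cost N p + 1) + 1
  | _ => 1

theorem bitLen_mono {a b : ℕ} (h : a ≤ b) : bitLen a ≤ bitLen b :=
  Nat.add_le_add_right (Nat.log_mono_right h) 1

theorem one_le_bitLen (a : ℕ) : 1 ≤ bitLen a := Nat.le_add_left 1 _

/-- Weakest precondition: started on a memory `M` with values at most `W`, the program `p` halts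
within the time `cost N p` for operands up to `W`, keeps all values at most `W`, and arrives at a
memory satisfying `Q`. The bound on the constants of `p` is part of the premise. -/
def WP (N W : ℕ) (p : RAMProg) (Q : (ℕ → ℕ) → Prop) (M : ℕ → ℕ) : Prop :=
  maxConst p ≤ W → (∀ k, M k ≤ W) →
    ∃ M' t, p.Run M M' t ∧ t ≤ cost N p * (5 * bitLen W) ∧ (∀ k, M' k ≤ W) ∧ Q M'

variable {N W : ℕ} {p q : RAMProg} {Q Q' : (ℕ → ℕ) → Prop} {M : ℕ → ℕ}

theorem WP.mono (h : WP N W p Q M) (hQ : ∀ M', Q M' → Q' M') : WP N W p Q' M := by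
  intro hp hM
  obtain ⟨M', t, h1, h2, h3, h4⟩ := h hp hM
  exact ⟨M', t, h1, h2, h3, hQ _ h4⟩

theorem wp_bdd (h : (∀ k, M k ≤ W) → WP N W p Q M) : WP N W p Q M :=
  fun hp hM => h hM hp hM

theorem update_le {k v : ℕ} (hM : ∀ k, M k ≤ W) (hv : v ≤ W) : ∀ j, Function.update M k v j ≤ W := by
  intro j
  by_cases h : j = k
  · subst h; simpa using hv
  · simpa [Function.update_of_ne h] using hM j

theorem wp_skip (h : Q M) : WP N W .skip Q M := by
  intro _ hM
  refine ⟨M, 1, .skip M, ?_, hM, h⟩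
  have := one_le_bitLen W
  simp only [cost]; omega

theorem wp_const {d c : ℕ} (h : Q (Function.update M d c)) : WP N W (.const d c) Q M := by
  intro hp hM
  simp only [maxConst, max_le_iff] at hp
  refine ⟨_, _, .const d c M, ?_, update_le hM hp.2, h⟩
  have h1 := bitLen_mono hp.1
  have h2 := bitLen_mono hp.2
  simp only [cost]; omega

theorem wp_add {d a b : ℕ} (hs : M a + M b ≤ W) (h : Q (Function.update M d (M a + M b))) :
    WP N W (.add d a b) Q M := by
  intro hp hM
  simp only [maxConst, max_le_iff] at hp
  refine ⟨_, _, .add d a b M, ?_, update_le hM hs, h⟩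
  have h1 := bitLen_mono hp.1
  have h2 := bitLen_mono hp.2.1
  have h3 := bitLen_mono hp.2.2
  have h4 := bitLen_mono (hM a)
  have h5 := bitLen_mono (hM b)
  simp only [cost]; omega

theorem wp_sub {d a b : ℕ} (h : Q (Function.update M d (M a - M b))) :
    WP N W (.sub d a b) Q M := by
  intro hp hM
  simp only [maxConst, max_le_iff] at hp
  refine ⟨_, _, .sub d a b M, ?_, update_le hM ((Nat.sub_le _ _).trans (hM a)), h⟩
  have h1 := bitLen_mono hp.1
  have h2 := bitLen_mono hp.2.1
  have h3 := bitLen_mono hp.2.2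
  have h4 := bitLen_mono (hM a)
  have h5 := bitLen_mono (hM b)
  simp only [cost]; omega

theorem wp_load {d a : ℕ} (h : Q (Function.update M d (M (M a)))) : WP N W (.load d a) Q M := by
  intro hp hM
  simp only [maxConst, max_le_iff] at hp
  refine ⟨_, _, .load d a M, ?_, update_le hM (hM _), h⟩
  have h1 := bitLen_mono hp.1
  have h2 := bitLen_mono hp.2
  have h3 := bitLen_mono (hM a)
  have h4 := bitLen_mono (hM (M a))
  simp only [cost]; omega

theorem wp_store {d a : ℕ} (h : Q (Function.update M (M d) (M a))) : WP N W (.store d a) Q M := by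
  intro hp hM
  simp only [maxConst, max_le_iff] at hp
  refine ⟨_, _, .store d a M, ?_, update_le hM (hM _), h⟩
  have h1 := bitLen_mono hp.1
  have h2 := bitLen_mono hp.2
  have h3 := bitLen_mono (hM d)
  have h4 := bitLen_mono (hM a)
  simp only [cost]; omega

theorem wp_add_eq {d a b v : ℕ} (hv : M a + M b = v) (hs : v ≤ W)
    (h : Q (Function.update M d v)) : WP N W (.add d a b) Q M := by
  subst hv
  exact wp_add hs h

theorem wp_store_eq {d a k v : ℕ} (hk : M d = k) (hv : M a = v)
    (h : Q (Function.update M k v)) : WP N W (.store d a) Q M := by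
  subst hk hv
  exact wp_store h

theorem wp_seq (h : WP N W p (fun M' => WP N W q Q M') M) : WP N W (p ;; q) Q M := by
  intro hp hM
  simp only [maxConst, max_le_iff] at hp
  obtain ⟨M1, t1, h1, h2, h3, h4⟩ := h hp.1 hM
  obtain ⟨M2, t2, h5, h6, h7, h8⟩ := h4 hp.2 h3
  refine ⟨M2, t1 + t2, .seq h1 h5, ?_, h7, h8⟩
  simp only [cost, add_mul]
  exact Nat.add_le_add h2 h6

theorem wp_ite {a : ℕ} (h1 : M a ≠ 0 → WP N W p Q M) (h2 : M a = 0 → WP N W q Q M) :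
    WP N W (.ite a p q) Q M := by
  intro hp hM
  simp only [maxConst, max_le_iff] at hp
  have ha := bitLen_mono hp.1
  have hMa := bitLen_mono (hM a)
  by_cases h : M a = 0
  · obtain ⟨M', t, h3, h4, h5, h6⟩ := h2 h hp.2.2 hM
    refine ⟨M', _, .ite_neg h h3, ?_, h5, h6⟩
    simp only [cost, add_mul]; omega
  · obtain ⟨M', t, h3, h4, h5, h6⟩ := h1 h hp.2.1 hM
    refine ⟨M', _, .ite_pos h h3, ?_, h5, h6⟩
    simp only [cost, add_mul]; omega

/-- A loop with invariant `I` that is left after at most `k` rounds; here `k` may exceed `N`. -/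
theorem run_loop {a : ℕ} {I : ℕ → (ℕ → ℕ) → Prop} (hp : maxConst (.loop a p) ≤ W)
    (hstep : ∀ k M, I k M → M a ≠ 0 → ∃ j, j + 1 = k ∧ WP N W p (I j) M)
    (hend : ∀ k M, I k M → M a = 0 → Q M) :
    ∀ k M, I k M → (∀ k, M k ≤ W) → ∃ M' t, (RAMProg.loop a p).Run M M' t ∧
      t ≤ (k * (cost N p + 1) + 1) * (5 * bitLen W) ∧ (∀ k, M' k ≤ W) ∧ Q M' := by
  intro k
  simp only [maxConst, max_le_iff] at hp
  have ha := bitLen_mono hp.1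
  induction k with
  | zero =>
    intro M hI hM
    have hMa := bitLen_mono (hM a)
    by_cases h : M a = 0
    · exact ⟨M, _, .loop_done h, by omega, hM, hend _ M hI h⟩
    · obtain ⟨j, hj, -⟩ := hstep _ M hI h
      omega
  | succ k ih =>
    intro M hI hM
    have hMa := bitLen_mono (hM a)
    by_cases h : M a = 0
    · refine ⟨M, _, .loop_done h, ?_, hM, hend _ M hI h⟩
      calc _ ≤ 1 * (5 * bitLen W) := by omega
        _ ≤ _ := Nat.mul_le_mul_right _ (by omega)
    · obtain ⟨j, hj, hwp⟩ := hstep _ M hI h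
      obtain rfl : j = k := by omega
      obtain ⟨M1, t1, h1, h2, h3, h4⟩ := hwp hp.2 hM
      obtain ⟨M2, t2, h5, h6, h7, h8⟩ := ih M1 h4 h3
      refine ⟨M2, _, .loop_step h h1 h5, ?_, h7, h8⟩
      have e : ((j + 1) * (cost N p + 1) + 1) * (5 * bitLen W) =
        cost N p * (5 * bitLen W) + 5 * bitLen W +
          (j * (cost N p + 1) + 1) * (5 * bitLen W) := by ring
      rw [e]; omega

theorem wp_loop {a k : ℕ} {I : ℕ → (ℕ → ℕ) → Prop} (hk : k ≤ N)
    (hstep : ∀ k M, I k M → M a ≠ 0 → ∃ j, j + 1 = k ∧ WP N W p (I j) M)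
    (hend : ∀ k M, I k M → M a = 0 → Q M) (h0 : I k M) : WP N W (.loop a p) Q M := by
  intro hp hM
  obtain ⟨M', t, h1, h2, h3, h4⟩ := run_loop hp hstep hend k M h0 hM
  refine ⟨M', t, h1, h2.trans ?_, h3, h4⟩
  simp only [cost]
  gcongr

/-- For `i` from `0` to `M lim - 1` do `body`. The cell `rOne` has to hold `1`; `rLoop` counts
the remaining rounds, but is set only after `body`, so that nested loops can share it. -/
def forLoop (i lim : ℕ) (body : RAMProg) : RAMProg :=
  .const i 0 ;; .sub rLoop lim i ;; .loop rLoop (body ;; .add i i rOne ;; .sub rLoop lim i)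

theorem wp_for {i lim L : ℕ} {body : RAMProg} (I : ℕ → (ℕ → ℕ) → Prop)
    (hreg : i ≠ lim ∧ i ≠ rLoop ∧ i ≠ rOne ∧ lim ≠ rLoop) (hlim : M lim = L) (hone : M rOne = 1)
    (hL : L ≤ N)
    (h0 : ∀ g, I 0 (Function.update (Function.update M i 0) rLoop g))
    (hbody : ∀ k < L, ∀ M, I k M → M i = k → M lim = L → M rOne = 1 →
      WP N W body (fun M' => M' i = k ∧ M' lim = L ∧ M' rOne = 1 ∧
        ∀ g, I (k + 1) (Function.update (Function.update M' i (k + 1)) rLoop g)) M)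
    (hend : ∀ M', I L M' → M' lim = L → M' rOne = 1 → Q M') : WP N W (forLoop i lim body) Q M := by
  obtain ⟨e1, e2, e3, e4⟩ := hreg
  refine wp_seq (wp_const (wp_seq (wp_sub ?_)))
  refine wp_loop (k := L) (I := fun j M => ∃ k, k + j = L ∧ I k M ∧ M i = k ∧ M lim = L ∧ M rOne = 1 ∧
    M rLoop = j) hL ?_ ?_ ⟨0, by omega, h0 _, ?_⟩
  · rintro j M ⟨k, hkj, hI, hi, hl, ho, hg⟩ hne
    refine ⟨j - 1, by omega, wp_seq ((hbody k (by omega) M hI hi hl ho).mono ?_)⟩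
    rintro M' ⟨h1, h2, h3, h4⟩
    refine wp_seq (wp_bdd fun hM' => wp_add ?_ (wp_sub ?_))
    · have := hM' lim
      omega
    · refine ⟨k + 1, by omega, ?_⟩
      rw [h1, h3]
      refine ⟨h4 _, ?_⟩
      simp [Function.update_of_ne, e2, e4, e1.symm, e3.symm, h2, h3]
      omega
  · rintro j M ⟨k, hkj, hI, hi, hl, ho, hg⟩ hz
    have : k = L := by omega
    subst this
    exact hend M hI hl ho
  · simp [Function.update_of_ne, e2, e4, e1.symm, e3.symm, hlim, hone]

/-- `M'` agrees with `M` outside the cells `lo, …, hi - 1`. -/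
def Frame (lo hi : ℕ) (M M' : ℕ → ℕ) : Prop := ∀ x, x < lo ∨ hi ≤ x → M' x = M x

theorem Frame.refl (lo hi : ℕ) (M : ℕ → ℕ) : Frame lo hi M M := fun _ _ => rfl

theorem Frame.update {lo hi d v : ℕ} {M M' : ℕ → ℕ} (h : Frame lo hi M M') (hd : lo ≤ d ∧ d < hi) :
    Frame lo hi M (Function.update M' d v) := by
  intro x hx
  rw [Function.update_of_ne (by omega), h x hx]

theorem Frame.trans {lo hi lo' hi' : ℕ} {M M' M'' : ℕ → ℕ} (h : Frame lo hi M M')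
    (h' : Frame lo' hi' M' M'') (hl : lo ≤ lo' ∧ hi' ≤ hi) : Frame lo hi M M'' := by
  intro x hx
  rw [h' x (by omega), h x hx]

end JumpNumber

namespace JumpNumber

variable {n N W tb : ℕ} {r : ℕ → ℕ → Prop} {Q : (ℕ → ℕ) → Prop} {M : ℕ → ℕ}

/-! ### Reading the order -/

/-- The constants and the order table, which no part of the search changes. The row `n` of the
table is blank, so `n` can stand for a missing element. -/
structure Static (n : ℕ) (r : ℕ → ℕ → Prop) (tb W : ℕ) (M : ℕ → ℕ) : Prop where
  n_eq : M rN = n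
  one : M rOne = 1
  zero : M rZero = 0
  tab : M rTab = tb
  table : ∀ i j, i ≤ n → j < n → M (tb + n * i + j) = if r i j then 1 else 0
  ge : 23 ≤ tb
  le : tb + n * n + n + 23 ≤ W

theorem Static.congr {M' : ℕ → ℕ} (h : Static n r tb W M)
    (hM : ∀ x, x < 4 ∨ (tb ≤ x ∧ x < tb + n * n + n) → M' x = M x) : Static n r tb W M' where
  n_eq := by rw [hM _ (by omega), h.n_eq]
  one := by rw [hM _ (by omega), h.one]
  zero := by rw [hM _ (by omega), h.zero]
  tab := by rw [hM _ (by omega), h.tab]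
  table i j hi hj := by
    have := Nat.mul_le_mul_left n hi
    rw [hM _ (by omega), h.table i j hi hj]
  ge := h.ge
  le := h.le

theorem Static.frame {M' : ℕ → ℕ} {lo hi : ℕ} (h : Static n r tb W M) (hM : Frame lo hi M M')
    (hlo : 4 ≤ lo) (hhi : hi ≤ 23) : Static n r tb W M' :=
  h.congr fun x hx => hM x (by have := h.ge; omega)

/-- `rLe := 1` if the element in cell `x` is below or equal to that in cell `y`, otherwise `0`. -/
def leProg (x y : ℕ) : RAMProg :=
  .sub rU x y ;; .sub rV y x ;; .add rU rU rV ;;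
    .ite rU
      (.add rLe rTab rZero ;; .add rV x rZero ;;
        .loop rV (.add rLe rLe rN ;; .sub rV rV rOne) ;; .add rLe rLe y ;; .load rLe rLe)
      (.const rLe 1)

theorem wp_leProg {x y : ℕ} (hS : Static n r tb W M) (hx : x < 19) (hy : y < 19) (hxn : M x ≤ n)
    (hyn : M y < n) (hN : n ≤ N)
    (hQ : ∀ M', Frame 19 22 M M' → M' rLe = (if Le r (M x) (M y) then 1 else 0) → Q M') :
    WP N W (leProg x y) Q M := by
  have hge := hS.ge
  have hle := hS.le
  refine wp_seq (wp_sub (wp_seq (wp_sub (wp_seq (wp_add ?_ (wp_ite ?_ ?_))))))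
  · simp (disch := omega) only [Function.update_self, Function.update_of_ne]
    omega
  · simp (disch := omega) only [Function.update_self, Function.update_of_ne]
    intro hne
    have hxy : M x ≠ M y := by omega
    refine wp_seq (wp_add ?_ (wp_seq (wp_add ?_ (wp_seq ?_))))
    · simp (disch := omega) only [Function.update_self, Function.update_of_ne, hS.tab, hS.zero]
      omega
    · simp (disch := omega) only [Function.update_self, Function.update_of_ne, hS.zero]
      omega
    simp (disch := omega) only [Function.update_self, Function.update_of_ne, hS.tab, hS.zero,
      Nat.add_zero]
    refine wp_loop (k := M x) (I := fun j M1 => Frame 19 22 M M1 ∧ M1 rV = j ∧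
      ∃ k, k + j = M x ∧ M1 rLe = tb + n * k) (by omega) ?_ ?_ ?_
    · rintro j M1 ⟨hF, hj, k, hk, hl⟩ hne
      have h0 : M1 rN = n := by rw [hF _ (by omega), hS.n_eq]
      have h1 : M1 rOne = 1 := by rw [hF _ (by omega), hS.one]
      have hmul : n * (k + 1) ≤ n * n := Nat.mul_le_mul_left n (by omega)
      rw [Nat.mul_add] at hmul
      refine ⟨j - 1, by omega, wp_seq (wp_add ?_ (wp_sub ⟨?_, ?_, k + 1, by omega, ?_⟩))⟩
      · rw [hl, h0]; omega
      · exact (hF.update (by omega)).update (by omega)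
      · simp (disch := omega) only [Function.update_self, Function.update_of_ne]
        omega
      · simp (disch := omega) only [Function.update_self, Function.update_of_ne]
        rw [hl, h0]; ring
    · rintro j M1 ⟨hF, hj, k, hk, hl⟩ hz
      obtain rfl : k = M x := by omega
      have hmul : n * (M x) ≤ n * n := Nat.mul_le_mul_left n (by omega)
      refine wp_seq (wp_add ?_ (wp_load (hQ _ ?_ ?_)))
      · rw [hl, hF y (by omega)]; omega
      · exact (hF.update (by omega)).update (by omega)
      · have h2 : tb + n * M x + M y ≠ rLe := by omega
        simp (disch := omega) only [Function.update_self, hl, hF y (by omega)]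
        rw [Function.update_of_ne h2, hF _ (by omega), hS.table _ _ hxn hyn]
        simp only [Le, hxy, false_or]
    · refine ⟨?_, ?_, 0, by omega, ?_⟩
      · exact (((((Frame.refl _ _ _).update (by omega)).update (by omega)).update
          (by omega)).update (by omega)).update (by omega)
      · simp (disch := omega) only [Function.update_self]
      · simp (disch := omega) only [Function.update_self, Function.update_of_ne]
        omega
  · simp (disch := omega) only [Function.update_self, Function.update_of_ne]
    intro he
    have hxy : M x = M y := by omega
    refine wp_const (hQ _ ?_ ?_)
    · exact ((((Frame.refl _ _ _).update (by omega)).update (by omega)).update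
        (by omega)).update (by omega)
    · simp (disch := omega) only [Function.update_self, hxy, Le.refl, if_true]

end JumpNumber

namespace JumpNumber

variable {n N W tb : ℕ} {r : ℕ → ℕ → Prop} {Q : (ℕ → ℕ) → Prop} {M : ℕ → ℕ}

/-- The number of elements that are below or equal to `c`: a linear extension of `r` arises from
sorting by rank. -/
noncomputable def rank (r : ℕ → ℕ → Prop) (n c : ℕ) : ℕ :=
  ((Finset.range n).filter fun d => Le r d c).card

theorem rank_le (c : ℕ) : rank r n c ≤ n :=
  (Finset.card_filter_le _ _).trans (Finset.card_range n).le

theorem rank_pos {c : ℕ} (hc : c < n) : 0 < rank r n c :=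
  Finset.card_pos.2 ⟨c, Finset.mem_filter.2 ⟨Finset.mem_range.2 hc, Le.refl c⟩⟩

theorem rank_lt (hr : PosetOn n r) {c d : ℕ} (h : r d c) : rank r n d < rank r n c := by
  refine Finset.card_lt_card (Finset.ssubset_iff_of_subset ?_ |>.2 ⟨c, ?_, ?_⟩)
  · intro e he
    rw [Finset.mem_filter] at he ⊢
    exact ⟨he.1, he.2.trans hr (Or.inr h)⟩
  · exact Finset.mem_filter.2 ⟨Finset.mem_range.2 (hr.lt_right h), Le.refl c⟩
  · rw [Finset.mem_filter]
    rintro ⟨-, he⟩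
    exact hr.irrefl _ (he.trans_lt hr h)

/-- `rCnt :=` the rank of the element in cell `rC`. -/
def countProg : RAMProg :=
  .const rCnt 0 ;; forLoop rD rN (leProg rD rC ;; .add rCnt rCnt rLe)

theorem wp_countProg (hS : Static n r tb W M) (hc : M rC < n) (hN : n ≤ N)
    (hQ : ∀ M', Frame 16 22 M M' → M' rCnt = rank r n (M rC) → Q M') :
    WP N W countProg Q M := by
  have hle := hS.le
  refine wp_seq (wp_const (wp_for (L := n) (fun k M1 => Frame 16 22 M M1 ∧
    M1 rCnt = ((Finset.range k).filter fun d => Le r d (M rC)).card) (by decide) ?_ ?_ hN ?_ ?_ ?_))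
  · simp (disch := omega) only [Function.update_of_ne, hS.n_eq]
  · simp (disch := omega) only [Function.update_of_ne, hS.one]
  · intro g
    refine ⟨fun x hx => by simp (disch := omega) only [Function.update_of_ne], ?_⟩
    simp (disch := omega) only [Function.update_self, Function.update_of_ne]
    simp
  · rintro k hk M1 ⟨hF, hcnt⟩ hd - -
    have hS1 := hS.frame hF (by omega) (by omega)
    have hcnt' : M1 rCnt ≤ k := by
      rw [hcnt]
      exact (Finset.card_filter_le _ _).trans (Finset.card_range k).le
    refine wp_seq (wp_leProg hS1 (by omega) (by omega) (by omega) ?_ hN fun M2 hF2 hle2 => ?_)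
    · rw [hF _ (by omega)]; exact hc
    refine wp_add ?_ ⟨?_, ?_, ?_, fun g => ⟨?_, ?_⟩⟩
    · rw [hF2 _ (by omega), hle2]
      split_ifs <;> omega
    · simp (disch := omega) only [Function.update_of_ne]
      rw [hF2 _ (by omega), hd]
    · simp (disch := omega) only [Function.update_of_ne]
      rw [hF2 _ (by omega), hS1.n_eq]
    · simp (disch := omega) only [Function.update_of_ne]
      rw [hF2 _ (by omega), hS1.one]
    · intro x hx
      simp (disch := omega) only [Function.update_of_ne]
      rw [hF2 _ (by omega), hF _ (by omega)]
    · simp (disch := omega) only [Function.update_self, Function.update_of_ne]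
      rw [hF2 _ (by omega), hle2, hcnt, hd, hF rC (by omega), Finset.range_add_one,
        Finset.filter_insert]
      split_ifs with h
      · rw [Finset.card_insert_of_notMem (by simp)]
      · rfl
  · rintro M1 ⟨hF, hcnt⟩ - -
    exact hQ M1 hF hcnt

/-! ### Appending elements to the list under construction -/

/-- The memory holds the list `s` as the one under construction, with its table of positions in the
free space at `q`. -/
structure Cur (n : ℕ) (r : ℕ → ℕ → Prop) (q : ℕ) (s : List ℕ) (M : ℕ → ℕ) : Prop where
  tail : M rTail = q
  asc_eq : M rAsc = asc r n s
  len : M rLen = s.length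
  last : M rLast = s.headD n
  pos_eq : ∀ c, c < n → M (q + c) = pos s c

/-- `M'` differs from `M` at most in the description of the list under construction at `q` and in
the auxiliary variables. -/
def CurFrame (n q : ℕ) (M M' : ℕ → ℕ) : Prop :=
  ∀ x, x < 11 ∨ (23 ≤ x ∧ x < q) ∨ q + n ≤ x → M' x = M x

theorem CurFrame.trans {q : ℕ} {M M' M'' : ℕ → ℕ} (h : CurFrame n q M M')
    (h' : CurFrame n q M' M'') : CurFrame n q M M'' :=
  fun x hx => (h' x hx).trans (h x hx)

theorem Frame.curFrame {q : ℕ} {lo hi : ℕ} {M M' : ℕ → ℕ} (h : Frame lo hi M M') (hlo : 11 ≤ lo)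
    (hhi : hi ≤ 23) (hq : 23 ≤ q) : CurFrame n q M M' :=
  fun x hx => h x (by omega)

theorem Static.curFrame {q : ℕ} {M' : ℕ → ℕ} (h : Static n r tb W M) (hM : CurFrame n q M M')
    (hq : tb + n * n + n ≤ q) : Static n r tb W M' :=
  h.congr fun x hx => hM x (by have := h.ge; omega)

theorem Cur.congr {q : ℕ} {s : List ℕ} {M' : ℕ → ℕ} (h : Cur n r q s M)
    (hM : ∀ x, x = rTail ∨ (11 ≤ x ∧ x < 14) ∨ (q ≤ x ∧ x < q + n) → M' x = M x) :
    Cur n r q s M' where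
  tail := by rw [hM _ (by omega), h.tail]
  asc_eq := by rw [hM _ (by omega), h.asc_eq]
  len := by rw [hM _ (by omega), h.len]
  last := by rw [hM _ (by omega), h.last]
  pos_eq c hc := by rw [hM _ (by omega), h.pos_eq c hc]

/-- Append the element in cell `rC`. -/
def appendProg : RAMProg :=
  leProg rLast rC ;; .add rAsc rAsc rLe ;; .add rLen rLen rOne ;; .add rLast rC rZero ;;
    .add rU rTail rC ;; .store rU rLen

theorem headD_le {s : List ℕ} (hs : ∀ c ∈ s, c < n) : s.headD n ≤ n := by
  cases s with
  | nil => simp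
  | cons c s => simpa using (hs c (by simp)).le

theorem wp_appendProg {q c : ℕ} {s : List ℕ} (hS : Static n r tb W M) (hC : Cur n r q s M)
    (hq : tb + n * n + n ≤ q) (hqW : q + n ≤ W) (hs : ∀ c ∈ s, c < n) (hlen : s.length < n)
    (hMc : M rC = c) (hc : c < n) (hN : n ≤ N)
    (hQ : ∀ M', CurFrame n q M M' → M' rKey = M rKey → M' rC = M rC → Cur n r q (c :: s) M' → Q M') :
    WP N W appendProg Q M := by
  have hle := hS.le
  have hge := hS.ge
  have hasc := asc_le_length (r := r) (n := n) s
  refine wp_seq (wp_leProg hS (by omega) (by omega) ?_ (by omega) hN fun M1 hF h1 => ?_)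
  · rw [hC.last]; exact headD_le hs
  rw [hC.last, hMc] at h1
  have e1 := hF rOne (by omega)
  have e2 := hF rZero (by omega)
  have e3 := hF rTail (by omega)
  have e4 := hF rAsc (by omega)
  have e5 := hF rLen (by omega)
  have e6 := hF rC (by omega)
  rw [hS.one] at e1
  rw [hS.zero] at e2
  rw [hC.tail] at e3
  rw [hC.asc_eq] at e4
  rw [hC.len] at e5
  rw [hMc] at e6
  refine wp_seq (wp_add ?_ (wp_seq (wp_add ?_ (wp_seq (wp_add ?_ (wp_seq (wp_add ?_
    (wp_store (hQ _ ?_ ?_ ?_ ⟨?_, ?_, ?_, ?_, ?_⟩)))))))))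
  · rw [h1, e4]
    split_ifs <;> omega
  all_goals simp (disch := omega) only [Function.update_self, Function.update_of_ne, e1, e2, e3, e4,
    e5, e6, h1]
  · omega
  · omega
  · omega
  · intro x hx
    simp (disch := omega) only [Function.update_of_ne]
    exact hF x (by omega)
  · exact hF _ (by omega)
  · exact hMc.symm
  · rfl
  · simp
  · simp
  · intro d hd
    by_cases hdc : d = c
    · subst hdc
      simp [pos]
    · simp (disch := omega) only [Function.update_of_ne]
      rw [hF _ (by omega), hC.pos_eq d hd]
      simp [pos, hdc]

/-- Append the element `c` in cell `rC` if its rank is one more than the content of `rKey`, it is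
missing in the list, below the element in `rT`, and not above that in cell `x`. -/
def visitProg (x : ℕ) : RAMProg :=
  countProg ;; .add rW rKey rOne ;; .sub rU rCnt rW ;; .sub rV rW rCnt ;; .add rU rU rV ;;
    .ite rU .skip (.add rU rTail rC ;; .load rU rU ;; .ite rU .skip
      (leProg rC rT ;; .ite rLe (leProg x rC ;; .ite rLe .skip appendProg) .skip))

theorem wp_visitProg {q c k x a t : ℕ} {s : List ℕ} (hS : Static n r tb W M) (hC : Cur n r q s M)
    (hq : tb + n * n + n ≤ q) (hqW : q + n ≤ W) (hs : ∀ c ∈ s, c < n) (hnd : s.Nodup)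
    (hMc : M rC = c) (hc : c < n) (hMk : M rKey = k) (hk : k < n) (hx : x < 11) (hMx : M x = a)
    (ha : a ≤ n) (hMt : M rT = t) (ht : t < n) (hN : n ≤ N)
    (hQ : ∀ M', CurFrame n q M M' → M' rKey = k → M' rC = c →
      Cur n r q (if rank r n c = k + 1 ∧ c ∉ s ∧ Le r c t ∧ ¬ Le r a c then c :: s else s) M' →
      Q M') :
    WP N W (visitProg x) Q M := by
  have hle := hS.le
  have hge := hS.ge
  have hrk := rank_le (r := r) (n := n) c
  refine wp_seq (wp_countProg hS (by omega) hN fun M1 hF h1 => ?_)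
  have hS1 := hS.frame hF (by omega) (by omega)
  have e1 := hS1.one
  have e3 := hF rTail (by omega)
  have e6 := hF rC (by omega)
  have e7 := hF rKey (by omega)
  rw [hC.tail] at e3
  rw [hMc] at e6 h1
  rw [hMk] at e7
  refine wp_seq (wp_add ?_ (wp_seq (wp_sub (wp_seq (wp_sub (wp_seq (wp_add ?_ (wp_ite ?_ ?_))))))))
  · rw [e7, e1]; omega
  · simp (disch := omega) only [Function.update_self, Function.update_of_ne]
    omega
  all_goals simp (disch := omega) only [Function.update_self, Function.update_of_ne, e1, e7, h1]
  · intro hne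
    refine wp_skip (hQ _ ?_ ?_ ?_ ?_)
    · intro y hy
      simp (disch := omega) only [Function.update_of_ne]
      exact hF y (by omega)
    · simp (disch := omega) only [Function.update_of_ne, e7]
    · simp (disch := omega) only [Function.update_of_ne, e6]
    · rw [if_neg (by rintro ⟨h, -⟩; omega)]
      refine hC.congr fun y hy => ?_
      simp (disch := omega) only [Function.update_of_ne]
      exact hF y (by omega)
  intro hz
  have hrank : rank r n c = k + 1 := by omega
  refine wp_seq (wp_add ?_ (wp_seq (wp_load (wp_ite ?_ ?_))))
  · simp (disch := omega) only [Function.update_self, Function.update_of_ne]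
    omega
  all_goals simp (disch := omega) only [Function.update_self, Function.update_of_ne, e3, e6]
  all_goals rw [hF _ (by omega), hC.pos_eq c hc]
  all_goals simp only [ne_eq, pos_eq_zero, not_not]
  · intro hcs
    refine wp_skip (hQ _ ?_ ?_ ?_ ?_)
    · intro y hy
      simp (disch := omega) only [Function.update_of_ne]
      exact hF y (by omega)
    · simp (disch := omega) only [Function.update_of_ne, e7]
    · simp (disch := omega) only [Function.update_of_ne, e6]
    · rw [if_neg (by rintro ⟨-, h, -⟩; exact h hcs)]
      refine hC.congr fun y hy => ?_
      simp (disch := omega) only [Function.update_of_ne]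
      exact hF y (by omega)
  intro hcs
  generalize hM2 : Function.update (_ : ℕ → ℕ) (_ : ℕ) (_ : ℕ) = M2
  have hF2 : Frame 16 23 M M2 := by
    subst hM2
    intro y hy
    simp (disch := omega) only [Function.update_of_ne]
    exact hF y (by omega)
  have hS2 := hS.frame hF2 (by omega) (by omega)
  have f1 : M2 rC = c := by rw [hF2 _ (by omega), hMc]
  have f2 : M2 rT = t := by rw [hF2 _ (by omega), hMt]
  refine wp_seq (wp_leProg hS2 (by omega) (by omega) (by omega) (by omega) hN fun M3 hF3 h3 => ?_)
  rw [f1, f2] at h3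
  have hF3' : Frame 16 23 M M3 := hF2.trans hF3 (by omega)
  have hS3 := hS.frame hF3' (by omega) (by omega)
  refine wp_ite ?_ ?_
  · intro hne
    have hct : Le r c t := by
      by_contra h
      rw [if_neg h] at h3
      exact hne h3
    have g1 : M3 rC = c := by rw [hF3' _ (by omega), hMc]
    have g2 : M3 x = a := by rw [hF3' _ (by omega), hMx]
    refine wp_seq (wp_leProg hS3 (by omega) (by omega) (by omega) (by omega) hN
      fun M4 hF4 h4 => ?_)
    rw [g1, g2] at h4
    have hF4' : Frame 16 23 M M4 := hF3'.trans hF4 (by omega)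
    have hS4 := hS.frame hF4' (by omega) (by omega)
    refine wp_ite ?_ ?_
    · intro hne4
      have hac : Le r a c := by
        by_contra h
        rw [if_neg h] at h4
        exact hne4 h4
      refine wp_skip (hQ _ (hF4'.curFrame (by omega) (by omega) (by omega)) ?_ ?_ ?_)
      · rw [hF4' _ (by omega), hMk]
      · rw [hF4' _ (by omega), hMc]
      · rw [if_neg (by rintro ⟨-, -, -, h⟩; exact h hac)]
        exact hC.congr fun y hy => hF4' y (by omega)
    · intro hz4
      have hac : ¬ Le r a c := by
        intro h
        rw [if_pos h] at h4
        omega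
      have hlen : (c :: s).length ≤ n := length_le_of_lt (List.nodup_cons.2 ⟨hcs, hnd⟩) (by
        intro d hd
        rcases List.mem_cons.1 hd with rfl | hd
        exacts [hc, hs d hd])
      rw [List.length_cons] at hlen
      refine wp_appendProg (c := c) hS4 (hC.congr fun y hy => hF4' y (by omega)) hq hqW hs
        (by omega) (by rw [hF4' _ (by omega), hMc]) hc hN fun M5 hF5 k1 k2 hC5 => ?_
      refine hQ M5 ((hF4'.curFrame (by omega) (by omega) (by omega)).trans hF5) ?_ ?_ ?_
      · rw [k1, hF4' _ (by omega), hMk]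
      · rw [k2, hF4' _ (by omega), hMc]
      · rwa [if_pos ⟨hrank, hcs, hct, hac⟩]
  · intro hz3
    have hct : ¬ Le r c t := by
      intro h
      rw [if_pos h] at h3
      omega
    refine wp_skip (hQ _ (hF3'.curFrame (by omega) (by omega) (by omega)) ?_ ?_ ?_)
    · rw [hF3' _ (by omega), hMk]
    · rw [hF3' _ (by omega), hMc]
    · rw [if_neg (by rintro ⟨-, -, h, -⟩; exact hct h)]
      exact hC.congr fun y hy => hF3' y (by omega)

end JumpNumber

namespace JumpNumber

variable {n N W tb : ℕ} {r : ℕ → ℕ → Prop} {Q : (ℕ → ℕ) → Prop} {M : ℕ → ℕ}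

/-- The state `s'` of a pass over all pairs of a rank and an element in lexicographic order, when
the ranks up to `k`, and for the rank `k + 1` the elements below `i`, have been dealt with. -/
structure PassInv (n : ℕ) (r : ℕ → ℕ → Prop) (a t k i : ℕ) (s s' : List ℕ) : Prop where
  suffix : s <:+ s'
  ext : Ext r s'
  lt : ∀ c ∈ s', c < n
  mem : ∀ c, c ∈ s' ↔ c ∈ s ∨ ((Le r c t ∧ ¬ Le r a c) ∧
    (rank r n c ≤ k ∨ (rank r n c = k + 1 ∧ c < i)))

theorem PassInv.init {a t : ℕ} (ht : t < n) (hr : PosetOn n r) {s : List ℕ} (hs : Ext r s)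
    (hsn : ∀ c ∈ s, c < n) : PassInv n r a t 0 0 s s where
  suffix := List.suffix_rfl
  ext := hs
  lt := hsn
  mem c := by
    constructor
    · exact Or.inl
    · rintro (h | ⟨h, h' | h'⟩)
      · exact h
      · have := rank_pos (r := r) (h.1.lt_left hr ht)
        omega
      · omega

theorem PassInv.next {a t k : ℕ} (ht : t < n) (hr : PosetOn n r) {s s' : List ℕ}
    (h : PassInv n r a t k n s s') : PassInv n r a t (k + 1) 0 s s' where
  suffix := h.suffix
  ext := h.ext
  lt := h.lt
  mem c := by
    rw [h.mem]
    refine or_congr_right (and_congr_right fun hc => ?_)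
    have := hc.1.lt_left hr ht
    omega

theorem PassInv.pass {a t : ℕ} {s s' : List ℕ} (h : PassInv n r a t n 0 s s') :
    Pass r a t s s' where
  suffix := h.suffix
  ext := h.ext
  mem c := by
    rw [h.mem]
    refine or_congr_right (and_iff_left (Or.inl (rank_le c)))

theorem PassInv.step {a t k i : ℕ} (hr : PosetOn n r) (hi : i < n) {s s' : List ℕ}
    (h : PassInv n r a t k i s s') : PassInv n r a t k (i + 1) s
      (if rank r n i = k + 1 ∧ i ∉ s' ∧ Le r i t ∧ ¬ Le r a i then i :: s' else s') := by
  split_ifs with hc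
  · obtain ⟨h1, h2, h3, h4⟩ := hc
    refine ⟨h.suffix.trans (List.suffix_cons _ _), ⟨h.ext, h2, fun d hd => ?_⟩, ?_, fun c => ?_⟩
    · refine (h.mem d).2 (Or.inr ⟨⟨Le.trans hr (Or.inr hd) h3, fun had => ?_⟩, Or.inl ?_⟩)
      · exact h4 (had.trans hr (Or.inr hd))
      · have := rank_lt hr hd
        omega
    · intro c hc
      rcases List.mem_cons.1 hc with rfl | hc
      exacts [hi, h.lt c hc]
    · rw [List.mem_cons, h.mem]
      constructor
      · rintro (rfl | h5 | ⟨h5, h6⟩)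
        · exact Or.inr ⟨⟨h3, h4⟩, Or.inr ⟨h1, by omega⟩⟩
        · exact Or.inl h5
        · exact Or.inr ⟨h5, by omega⟩
      · rintro (h5 | ⟨h5, h6⟩)
        · exact Or.inr (Or.inl h5)
        · by_cases hci : c = i
          · exact Or.inl hci
          · exact Or.inr (Or.inr ⟨h5, by omega⟩)
  · refine ⟨h.suffix, h.ext, h.lt, fun c => ?_⟩
    by_cases hci : c = i
    · subst hci
      constructor
      · intro h1
        rcases (h.mem c).1 h1 with h1 | ⟨h1, h2⟩
        · exact Or.inl h1
        · exact Or.inr ⟨h1, by omega⟩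
      · rintro (h1 | ⟨h1, h2 | h2⟩)
        · exact (h.mem c).2 (Or.inl h1)
        · exact (h.mem c).2 (Or.inr ⟨h1, Or.inl h2⟩)
        · by_contra h3
          exact hc ⟨h2.1, h3, h1⟩
    · rw [h.mem]
      refine or_congr_right (and_congr_right fun _ => ?_)
      omega

/-- Append, sorted by rank, all missing elements that are below the element in `rT` and not above
that in cell `x`. -/
def passProg (x : ℕ) : RAMProg := forLoop rKey rN (forLoop rC rN (visitProg x))

theorem wp_passProg {q x a t : ℕ} {s : List ℕ} (hr : PosetOn n r) (hS : Static n r tb W M)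
    (hC : Cur n r q s M) (hq : tb + n * n + n ≤ q) (hqW : q + n ≤ W) (hs : ∀ c ∈ s, c < n)
    (hext : Ext r s) (hx : x < 11) (hMx : M x = a) (ha : a ≤ n) (hMt : M rT = t) (ht : t < n)
    (hN : n ≤ N)
    (hQ : ∀ M' s', CurFrame n q M M' → Cur n r q s' M' → Pass r a t s s' → (∀ c ∈ s', c < n) →
      Q M') :
    WP N W (passProg x) Q M := by
  have hge := hS.ge
  refine wp_for (L := n) (fun k M1 => CurFrame n q M M1 ∧ ∃ s', PassInv n r a t k 0 s s' ∧
    Cur n r q s' M1) (by decide) hS.n_eq hS.one hN ?_ ?_ ?_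
  · intro g
    refine ⟨fun y hy => ?_, s, .init ht hr hext hs, hC.congr fun y hy => ?_⟩ <;>
    simp (disch := omega) only [Function.update_of_ne]
  · rintro k hk M1 ⟨hF1, s1, hP1, hC1⟩ hk1 hn1 ho1
    have hS1 := hS.curFrame hF1 hq
    refine wp_for (L := n) (fun i M2 => CurFrame n q M M2 ∧ M2 rKey = k ∧
      ∃ s', PassInv n r a t k i s s' ∧ Cur n r q s' M2) (by decide) hn1 ho1 hN ?_ ?_ ?_
    · intro g
      refine ⟨fun y hy => ?_, ?_, s1, hP1, hC1.congr fun y hy => ?_⟩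
      · simp (disch := omega) only [Function.update_of_ne]
        exact hF1 y hy
      · simp (disch := omega) only [Function.update_of_ne, hk1]
      · simp (disch := omega) only [Function.update_of_ne]
    · rintro i hi M2 ⟨hF2, hk2, s2, hP2, hC2⟩ hi2 hn2 ho2
      have hS2 := hS.curFrame hF2 hq
      refine wp_visitProg (c := i) (k := k) (a := a) (t := t) hS2 hC2 hq hqW hP2.lt hP2.ext.nodup
        hi2 hi hk2 hk hx ?_ ha ?_ ht hN fun M3 hF3 hk3 hi3 hC3 => ?_
      · rw [hF2 _ (by omega), hMx]
      · rw [hF2 _ (by omega), hMt]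
      have hS3 := hS2.curFrame hF3 hq
      refine ⟨hi3, hS3.n_eq, hS3.one, fun g => ⟨fun y hy => ?_, ?_, _, hP2.step hr hi,
        hC3.congr fun y hy => ?_⟩⟩
      · simp (disch := omega) only [Function.update_of_ne]
        exact (hF2.trans hF3) y hy
      · simp (disch := omega) only [Function.update_of_ne, hk3]
      · simp (disch := omega) only [Function.update_of_ne]
    · rintro M2 ⟨hF2, hk2, s2, hP2, hC2⟩ hn2 ho2
      refine ⟨hk2, hn2, ho2, fun g => ⟨fun y hy => ?_, s2, hP2.next ht hr,
        hC2.congr fun y hy => ?_⟩⟩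
      · simp (disch := omega) only [Function.update_of_ne]
        exact hF2 y hy
      · simp (disch := omega) only [Function.update_of_ne]
  · rintro M1 ⟨hF1, s1, hP1, hC1⟩ - -
    exact hQ M1 s1 hF1 hC1 hP1.pass hP1.lt

/-! ### Loading and completing a list -/

/-- The list `s` is stored at address `e`: the positions of all elements, the number of comparable
neighbours, the length, and the newest element. -/
structure Stored (n : ℕ) (r : ℕ → ℕ → Prop) (e : ℕ) (s : List ℕ) (M : ℕ → ℕ) : Prop where
  pos_eq : ∀ c, c < n → M (e + c) = pos s c
  asc_eq : M (e + n) = asc r n s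
  len : M (e + n + 1) = s.length
  last : M (e + n + 2) = s.headD n

theorem Stored.congr {e : ℕ} {s : List ℕ} {M' : ℕ → ℕ} (h : Stored n r e s M)
    (hM : ∀ x, e ≤ x → x < e + n + 3 → M' x = M x) : Stored n r e s M' where
  pos_eq c hc := by rw [hM _ (by omega) (by omega), h.pos_eq c hc]
  asc_eq := by rw [hM _ (by omega) (by omega), h.asc_eq]
  len := by rw [hM _ (by omega) (by omega), h.len]
  last := by rw [hM _ (by omega) (by omega), h.last]

/-- Make a copy of the list stored at the address in cell `h` the list under construction. -/
def loadProg (h : ℕ) : RAMProg :=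
  forLoop rC rN (.add rU h rC ;; .load rU rU ;; .add rV rTail rC ;; .store rV rU) ;;
    .add rU h rN ;; .load rAsc rU ;; .add rU rU rOne ;; .load rLen rU ;; .add rU rU rOne ;;
    .load rLast rU

theorem wp_loadProg {q h e : ℕ} {s : List ℕ} (hS : Static n r tb W M) (hh : h < 11)
    (hMh : M h = e) (he : Stored n r e s M) (he23 : 23 ≤ e) (heq : e + n + 3 ≤ q)
    (hMq : M rTail = q) (hq : tb + n * n + n ≤ q) (hqW : q + n ≤ W) (hN : n ≤ N)
    (hQ : ∀ M', CurFrame n q M M' → Cur n r q s M' → Q M') : WP N W (loadProg h) Q M := by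
  have hge := hS.ge
  refine wp_seq (wp_for (L := n) (fun k M1 => CurFrame n q M M1 ∧ ∀ c < k, M1 (q + c) = pos s c)
    (by decide) hS.n_eq hS.one hN ?_ ?_ ?_)
  · intro g
    refine ⟨fun y hy => ?_, by omega⟩
    simp (disch := omega) only [Function.update_of_ne]
  · rintro k hk M1 ⟨hF, hp⟩ hk1 hn1 ho1
    have e1 : M1 h = e := by rw [hF _ (by omega), hMh]
    have e2 : M1 rTail = q := by rw [hF _ (by omega), hMq]
    have e3 : M1 (e + k) = pos s k := by rw [hF _ (by omega), he.pos_eq k hk]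
    refine wp_seq (wp_add ?_ (wp_seq (wp_load (wp_seq (wp_add ?_ (wp_store ⟨?_, ?_, ?_,
      fun g => ⟨fun y hy => ?_, fun c hc => ?_⟩⟩))))))
    all_goals simp (disch := omega) only [Function.update_self, Function.update_of_ne, e1, e2, e3,
      hk1, hn1, ho1]
    · omega
    · omega
    · exact hF y hy
    · by_cases hck : c = k
      · subst hck
        simp (disch := omega) only [Function.update_self, Function.update_of_ne]
      · simp (disch := omega) only [Function.update_self, Function.update_of_ne]
        exact hp c (by omega)
  · rintro M1 ⟨hF, hp⟩ hn1 ho1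
    have e1 : M1 h = e := by rw [hF _ (by omega), hMh]
    have e2 : M1 rTail = q := by rw [hF _ (by omega), hMq]
    have e3 : M1 (e + n) = asc r n s := by rw [hF _ (by omega), he.asc_eq]
    have e4 : M1 (e + n + 1) = s.length := by rw [hF _ (by omega), he.len]
    have e5 : M1 (e + n + 2) = s.headD n := by rw [hF _ (by omega), he.last]
    refine wp_seq (wp_add ?_ (wp_seq (wp_load (wp_seq (wp_add ?_ (wp_seq (wp_load (wp_seq (wp_add ?_
      (wp_load (hQ _ (fun y hy => ?_) ⟨?_, ?_, ?_, ?_, fun c hc => ?_⟩)))))))))))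
    all_goals simp (disch := omega) only [Function.update_self, Function.update_of_ne, e1, e2, e3,
      e4, e5, hn1, ho1]
    · omega
    · omega
    · omega
    · exact hF y hy
    · exact hp c hc

/-- Append all missing elements to the list under construction. -/
def completeProg : RAMProg := forLoop rT rN (passProg rN)

theorem wp_completeProg {q : ℕ} {s : List ℕ} (hr : PosetOn n r) (hS : Static n r tb W M)
    (hC : Cur n r q s M) (hq : tb + n * n + n ≤ q) (hqW : q + n ≤ W) (hs : ∀ c ∈ s, c < n)
    (hext : Ext r s) (hN : n ≤ N)
    (hQ : ∀ M' s', Static n r tb W M' → Cur n r q s' M' → Ext r s' → (∀ c, c ∈ s' ↔ c < n) →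
      asc r n s ≤ asc r n s' → Q M') :
    WP N W completeProg Q M := by
  have hge := hS.ge
  refine wp_for (L := n) (fun k M1 => Static n r tb W M1 ∧ ∃ s', Cur n r q s' M1 ∧ Ext r s' ∧
    (∀ c ∈ s', c < n) ∧ (∀ c < k, c ∈ s') ∧ asc r n s ≤ asc r n s')
    (by decide) hS.n_eq hS.one hN ?_ ?_ ?_
  · intro g
    refine ⟨hS.congr fun y hy => ?_, s, hC.congr fun y hy => ?_, hext, hs, by omega, le_rfl⟩ <;>
    simp (disch := omega) only [Function.update_of_ne]
  · rintro k hk M1 ⟨hS1, s1, hC1, hext1, hs1, hk1, ha1⟩ hMk - -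
    refine wp_passProg hr hS1 hC1 hq hqW hs1 hext1 (by omega) hS1.n_eq le_rfl hMk hk hN
      fun M2 s2 hF2 hC2 hP hs2 => ?_
    have hS2 := hS1.curFrame hF2 hq
    refine ⟨?_, hS2.n_eq, hS2.one, fun g => ⟨hS2.congr fun y hy => ?_, s2, hC2.congr fun y hy => ?_,
      hP.ext, hs2, fun c hc => ?_, ha1.trans hP.asc_le⟩⟩
    · rw [hF2 _ (by omega), hMk]
    · simp (disch := omega) only [Function.update_of_ne]
    · simp (disch := omega) only [Function.update_of_ne]
    · rw [hP.mem]
      by_cases hck : c = k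
      · exact Or.inr ⟨Or.inl hck, not_le_top hr (by omega)⟩
      · exact Or.inl (hk1 c (by omega))
  · rintro M1 ⟨hS1, s1, hC1, hext1, hs1, hk1, ha1⟩ - -
    exact hQ M1 s1 hS1 hC1 hext1 (fun c => ⟨hs1 c, hk1 c⟩) ha1

/-! ### The table of visited sets -/

/-- The number with leading part `v` and then the binary digits that tell which of the elements
`0, …, k - 1` occur in `s`. -/
def hornerCode (v : ℕ) (s : List ℕ) : ℕ → ℕ
  | 0 => v
  | k + 1 => 2 * hornerCode v s k + if k ∈ s then 1 else 0

theorem hornerCode_bounds (v : ℕ) (s : List ℕ) (k : ℕ) :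
    v * 2 ^ k ≤ hornerCode v s k ∧ hornerCode v s k + 1 ≤ (v + 1) * 2 ^ k := by
  induction k with
  | zero => simp [hornerCode]
  | succ k ih =>
    rw [hornerCode, pow_succ, ← mul_assoc, ← mul_assoc]
    split_ifs <;> omega

theorem hornerCode_inj {v v' : ℕ} {s s' : List ℕ} : ∀ {k : ℕ},
    hornerCode v s k = hornerCode v' s' k → v = v' ∧ ∀ c < k, c ∈ s ↔ c ∈ s'
  | 0, h => ⟨h, by omega⟩
  | k + 1, h => by
    simp only [hornerCode] at h
    have h1 : hornerCode v s k = hornerCode v' s' k := by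
      split_ifs at h <;> omega
    have h2 : k ∈ s ↔ k ∈ s' := by
      split_ifs at h with h3 h4 h4
      · simp [h3, h4]
      · omega
      · omega
      · simp [h3, h4]
    obtain ⟨h3, h4⟩ := hornerCode_inj h1
    refine ⟨h3, fun c hc => ?_⟩
    by_cases hck : c = k
    · rwa [hck]
    · exact h4 c (by omega)

theorem hornerCode_congr {v : ℕ} {s s' : List ℕ} (h : ∀ c, c ∈ s ↔ c ∈ s') :
    ∀ k, hornerCode v s k = hornerCode v s' k
  | 0 => rfl
  | k + 1 => by simp only [hornerCode, hornerCode_congr h k, h k]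

/-- `rU :=` the address in the table of visited sets that belongs to the list under construction. -/
def codeProg : RAMProg :=
  .add rU rVis rAsc ;; forLoop rC rN (.add rU rU rU ;; .add rV rTail rC ;; .load rV rV ;;
    .ite rV (.add rU rU rOne) .skip)

theorem wp_codeProg {q vb : ℕ} {s : List ℕ} (hS : Static n r tb W M) (hC : Cur n r q s M)
    (hv : M rVis = vb) (hq : 23 ≤ q) (hqW : q + n ≤ W) (hW : (vb + asc r n s + 1) * 2 ^ n ≤ W)
    (hN : n ≤ N)
    (hQ : ∀ M', Frame 15 22 M M' → M' rU = hornerCode (vb + asc r n s) s n → Q M') :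
    WP N W codeProg Q M := by
  have hge := hS.ge
  have hle := hS.le
  have hcode : ∀ k, k ≤ n → hornerCode (vb + asc r n s) s k + 1 ≤ W := fun k hk =>
    ((hornerCode_bounds _ _ _).2.trans (Nat.mul_le_mul_left _
      (Nat.pow_le_pow_right (by omega) hk))).trans hW
  refine wp_seq (wp_add ?_ (wp_for (L := n) (fun k M1 => Frame 15 22 M M1 ∧
    M1 rU = hornerCode (vb + asc r n s) s k) (by decide) ?_ ?_ hN ?_ ?_ ?_))
  · rw [hv, hC.asc_eq]
    have := hcode 0 (by omega)
    simp only [hornerCode] at this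
    omega
  · simp (disch := omega) only [Function.update_of_ne, hS.n_eq]
  · simp (disch := omega) only [Function.update_of_ne, hS.one]
  · intro g
    refine ⟨fun y hy => ?_, ?_⟩ <;>
    simp (disch := omega) only [Function.update_of_ne, Function.update_self, hv, hC.asc_eq,
      hornerCode]
  · rintro k hk M1 ⟨hF, hU⟩ hMk hn1 ho1
    have e2 : M1 rTail = q := by rw [hF _ (by omega), hC.tail]
    have hb := hcode (k + 1) (by omega)
    simp only [hornerCode] at hb
    refine wp_bdd fun hM1 => wp_seq (wp_add ?_ (wp_seq (wp_add ?_ (wp_seq (wp_load (wp_ite ?_ ?_))))))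
    all_goals simp (disch := omega) only [Function.update_self, Function.update_of_ne, e2, hU, hMk]
    · split_ifs at hb <;> omega
    · omega
    all_goals rw [hF _ (by omega), hC.pos_eq k hk]
    all_goals simp only [ne_eq, pos_eq_zero, not_not]
    · intro hks
      rw [if_pos hks] at hb
      refine wp_add ?_ ⟨?_, ?_, ?_, fun g => ⟨fun y hy => ?_, ?_⟩⟩
      all_goals simp (disch := omega) only [Function.update_self, Function.update_of_ne, hMk, hn1,
        ho1]
      · omega
      · exact hF y hy
      · rw [hornerCode, if_pos hks]
        omega
    · intro hks
      refine wp_skip ⟨?_, ?_, ?_, fun g => ⟨fun y hy => ?_, ?_⟩⟩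
      all_goals simp (disch := omega) only [Function.update_self, Function.update_of_ne, hMk, hn1,
        ho1]
      · exact hF y hy
      · rw [hornerCode, if_neg hks]
        omega
  · rintro M1 ⟨hF, hU⟩ - -
    exact hQ M1 hF hU

end JumpNumber

namespace JumpNumber

variable {n N W tb vb : ℕ} {r : ℕ → ℕ → Prop} {Q : (ℕ → ℕ) → Prop} {M : ℕ → ℕ}

/-! ### The queue of the search -/

/-- Two lists are equivalent for the search: they have the same elements and the same number of
comparable neighbours. -/
def SameKey (r : ℕ → ℕ → Prop) (n : ℕ) (s s' : List ℕ) : Prop :=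
  asc r n s = asc r n s' ∧ ∀ c, c ∈ s ↔ c ∈ s'

/-- The lists `qs 0, …, qs (L - 1)` found by the search: pairwise inequivalent linear extensions of
down-sets with few generators, the first one empty. -/
structure Queue (n : ℕ) (r : ℕ → ℕ → Prop) (L : ℕ) (qs : ℕ → List ℕ) : Prop where
  pos : 0 < L
  first : qs 0 = []
  ext : ∀ i < L, Ext r (qs i)
  lt : ∀ i < L, ∀ c ∈ qs i, c < n
  few : ∀ i < L, FewTops r {c | c ∈ qs i}
  distinct : ∀ i < L, ∀ j < L, SameKey r n (qs i) (qs j) → i = j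

/-- An upper bound for the number of lists that the search finds on `n` elements. -/
noncomputable def maxQueue (n : ℕ) : ℕ := (n + 1) * ⌊(1.802 : ℝ) ^ n⌋₊

theorem Queue.le_maxQueue {L : ℕ} {qs : ℕ → List ℕ} (hr : PosetOn n r) (h : Queue n r L qs) :
    L ≤ maxQueue n := by
  set 𝓓 := (Finset.range L).image fun i => (qs i).toFinset with h𝓓
  have hD : 𝓓.card ≤ ⌊(1.802 : ℝ) ^ n⌋₊ := by
    refine Nat.le_floor (card_fewTops_le hr 𝓓 fun D hD => ?_)
    obtain ⟨i, hi, rfl⟩ := Finset.mem_image.1 hD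
    rw [Finset.mem_range] at hi
    refine ⟨fun c hc => h.lt i hi c (List.mem_toFinset.1 hc), ?_⟩
    rw [List.coe_toFinset]
    exact h.few i hi
  have hmap : (Finset.range L).card ≤ (Finset.range (n + 1) ×ˢ 𝓓).card := by
    refine Finset.card_le_card_of_injOn (fun i => (asc r n (qs i), (qs i).toFinset)) ?_ ?_
    · intro i hi
      have hi' := Finset.mem_range.1 hi
      refine Finset.mem_coe.2 (Finset.mem_product.2 ⟨Finset.mem_range.2 ?_,
        Finset.mem_image_of_mem _ hi⟩)
      have h1 := asc_le_length (r := r) (n := n) (qs i)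
      have h2 := length_le_of_lt (h.ext i hi').nodup (h.lt i hi')
      exact Nat.lt_succ_of_le (h1.trans h2)
    · intro i hi j hj he
      simp only [Prod.mk.injEq] at he
      refine h.distinct i (Finset.mem_range.1 hi) j (Finset.mem_range.1 hj) ⟨he.1, fun c => ?_⟩
      rw [← List.mem_toFinset, he.2, List.mem_toFinset]
  rw [Finset.card_range, Finset.card_product, Finset.card_range] at hmap
  exact hmap.trans (Nat.mul_le_mul_left _ hD)

theorem Queue.push {L : ℕ} {qs : ℕ → List ℕ} (h : Queue n r L qs) {s : List ℕ} (hext : Ext r s)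
    (hlt : ∀ c ∈ s, c < n) (hfew : FewTops r {c | c ∈ s}) (hnew : ∀ i < L, ¬ SameKey r n (qs i) s) :
    Queue n r (L + 1) (Function.update qs L s) := by
  have hL : ∀ i < L, Function.update qs L s i = qs i := fun i hi =>
    Function.update_of_ne (by omega) _ _
  have key : ∀ P : List ℕ → Prop, (∀ i < L, P (qs i)) → P s →
      ∀ i < L + 1, P (Function.update qs L s i) := by
    intro P h1 h2 i hi
    by_cases hiL : i = L
    · subst hiL; simpa using h2
    · rw [hL i (by omega)]; exact h1 i (by omega)
  refine ⟨by omega, by rw [hL 0 h.pos, h.first], key _ h.ext hext,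
    key (fun s => ∀ c ∈ s, c < n) h.lt hlt,
    key (fun s => FewTops r {c | c ∈ s}) h.few hfew, fun i hi j hj hij => ?_⟩
  by_cases hiL : i = L <;> by_cases hjL : j = L
  · omega
  · subst hiL
    rw [hL j (by omega), Function.update_self] at hij
    exact absurd ⟨hij.1.symm, fun c => (hij.2 c).symm⟩ (hnew j (by omega))
  · subst hjL
    rw [hL i (by omega), Function.update_self] at hij
    exact absurd hij (hnew i (by omega))
  · rw [hL i (by omega), hL j (by omega)] at hij
    exact h.distinct i (by omega) j (by omega) hij

/-- The address behind the table of visited sets, where the queue starts. -/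
def queueBase (n vb : ℕ) : ℕ := (vb + n + 1) * 2 ^ n

/-- The address of the `i`-th list of the queue. -/
def slot (n vb i : ℕ) : ℕ := queueBase n vb + (n + 3) * i

theorem slot_succ (i : ℕ) : slot n vb (i + 1) = slot n vb i + n + 3 := by
  unfold slot; ring

theorem slot_le {i j : ℕ} (h : i ≤ j) : slot n vb i ≤ slot n vb j :=
  Nat.add_le_add_left (Nat.mul_le_mul_left _ h) _

theorem slot_lt {i j : ℕ} (h : i < j) : slot n vb i + n + 3 ≤ slot n vb j := by
  rw [← slot_succ]; exact slot_le h

theorem le_queueBase : vb + n + 1 ≤ queueBase n vb :=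
  Nat.le_mul_of_pos_right _ (by positivity)

/-- Bounds for the addresses: the table of visited sets lies behind the order table, and `W` leaves
room for the largest possible queue, one further list, and `n + 26` more cells. -/
structure Layout (n tb vb W : ℕ) : Prop where
  tab_le : tb + n * n + n ≤ vb
  le : slot n vb (maxQueue n + 2) + n + 26 ≤ W

/-- The memory holds the queue `qs 0, …, qs (L - 1)`, the table of visited sets, and the address of
a list with the maximum number of comparable neighbours. The empty list is never entered into the
table, because no transition leads to it. -/
structure Search (n : ℕ) (r : ℕ → ℕ → Prop) (tb vb W L : ℕ) (qs : ℕ → List ℕ) (M : ℕ → ℕ) :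
    Prop where
  static : Static n r tb W M
  vis : M rVis = vb
  tail : M rTail = slot n vb L
  stored : ∀ i < L, Stored n r (slot n vb i) (qs i) M
  best : ∃ b < L, M rBest = slot n vb b ∧ ∀ i < L, asc r n (qs i) ≤ asc r n (qs b)
  visited : ∀ s, s ≠ [] → (∀ c ∈ s, c < n) → asc r n s ≤ n →
    (M (hornerCode (vb + asc r n s) s n) = 0 ↔ ∀ i < L, ¬ SameKey r n (qs i) s)
  queue : Queue n r L qs

theorem hornerCode_mem {s : List ℕ} (hs : asc r n s ≤ n) :
    vb ≤ hornerCode (vb + asc r n s) s n ∧ hornerCode (vb + asc r n s) s n < queueBase n vb := by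
  have h := hornerCode_bounds (vb + asc r n s) s n
  constructor
  · exact (Nat.le_add_right _ _).trans ((Nat.le_mul_of_pos_right _ (by positivity)).trans h.1)
  · exact h.2.trans (Nat.mul_le_mul_right _ (by omega))

theorem Search.congr {L : ℕ} {qs : ℕ → List ℕ} {M' : ℕ → ℕ} (hl : Layout n tb vb W)
    (h : Search n r tb vb W L qs M)
    (hM : ∀ x, x < 5 ∨ x = rTail ∨ x = rBest ∨ (23 ≤ x ∧ x < slot n vb L) → M' x = M x) :
    Search n r tb vb W L qs M' := by
  have hge := h.static.ge
  have h1 := hl.tab_le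
  have h2 : vb + n + 1 ≤ queueBase n vb := le_queueBase
  have h3 : queueBase n vb ≤ slot n vb L := Nat.le_add_right _ _
  refine ⟨h.static.congr fun x hx => hM x (by omega), ?_, ?_, ?_, ?_, ?_, h.queue⟩
  · rw [hM _ (by omega), h.vis]
  · rw [hM _ (by omega), h.tail]
  · intro i hi
    have h4 := slot_lt (n := n) (vb := vb) hi
    have h5 : queueBase n vb ≤ slot n vb i := Nat.le_add_right _ _
    exact (h.stored i hi).congr fun x hx hx' => hM x (by omega)
  · obtain ⟨b, hb, hb'⟩ := h.best
    exact ⟨b, hb, by rw [hM _ (by omega)]; exact hb'.1, hb'.2⟩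
  · intro s hs hsn ha
    have h4 := hornerCode_mem (vb := vb) ha
    rw [hM _ (by omega)]
    exact h.visited s hs hsn ha

theorem Search.push {L : ℕ} {qs : ℕ → List ℕ} {s : List ℕ} {M' : ℕ → ℕ}
    (hl : Layout n tb vb W) (hS : Search n r tb vb W L qs M) (hC : Cur n r (slot n vb L) s M)
    (hlt : ∀ c ∈ s, c < n) (ha : asc r n s ≤ n)
    (hq : Queue n r (L + 1) (Function.update qs L s))
    (g1 : ∀ x, x < 5 → M' x = M x) (g2 : M' rTail = slot n vb L + n + 3)
    (g3 : M' (hornerCode (vb + asc r n s) s n) = 1)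
    (g4 : ∀ x, 23 ≤ x → x < slot n vb L + n → x ≠ hornerCode (vb + asc r n s) s n → M' x = M x)
    (g5 : M' (slot n vb L + n) = asc r n s) (g6 : M' (slot n vb L + n + 1) = s.length)
    (g7 : M' (slot n vb L + n + 2) = s.headD n)
    (g8 : ∃ b < L + 1, M' rBest = slot n vb b ∧ ∀ i < L + 1,
      asc r n (Function.update qs L s i) ≤ asc r n (Function.update qs L s b)) :
    Search n r tb vb W (L + 1) (Function.update qs L s) M' := by
  have hge := hS.static.ge
  have h1 := hl.tab_le
  have h2 : vb + n + 1 ≤ queueBase n vb := le_queueBase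
  have h3 : queueBase n vb ≤ slot n vb L := Nat.le_add_right _ _
  have hcode := hornerCode_mem (vb := vb) ha
  generalize hk : hornerCode (vb + asc r n s) s n = k at g3 g4 hcode
  refine ⟨hS.static.congr fun x hx => ?_, ?_, ?_, ?_, g8, ?_, hq⟩
  · rcases hx with hx | hx
    · exact g1 x (by omega)
    · exact g4 x (by omega) (by omega) (by omega)
  · rw [g1 _ (by omega), hS.vis]
  · rw [g2, slot_succ]
  · intro i hi
    by_cases hiL : i = L
    · subst hiL
      rw [Function.update_self]
      exact ⟨fun c hc => by rw [g4 _ (by omega) (by omega) (by omega), hC.pos_eq c hc], g5, g6, g7⟩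
    · rw [Function.update_of_ne hiL]
      have h4 := slot_lt (n := n) (vb := vb) (show i < L by omega)
      have h5 : queueBase n vb ≤ slot n vb i := Nat.le_add_right _ _
      exact (hS.stored i (by omega)).congr fun x hx hx' => g4 x (by omega) (by omega) (by omega)
  · intro s' hs' hsn' ha'
    have h4 := hornerCode_mem (vb := vb) ha'
    by_cases hkk : hornerCode (vb + asc r n s') s' n = k
    · rw [hkk, g3]
      refine iff_of_false (by omega) fun h => h L (by omega) ?_
      rw [Function.update_self]
      obtain ⟨h5, h6⟩ := hornerCode_inj (hkk.trans hk.symm)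
      refine ⟨by omega, fun c => ?_⟩
      by_cases hc : c < n
      · exact (h6 c hc).symm
      · exact iff_of_false (fun h => hc (hlt c h)) (fun h => hc (hsn' c h))
    · rw [g4 _ (by omega) (by omega) hkk, hS.visited s' hs' hsn' ha']
      constructor
      · intro h i hi
        by_cases hiL : i = L
        · subst hiL
          rw [Function.update_self]
          rintro ⟨h5, h6⟩
          apply hkk
          rw [← hk, h5]
          exact hornerCode_congr (fun c => (h6 c).symm) n
        · rw [Function.update_of_ne hiL]
          exact h i (by omega)
      · intro h i hi
        have := h i (by omega)
        rwa [Function.update_of_ne (by omega)] at this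

/-- Store the list under construction behind the queue, and mark its code, given in `rU`. -/
def storeProg : RAMProg :=
  .store rU rOne ;; .add rU rTail rN ;; .store rU rAsc ;; .add rU rU rOne ;; .store rU rLen ;;
    .add rU rU rOne ;; .store rU rLast

theorem wp_storeProg {q k : ℕ} {s : List ℕ} (hn : M rN = n) (ho : M rOne = 1)
    (hC : Cur n r q s M) (hk : 23 ≤ k ∧ k < q) (hW : q + n + 26 ≤ W) (hU : M rU = k)
    (hQ : ∀ M', (∀ x, x < rU → M' x = M x) → (∀ x, 23 ≤ x → x < q + n → x ≠ k → M' x = M x) →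
      M' k = 1 → M' rU = q + n + 2 → M' (q + n) = asc r n s → M' (q + n + 1) = s.length →
      M' (q + n + 2) = s.headD n → Q M') :
    WP N W storeProg Q M := by
  have e3 := hC.tail
  have e4 := hC.asc_eq
  have e5 := hC.len
  have e6 := hC.last
  refine wp_seq (wp_store_eq hU ho (wp_seq (wp_add_eq (v := q + n) ?_ ?_ (wp_seq (wp_store_eq
    (k := q + n) (v := asc r n s) ?_ ?_ (wp_seq (wp_add_eq (v := q + n + 1) ?_ ?_ (wp_seq
    (wp_store_eq (k := q + n + 1) (v := s.length) ?_ ?_ (wp_seq (wp_add_eq (v := q + n + 2) ?_ ?_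
    (wp_store_eq (k := q + n + 2) (v := s.headD n) ?_ ?_ (hQ _ (fun x hx => ?_)
    (fun x hx hx' hxk => ?_) ?_ ?_ ?_ ?_ ?_)))))))))))))
  all_goals try simp (disch := omega) only [Function.update_self, Function.update_of_ne, hn, ho, e3,
    e4, e5, e6, hU]
  all_goals omega

/-- Store the list under construction, whose code is in `rU`, as the last list of the queue. -/
def commitProg : RAMProg :=
  storeProg ;; .add rV rBest rN ;; .load rV rV ;; .sub rV rAsc rV ;;
    .ite rV (.add rBest rTail rZero) .skip ;; .add rTail rU rOne

theorem wp_commitProg {L : ℕ} {qs : ℕ → List ℕ} {s : List ℕ} (hr : PosetOn n r)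
    (hl : Layout n tb vb W) (hS : Search n r tb vb W L qs M) (hC : Cur n r (slot n vb L) s M)
    (hext : Ext r s) (hlt : ∀ c ∈ s, c < n) (hfew : FewTops r {c | c ∈ s})
    (hnew : ∀ i < L, ¬ SameKey r n (qs i) s)
    (hU : M rU = hornerCode (vb + asc r n s) s n)
    (hQ : ∀ M', (∀ x, x = rHead ∨ x = rA ∨ x = rT → M' x = M x) →
      Search n r tb vb W (L + 1) (Function.update qs L s) M' → Q M') :
    WP N W commitProg Q M := by
  have hge := hS.static.ge
  have h1 := hl.tab_le
  have h2 : vb + n + 1 ≤ queueBase n vb := le_queueBase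
  have h3 : queueBase n vb ≤ slot n vb L := Nat.le_add_right _ _
  have hW : slot n vb L + n + 26 ≤ W := by
    have := slot_le (n := n) (vb := vb) (hS.queue.le_maxQueue hr)
    have h4 := slot_le (n := n) (vb := vb) (Nat.le_add_right (maxQueue n) 2)
    have := hl.le
    omega
  have ha : asc r n s ≤ n := (asc_le_length s).trans (length_le_of_lt hext.nodup hlt)
  have hcode := hornerCode_mem (vb := vb) ha
  obtain ⟨b, hb, hMb, hbmax⟩ := hS.best
  have hsb := slot_lt (n := n) (vb := vb) hb
  have hsb' : queueBase n vb ≤ slot n vb b := Nat.le_add_right _ _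
  have hq := hS.queue.push hext hlt hfew hnew
  refine wp_seq (wp_storeProg hS.static.n_eq hS.static.one hC (by omega) hW hU
    fun M1 f1 f2 f3 f4 f5 f6 f7 => ?_)
  have key := fun M' => hS.push (M' := M') hl hC hlt ha hq
  have e0 : M1 rN = n := by rw [f1 _ (by omega), hS.static.n_eq]
  have e1 : M1 rOne = 1 := by rw [f1 _ (by omega), hS.static.one]
  have e2 : M1 rZero = 0 := by rw [f1 _ (by omega), hS.static.zero]
  have e3 : M1 rTail = slot n vb L := by rw [f1 _ (by omega), hC.tail]
  have e4 : M1 rAsc = asc r n s := by rw [f1 _ (by omega), hC.asc_eq]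
  have e5 : M1 rBest = slot n vb b := by rw [f1 _ (by omega), hMb]
  have hkb : hornerCode (vb + asc r n s) s n ≠ slot n vb b + n := by omega
  have e7 : M1 (slot n vb b + n) = asc r n (qs b) := by
    rw [f2 _ (by omega) (by omega) hkb.symm, (hS.stored b hb).asc_eq]
  refine wp_seq (wp_add ?_ (wp_seq (wp_load (wp_seq (wp_sub (wp_seq (wp_ite ?_ ?_)))))))
  all_goals simp (disch := omega) only [Function.update_self, Function.update_of_ne, e0, e4, e5, e7]
  · omega
  · intro hgt
    refine wp_add ?_ (wp_add ?_ (hQ _ (fun x hx => ?_) (key _ (fun x hx => ?_) ?_ ?_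
      (fun x hx hx' hxk => ?_) ?_ ?_ ?_ ⟨L, by omega, ?_, fun i hi => ?_⟩)))
    all_goals try simp (disch := omega) only [Function.update_self, Function.update_of_ne, e1,
      e2, e3, f3, f4, f5, f6, f7, add_zero]
    · omega
    · omega
    · exact f1 x (by omega)
    · exact f1 x (by omega)
    · exact f2 x hx hx' hxk
    · by_cases hiL : i = L
      · simp [hiL]
      · rw [Function.update_of_ne hiL]
        exact (hbmax i (by omega)).trans (by omega)
  · intro hz
    refine wp_skip (wp_add ?_ (hQ _ (fun x hx => ?_) (key _ (fun x hx => ?_) ?_ ?_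
      (fun x hx hx' hxk => ?_) ?_ ?_ ?_ ⟨b, by omega, ?_, fun i hi => ?_⟩)))
    all_goals try simp (disch := omega) only [Function.update_self, Function.update_of_ne, e1,
      e2, e3, e5, f3, f4, f5, f6, f7, add_zero]
    · omega
    · exact f1 x (by omega)
    · exact f1 x (by omega)
    · exact f2 x hx hx' hxk
    · by_cases hiL : i = L
      · rw [hiL, Function.update_self]
        omega
      · rw [Function.update_of_ne hiL]
        exact hbmax i (by omega)

/-! ### Expanding a list -/

/-- The queue contains a list equivalent to the result of the transition from `s` given by the pair
`(a, t)`, if there is such a transition. -/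
def Done (n : ℕ) (r : ℕ → ℕ → Prop) (L : ℕ) (qs : ℕ → List ℕ) (s : List ℕ) (a t : ℕ) : Prop :=
  r a t → a ∉ s → ∃ j < L, ∃ s', Transition r n a t s s' ∧ SameKey r n (qs j) s'

/-- The queue `qs' 0, …, qs' (L' - 1)` extends the queue `qs 0, …, qs (L - 1)`. -/
def QueueLe (L : ℕ) (qs : ℕ → List ℕ) (L' : ℕ) (qs' : ℕ → List ℕ) : Prop :=
  L ≤ L' ∧ ∀ i < L, qs' i = qs i

theorem QueueLe.refl (L : ℕ) (qs : ℕ → List ℕ) : QueueLe L qs L qs := ⟨le_rfl, fun _ _ => rfl⟩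

theorem QueueLe.trans {L L' L'' : ℕ} {qs qs' qs'' : ℕ → List ℕ} (h : QueueLe L qs L' qs')
    (h' : QueueLe L' qs' L'' qs'') : QueueLe L qs L'' qs'' :=
  ⟨h.1.trans h'.1, fun i hi => (h'.2 i (lt_of_lt_of_le hi h.1)).trans (h.2 i hi)⟩

theorem Done.mono {L L' : ℕ} {qs qs' : ℕ → List ℕ} {s : List ℕ} {a t : ℕ}
    (h : Done n r L qs s a t) (hle : QueueLe L qs L' qs') : Done n r L' qs' s a t := by
  intro h1 h2
  obtain ⟨j, hj, s', h3, h4⟩ := h h1 h2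
  exact ⟨j, lt_of_lt_of_le hj hle.1, s', h3, by rwa [hle.2 j hj]⟩

/-- Make the transition from the list at `rHead` given by the elements in `rA` and `rT`, and store
the result unless an equivalent list has been found before. -/
def candProg : RAMProg :=
  loadProg rHead ;; passProg rA ;; passProg rN ;; codeProg ;; .load rV rU ;;
    .ite rV .skip commitProg

theorem wp_candProg {L h a t : ℕ} {qs : ℕ → List ℕ} (hr : PosetOn n r)
    (hl : Layout n tb vb W) (hS : Search n r tb vb W L qs M) (hh : h < L)
    (hMh : M rHead = slot n vb h) (hMa : M rA = a) (hMt : M rT = t) (hat : r a t)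
    (ha : a ∉ qs h) (hN : n ≤ N)
    (hQ : ∀ M' L' qs', M' rHead = M rHead → M' rA = a → M' rT = t →
      Search n r tb vb W L' qs' M' → QueueLe L qs L' qs' → Done n r L' qs' (qs h) a t → Q M') :
    WP N W candProg Q M := by
  have hge := hS.static.ge
  have hle := hS.static.le
  have h1 := hl.tab_le
  have h2 : vb + n + 1 ≤ queueBase n vb := le_queueBase
  have h3 : queueBase n vb ≤ slot n vb L := Nat.le_add_right _ _
  have hW : slot n vb L + n + 26 ≤ W := by
    have := slot_le (n := n) (vb := vb) (hS.queue.le_maxQueue hr)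
    have h4 := slot_le (n := n) (vb := vb) (Nat.le_add_right (maxQueue n) 2)
    have := hl.le
    omega
  have hsh := slot_lt (n := n) (vb := vb) hh
  have hsh' : queueBase n vb ≤ slot n vb h := Nat.le_add_right _ _
  have hq : tb + n * n + n ≤ slot n vb L := by omega
  have han := hr.lt_left hat
  have htn := hr.lt_right hat
  refine wp_seq (wp_loadProg hS.static (by omega) hMh (hS.stored h hh) (by omega) (by omega) hS.tail
    hq (by omega) hN fun M1 hF1 hC1 => ?_)
  have hS1 := hS.static.curFrame hF1 hq
  refine wp_seq (wp_passProg (a := a) (t := t) hr hS1 hC1 hq (by omega) (hS.queue.lt h hh)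
    (hS.queue.ext h hh) (by omega) ?_ han.le ?_ htn hN fun M2 s2 hF2 hC2 hP2 hs2 => ?_)
  · rw [hF1 _ (by omega), hMa]
  · rw [hF1 _ (by omega), hMt]
  have hF2' := hF1.trans hF2
  have hS2 := hS.static.curFrame hF2' hq
  refine wp_seq (wp_passProg (t := t) hr hS2 hC2 hq (by omega) hs2
    hP2.ext (by omega) hS2.n_eq le_rfl ?_ htn hN fun M3 s3 hF3 hC3 hP3 hs3 => ?_)
  · rw [hF2' _ (by omega), hMt]
  have hF3' := hF2'.trans hF3
  have hS3 := hS.static.curFrame hF3' hq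
  have htr : Transition r n a t (qs h) s3 := ⟨s2, hP2, hP3⟩
  have hasc : asc r n s3 ≤ n := (asc_le_length s3).trans (length_le_of_lt hP3.ext.nodup hs3)
  have hcode := hornerCode_bounds (vb + asc r n s3) s3 n
  have hpow : (vb + asc r n s3 + 1) * 2 ^ n ≤ queueBase n vb :=
    Nat.mul_le_mul_right _ (by omega)
  refine wp_seq (wp_codeProg (vb := vb) hS3 hC3 ?_ (by omega) (by omega) (by omega) hN
    fun M4 hF4 hU => ?_)
  · rw [hF3' _ (by omega), hS.vis]
  have hF4' := hF3'.trans (hF4.curFrame (q := slot n vb L) (n := n) (by omega) (by omega) (by omega))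
  have hcm := hornerCode_mem (vb := vb) hasc
  have hne : s3 ≠ [] := by
    intro h
    have := (htr.mem hr htn t).2 (Or.inr (Le.refl t))
    simp [h] at this
  have hS5 : ∀ v, Search n r tb vb W L qs (Function.update M4 rV v) := fun v =>
    hS.congr hl fun x hx => by
      simp (disch := omega) only [Function.update_of_ne]
      exact hF4' x (by omega)
  refine wp_seq (wp_load (wp_ite ?_ ?_))
  all_goals rw [Function.update_self, hU]
  · intro hvis
    refine wp_skip (hQ _ L qs ?_ ?_ ?_ (hS5 _) (.refl _ _) fun _ _ => ?_)
    · simp (disch := omega) only [Function.update_of_ne]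
      exact hF4' _ (by omega)
    · simp (disch := omega) only [Function.update_of_ne]
      rw [hF4' _ (by omega), hMa]
    · simp (disch := omega) only [Function.update_of_ne]
      rw [hF4' _ (by omega), hMt]
    · have := hS5 0
      have h6 := (this.visited s3 hne hs3 hasc).not
      rw [Function.update_of_ne (by omega)] at h6
      have h7 := h6.1 hvis
      push Not at h7
      obtain ⟨j, hj, hjk⟩ := h7
      exact ⟨j, hj, s3, htr, hjk⟩
  · intro hvis
    have hnew := ((hS5 0).visited s3 hne hs3 hasc).1 (by
      rw [Function.update_of_ne (by omega)]; exact hvis)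
    have hfew := (hS.queue.few h hh).transition hr (hS.queue.ext h hh) hat ha htr
    refine wp_commitProg hr hl (hS5 _) (hC3.congr fun x hx => ?_) hP3.ext hs3 hfew hnew ?_
      fun M6 h6 hS6 => hQ M6 (L + 1) _ ?_ ?_ ?_ hS6 ⟨by omega, fun i hi => ?_⟩ fun _ _ => ?_
    · rw [Function.update_of_ne (by omega)]
      exact hF4 x (by omega)
    · rw [Function.update_of_ne (by omega)]; exact hU
    · rw [h6 _ (by omega), Function.update_of_ne (by omega), hF4' _ (by omega)]
    · rw [h6 _ (by omega), Function.update_of_ne (by omega), hF4' _ (by omega), hMa]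
    · rw [h6 _ (by omega), Function.update_of_ne (by omega), hF4' _ (by omega), hMt]
    · rw [Function.update_of_ne (by omega)]
    · refine ⟨L, by omega, s3, htr, ?_⟩
      rw [Function.update_self]
      exact ⟨rfl, fun _ => Iff.rfl⟩

/-- Call `candProg` if the element in `rA` is missing in the list at `rHead` and below that in
`rT`. -/
def pairProg : RAMProg :=
  .sub rU rA rT ;; .sub rV rT rA ;; .add rU rU rV ;;
    .ite rU (leProg rA rT ;;
      .ite rLe (.add rU rHead rA ;; .load rU rU ;; .ite rU .skip candProg) .skip) .skip

theorem wp_pairProg {L h a t : ℕ} {qs : ℕ → List ℕ} (hr : PosetOn n r)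
    (hl : Layout n tb vb W) (hS : Search n r tb vb W L qs M) (hh : h < L)
    (hMh : M rHead = slot n vb h) (hMa : M rA = a) (hMt : M rT = t) (han : a < n) (htn : t < n)
    (hN : n ≤ N)
    (hQ : ∀ M' L' qs', M' rHead = slot n vb h → M' rA = a → M' rT = t →
      Search n r tb vb W L' qs' M' → QueueLe L qs L' qs' → Done n r L' qs' (qs h) a t → Q M') :
    WP N W pairProg Q M := by
  have hge := hS.static.ge
  have hle := hS.static.le
  have h1 := hl.tab_le
  have h2 : vb + n + 1 ≤ queueBase n vb := le_queueBase
  have hW : slot n vb L + n + 26 ≤ W := by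
    have := slot_le (n := n) (vb := vb) (hS.queue.le_maxQueue hr)
    have h4 := slot_le (n := n) (vb := vb) (Nat.le_add_right (maxQueue n) 2)
    have := hl.le
    omega
  have hsh := slot_lt (n := n) (vb := vb) hh
  have hsh' : queueBase n vb ≤ slot n vb h := Nat.le_add_right _ _
  have hfr : ∀ M', Frame 11 23 M M' → Search n r tb vb W L qs M' ∧ M' rHead = slot n vb h ∧
      M' rA = a ∧ M' rT = t := by
    intro M' hF
    refine ⟨hS.congr hl fun x hx => hF x (by omega), ?_, ?_, ?_⟩
    · rw [hF _ (by omega), hMh]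
    · rw [hF _ (by omega), hMa]
    · rw [hF _ (by omega), hMt]
  have skip : ∀ M', Frame 11 23 M M' → (r a t → a ∈ qs h) → WP N W .skip Q M' := by
    intro M' hF hno
    obtain ⟨g1, g2, g3, g4⟩ := hfr M' hF
    exact wp_skip (hQ M' L qs g2 g3 g4 g1 (.refl _ _) fun h3 h4 => absurd (hno h3) h4)
  refine wp_seq (wp_sub (wp_seq (wp_sub (wp_seq (wp_add ?_ ?_)))))
  · simp (disch := omega) only [Function.update_self, Function.update_of_ne]
    omega
  generalize hM1 : Function.update (_ : ℕ → ℕ) (_ : ℕ) (_ : ℕ) = M1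
  have hU : M1 rU = (a - t) + (t - a) := by
    subst hM1
    simp (disch := omega) only [Function.update_self, Function.update_of_ne, hMa, hMt]
  have hF1 : Frame 11 23 M M1 := by
    subst hM1
    intro y hy
    simp (disch := omega) only [Function.update_of_ne]
  obtain ⟨g1, g2, g3, g4⟩ := hfr M1 hF1
  refine wp_ite (fun hne => ?_) (fun hz => skip M1 hF1 fun hat => ?_)
  · refine wp_seq (wp_leProg g1.static (by omega) (by omega) (by omega) (by omega) hN
      fun M2 hF2 hL2 => ?_)
    have hF2' := hF1.trans hF2 (by omega)
    rw [g3, g4] at hL2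
    refine wp_ite (fun hne2 => ?_) (fun hz2 => skip M2 hF2' fun hat => ?_)
    · have hat : r a t := by
        by_contra hat
        rw [if_neg (by rintro (h | h); exacts [by omega, hat h])] at hL2
        exact hne2 hL2
      obtain ⟨k1, k2, k3, k4⟩ := hfr M2 hF2'
      refine wp_seq (wp_add ?_ (wp_seq (wp_load ?_)))
      · rw [k2, k3]; omega
      generalize hM3 : Function.update (_ : ℕ → ℕ) (_ : ℕ) (_ : ℕ) = M3
      have hU3 : M3 rU = pos (qs h) a := by
        subst hM3
        simp (disch := omega) only [Function.update_self, Function.update_of_ne, k2, k3]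
        exact (k1.stored h hh).pos_eq a han
      have hF3 : Frame 11 23 M M3 := by
        subst hM3
        intro y hy
        simp (disch := omega) only [Function.update_of_ne]
        exact hF2' y hy
      obtain ⟨l1, l2, l3, l4⟩ := hfr M3 hF3
      refine wp_ite (fun hne3 => skip M3 hF3 fun _ => ?_) (fun hz3 => ?_)
      · by_contra h
        exact hne3 (hU3.trans (pos_eq_zero.2 h))
      · rw [hU3, pos_eq_zero] at hz3
        refine wp_candProg hr hl l1 hh l2 l3 l4 hat hz3 hN fun M4 L' qs' m1 m2 m3 m4 m5 m6 => ?_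
        exact hQ M4 L' qs' (m1.trans l2) m2 m3 m4 m5 m6
    · rw [if_pos (show Le r a t from Or.inr hat)] at hL2
      omega
  · have : a = t := by omega
    exact absurd (this ▸ hat) (hr.irrefl _)

/-- Make all transitions from the list at `rHead`, then advance `rHead` to the next list. -/
def expandProg : RAMProg :=
  forLoop rA rN (forLoop rT rN pairProg) ;; .add rHead rHead rN ;; .add rHead rHead rOne ;;
    .add rHead rHead rOne ;; .add rHead rHead rOne ;; .sub rMain rTail rHead

theorem wp_expandProg {L h : ℕ} {qs : ℕ → List ℕ} (hr : PosetOn n r)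
    (hl : Layout n tb vb W) (hS : Search n r tb vb W L qs M) (hh : h < L)
    (hMh : M rHead = slot n vb h) (hN : n ≤ N)
    (hQ : ∀ M' L' qs', M' rHead = slot n vb (h + 1) → M' rMain = slot n vb L' - slot n vb (h + 1) →
      Search n r tb vb W L' qs' M' → QueueLe L qs L' qs' →
      (∀ a t, Done n r L' qs' (qs h) a t) → Q M') :
    WP N W expandProg Q M := by
  have hge := hS.static.ge
  have hhL : ∀ {L' qs'}, QueueLe L qs L' qs' → h < L' := fun hle => lt_of_lt_of_le hh hle.1
  refine wp_seq (wp_for (L := n) (fun a M1 => M1 rHead = slot n vb h ∧ ∃ L' qs',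
    Search n r tb vb W L' qs' M1 ∧ QueueLe L qs L' qs' ∧
    ∀ a' t, a' < a → Done n r L' qs' (qs h) a' t) (by decide) hS.static.n_eq hS.static.one hN ?_ ?_ ?_)
  · intro g
    refine ⟨?_, L, qs, hS.congr hl fun x hx => ?_, .refl _ _, by omega⟩
    · simp (disch := omega) only [Function.update_of_ne, hMh]
    · simp (disch := omega) only [Function.update_of_ne]
  · rintro a ha M1 ⟨hM1, L1, qs1, hS1, hle1, hd1⟩ hMa - -
    refine wp_for (L := n) (fun t M2 => M2 rHead = slot n vb h ∧ M2 rA = a ∧ ∃ L' qs',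
      Search n r tb vb W L' qs' M2 ∧ QueueLe L qs L' qs' ∧
      (∀ a' t, a' < a → Done n r L' qs' (qs h) a' t) ∧ ∀ t' < t, Done n r L' qs' (qs h) a t')
      (by decide) hS1.static.n_eq hS1.static.one hN ?_ ?_ ?_
    · intro g
      refine ⟨?_, ?_, L1, qs1, hS1.congr hl fun x hx => ?_, hle1, hd1, by omega⟩
      · simp (disch := omega) only [Function.update_of_ne, hM1]
      · simp (disch := omega) only [Function.update_of_ne, hMa]
      · simp (disch := omega) only [Function.update_of_ne]
    · rintro t ht M2 ⟨hM2, hMa2, L2, qs2, hS2, hle2, hd2, hd2'⟩ hMt - -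
      refine wp_pairProg hr hl hS2 (hhL hle2) hM2 hMa2 hMt ha ht hN
        fun M3 L3 qs3 k1 k2 k3 hS3 hle3 hd3 => ?_
      rw [hle2.2 h hh] at hd3
      refine ⟨k3, hS3.static.n_eq, hS3.static.one, fun g => ⟨?_, ?_, L3, qs3,
        hS3.congr hl fun x hx => ?_, hle2.trans hle3, fun a' t' h' => (hd2 a' t' h').mono hle3,
        fun t' ht' => ?_⟩⟩
      · simp (disch := omega) only [Function.update_of_ne, k1]
      · simp (disch := omega) only [Function.update_of_ne, k2]
      · simp (disch := omega) only [Function.update_of_ne]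
      · by_cases htt : t' = t
        · rwa [htt]
        · exact (hd2' t' (by omega)).mono hle3
    · rintro M2 ⟨hM2, hMa2, L2, qs2, hS2, hle2, hd2, hd2'⟩ hn2 ho2
      refine ⟨hMa2, hn2, ho2, fun g => ⟨?_, L2, qs2, hS2.congr hl fun x hx => ?_, hle2,
        fun a' t h' => ?_⟩⟩
      · simp (disch := omega) only [Function.update_of_ne, hM2]
      · simp (disch := omega) only [Function.update_of_ne]
      · by_cases haa : a' = a
        · subst haa
          intro hat
          exact hd2' t (hr.lt_right hat) hat
        · exact hd2 a' t (by omega)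
  · rintro M1 ⟨hM1, L1, qs1, hS1, hle1, hd1⟩ hn1 ho1
    have hW : slot n vb (h + 1) ≤ W := by
      have := (slot_le (n := n) (vb := vb) (show h + 1 ≤ maxQueue n + 2 by
        have := hS.queue.le_maxQueue hr
        omega))
      have := hl.le
      omega
    rw [slot_succ] at hW
    refine wp_seq (wp_add ?_ (wp_seq (wp_add ?_ (wp_seq (wp_add ?_ (wp_seq (wp_add ?_ (wp_sub
      (hQ _ L1 qs1 ?_ ?_ (hS1.congr hl fun x hx => ?_) hle1 fun a t hat => ?_)))))))))
    all_goals try simp (disch := omega) only [Function.update_self, Function.update_of_ne, hM1, hn1,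
      ho1, slot_succ, hS1.tail]
    · omega
    · omega
    · omega
    · omega
    · exact hd1 a t (hr.lt_left hat) hat

/-- Expand the lists of the queue one after the other. -/
def mainProg : RAMProg := .loop rMain expandProg

/-- The time of the search is the time of one expansion times the bound on the queue. -/
theorem run_mainProg {L : ℕ} {qs : ℕ → List ℕ} (hr : PosetOn n r)
    (hl : Layout n tb vb W) (hS : Search n r tb vb W L qs M)
    (hMh : M rHead = slot n vb 0) (hMm : M rMain = slot n vb L - slot n vb 0) (hN : n ≤ N)
    (hc : maxConst mainProg ≤ W) (hM : ∀ k, M k ≤ W) :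
    ∃ M' t, mainProg.Run M M' t ∧
      t ≤ (maxQueue n * (cost N expandProg + 1) + 1) * (5 * bitLen W) ∧ (∀ k, M' k ≤ W) ∧
      ∃ L' qs', Search n r tb vb W L' qs' M' ∧ ∀ i < L', ∀ a t, Done n r L' qs' (qs' i) a t := by
  refine run_loop (N := N) (I := fun k M => ∃ h L qs, h + k = maxQueue n ∧ h ≤ L ∧
    M rHead = slot n vb h ∧ M rMain = slot n vb L - slot n vb h ∧ Search n r tb vb W L qs M ∧
    ∀ i < h, ∀ a t, Done n r L qs (qs i) a t) hc ?_ ?_ (maxQueue n) M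
    ⟨0, L, qs, by omega, by omega, hMh, hMm, hS, by omega⟩ hM
  · rintro k M ⟨h, L, qs, hk, hhL, h1, h2, hS, hd⟩ hne
    have hlt : h < L := by
      by_contra hh
      have : h = L := by omega
      subst this
      omega
    have hLm := hS.queue.le_maxQueue hr
    refine ⟨k - 1, by omega, wp_expandProg hr hl hS hlt h1 hN fun M' L' qs' g1 g2 g3 g4 g5 => ?_⟩
    refine ⟨h + 1, L', qs', by omega, lt_of_lt_of_le hlt g4.1, g1, g2, g3, fun i hi a t => ?_⟩
    rw [g4.2 i (by omega)]
    by_cases hih : i = h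
    · rw [hih]; exact g5 a t
    · exact (hd i (by omega) a t).mono g4
  · rintro k M ⟨h, L, qs, hk, hhL, h1, h2, hS, hd⟩ hz
    refine ⟨L, qs, hS, fun i hi => hd i ?_⟩
    by_contra hih
    have := slot_lt (n := n) (vb := vb) (show h < L by omega)
    omega

end JumpNumber

namespace JumpNumber

variable {n N W tb vb : ℕ} {r : ℕ → ℕ → Prop} {Q : (ℕ → ℕ) → Prop} {M : ℕ → ℕ}

/-! ### Preparing the memory -/

/-- The input: the number `n` and the table of the relation `r`. -/
structure IsInput (n : ℕ) (r : ℕ → ℕ → Prop) (inp : ℕ → ℕ) : Prop where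
  zero : inp 0 = n
  le_one : ∀ x, 1 ≤ x → inp x ≤ 1
  blank : ∀ x, n * n < x → inp x = 0
  table : ∀ i j, i < n → j < n → inp (1 + (n * i + j)) = if r i j then 1 else 0

/-- Branch on the cells `k, …, 1`, all of them `0` or `1`, and go on with the program that belongs
to their contents. Thereby the input bits in these cells are kept in the control state, and the
cells can be used as variables. -/
def peek : ℕ → ((ℕ → ℕ) → RAMProg) → (ℕ → ℕ) → RAMProg
  | 0, f, g => f g
  | k + 1, f, g => .ite (k + 1) (peek k f (Function.update g (k + 1) 1))
      (peek k f (Function.update g (k + 1) 0))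

theorem run_peek {f : (ℕ → ℕ) → RAMProg} {τ : ℕ} (hW : 1 ≤ W) : ∀ {k : ℕ} (g : ℕ → ℕ), k ≤ W →
    (∀ d, 1 ≤ d → d ≤ k → M d ≤ 1) →
    (∀ g', (∀ d, 1 ≤ d → d ≤ k → g' d = M d) → (∀ d, k < d → g' d = g d) →
      ∃ M' t, (f g').Run M M' t ∧ t ≤ τ ∧ Q M') →
    ∃ M' t, (peek k f g).Run M M' t ∧ t ≤ τ + k * (5 * bitLen W) ∧ Q M'
  | 0, g, _, _, h => by
    obtain ⟨M', t, h1, h2, h3⟩ := h g (by omega) (fun _ _ => rfl)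
    exact ⟨M', t, h1, by omega, h3⟩
  | k + 1, g, hk, hM, h => by
    have hb1 := bitLen_mono hk
    have hb2 := bitLen_mono ((hM (k + 1) (by omega) le_rfl).trans hW)
    have key : ∀ v, M (k + 1) = v → ∃ M' t, (peek k f (Function.update g (k + 1) v)).Run M M' t ∧
        t ≤ τ + k * (5 * bitLen W) ∧ Q M' := by
      intro v hv
      refine run_peek hW _ (by omega) (fun d h1 h2 => hM d h1 (by omega)) fun g' h1 h2 => ?_
      refine h g' (fun d hd hdk => ?_) (fun d hd => ?_)
      · by_cases hd' : d = k + 1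
        · rw [h2 d (by omega), hd', Function.update_self, hv]
        · exact h1 d hd (by omega)
      · rw [h2 d (by omega), Function.update_of_ne (by omega)]
    have e : (k + 1) * (5 * bitLen W) = k * (5 * bitLen W) + 5 * bitLen W := by ring
    by_cases h0 : M (k + 1) = 0
    · obtain ⟨M', t, h1, h2, h3⟩ := key 0 h0
      exact ⟨M', _, .ite_neg h0 h1, by omega, h3⟩
    · have := hM (k + 1) (by omega) le_rfl
      obtain ⟨M', t, h1, h2, h3⟩ := key 1 (by omega)
      exact ⟨M', _, .ite_pos h0 h1, by omega, h3⟩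

/-- Write `g 1, …, g k` behind the address in `rU`, and advance `rU`. -/
def fixProg (g : ℕ → ℕ) : ℕ → RAMProg
  | 0 => .skip
  | k + 1 => fixProg g k ;; .add rU rU rOne ;; .const rW (g (k + 1)) ;; .store rU rW

theorem wp_fixProg {g : ℕ → ℕ} {B k : ℕ} (hB : 23 ≤ B) (hW : B + k ≤ W)
    (hone : M rOne = 1) (hU : M rU = B)
    (hQ : ∀ M', M' rU = B + k → (∀ x, x < 20 → M' x = M x) → (∀ x, B + k < x → M' x = M x) →
      (∀ d, 1 ≤ d → d ≤ k → M' (B + d) = g d) → Q M') : WP N W (fixProg g k) Q M := by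
  induction k generalizing Q with
  | zero => exact wp_skip (hQ M hU (fun _ _ => rfl) (fun _ _ => rfl) (by omega))
  | succ k ih =>
    refine wp_seq (ih (by omega) fun M1 h1 h2 h3 h4 => ?_)
    have h5 : M1 rOne = 1 := by rw [h2 _ (by omega), hone]
    refine wp_seq (wp_add_eq (v := B + (k + 1)) (by omega) (by omega) (wp_seq (wp_const
      (wp_store_eq (k := B + (k + 1)) (v := g (k + 1)) ?_ ?_ (hQ _ ?_ (fun x hx => ?_)
        (fun x hx => ?_) (fun d hd hdk => ?_))))))
    all_goals try simp (disch := omega) only [Function.update_self, Function.update_of_ne]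
    · exact h2 x hx
    · exact h3 x (by omega)
    · by_cases hd' : d = k + 1
      · simp [hd']
      · simp (disch := omega) only [Function.update_self, Function.update_of_ne]
        exact h4 d hd (by omega)

/-- Move the input table behind the cells used as variables and put its address into `rTab`. Here
`g 1, …, g 22` are the original contents of the cells `1, …, 22`. -/
def tableProg (g : ℕ → ℕ) : RAMProg :=
  .const rOne 1 ;; .const rZero 0 ;; .const rAsc 0 ;; forLoop rC rN (.add rAsc rAsc rN) ;;
    .const rV 23 ;; .add rTab rAsc rV ;;
    forLoop rC rAsc (.add rU rV rC ;; .load rW rU ;; .add rU rU rTab ;; .store rU rW) ;;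
    .add rU rTab rZero ;; fixProg g 22 ;; .add rTab rTab rOne

theorem wp_tableProg {inp g : ℕ → ℕ} (hI : IsInput n r inp)
    (hg : ∀ d, 1 ≤ d → d ≤ 22 → g d = inp d) (hW : 2 * (n * n) + n + 70 ≤ W) (hN : n * n + n ≤ N)
    (hQ : ∀ M', M' rN = n → M' rOne = 1 → M' rZero = 0 → M' rAsc = n * n → M' rTab = n * n + 24 →
      (∀ x, 1 ≤ x → M' (n * n + 23 + x) = inp x) → Q M') : WP N W (tableProg g) Q inp := by
  refine wp_seq (wp_const (wp_seq (wp_const (wp_seq (wp_const (wp_seq (wp_for (L := n)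
    (fun k M1 => M1 rZero = 0 ∧ M1 rAsc = n * k ∧ ∀ x, 23 ≤ x → M1 x = inp x) (by decide)
    ?_ ?_ (by omega) ?_ ?_ ?_)))))))
  · simp (disch := omega) only [Function.update_of_ne, hI.zero]
  · simp (disch := omega) only [Function.update_self, Function.update_of_ne]
  · intro g'
    refine ⟨?_, ?_, fun x hx => ?_⟩ <;>
    simp (disch := omega) only [Function.update_self, Function.update_of_ne, mul_zero]
  · rintro k hk M1 ⟨h1, h2, h3⟩ hMk hn1 ho1
    have : n * (k + 1) ≤ n * n := Nat.mul_le_mul_left n hk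
    refine wp_add_eq (v := n * (k + 1)) ?_ (by omega) ⟨?_, ?_, ?_, fun g' => ⟨?_, ?_, fun x hx => ?_⟩⟩
    · rw [h2, hn1]; ring
    all_goals simp (disch := omega) only [Function.update_self, Function.update_of_ne, hMk, hn1, ho1,
      h1]
    exact h3 x hx
  rintro M1 ⟨h1, h2, h3⟩ hn1 ho1
  refine wp_seq (wp_const (wp_seq (wp_add_eq (v := n * n + 23) ?_ (by omega) (wp_seq
    (wp_for (L := n * n) (fun k M2 => M2 rN = n ∧ M2 rZero = 0 ∧ M2 rTab = n * n + 23 ∧ M2 rV = 23 ∧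
      (∀ x, 23 ≤ x → x < n * n + 23 → M2 x = inp x) ∧
      ∀ x, 23 ≤ x → M2 (n * n + 23 + x) = if x < 23 + k then inp x else 0) (by decide)
      ?_ ?_ (by omega) ?_ ?_ ?_)))))
  · simp (disch := omega) only [Function.update_self, Function.update_of_ne, h2]
  · simp (disch := omega) only [Function.update_self, Function.update_of_ne, h2]
  · simp (disch := omega) only [Function.update_self, Function.update_of_ne, ho1]
  · intro g'
    refine ⟨?_, ?_, ?_, ?_, fun x hx hx' => ?_, fun x hx => ?_⟩ <;>
    simp (disch := omega) only [Function.update_self, Function.update_of_ne, hn1, h1]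
    · exact h3 x hx
    · rw [h3 _ (by omega), if_neg (by omega)]
      exact hI.blank _ (by omega)
  · rintro k hk M2 ⟨e1, e2, e3, e4, e5, e6⟩ hMk hl2 ho2
    refine wp_seq (wp_add_eq (v := 23 + k) (by rw [e4, hMk]) (by omega) (wp_seq (wp_load (wp_seq
      (wp_add_eq (v := n * n + 23 + (23 + k)) ?_ (by omega) (wp_store_eq
      (k := n * n + 23 + (23 + k)) (v := inp (23 + k)) ?_ ?_ ⟨?_, ?_, ?_, fun g' =>
      ⟨?_, ?_, ?_, ?_, fun x hx hx' => ?_, fun x hx => ?_⟩⟩))))))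
    all_goals try simp (disch := omega) only [Function.update_self, Function.update_of_ne, e1, e2,
      e3, e4, hMk, hl2, ho2]
    · omega
    · exact e5 _ (by omega) (by omega)
    · exact e5 x hx hx'
    · by_cases hxk : x = 23 + k
      · subst hxk
        simp (disch := omega) only [Function.update_self, Function.update_of_ne]
        rw [if_pos (by omega)]
      · simp (disch := omega) only [Function.update_self, Function.update_of_ne]
        rw [e6 x hx]
        by_cases hx' : x < 23 + k
        · rw [if_pos hx', if_pos (by omega)]
        · rw [if_neg hx', if_neg (by omega)]
  rintro M2 ⟨e1, e2, e3, e4, e5, e6⟩ hl2 ho2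
  refine wp_seq (wp_add_eq (v := n * n + 23) (by rw [e3, e2]) (by omega) (wp_seq (wp_fixProg
    (B := n * n + 23) (by omega) (by omega) ?_ ?_ fun M3 f1 f2 f3 f4 => ?_)))
  · simp (disch := omega) only [Function.update_of_ne, ho2]
  · simp (disch := omega) only [Function.update_self]
  have f5 : M3 rTab = n * n + 23 := by
    rw [f2 _ (by omega), Function.update_of_ne (by omega), e3]
  have f6 : M3 rOne = 1 := by
    rw [f2 _ (by omega), Function.update_of_ne (by omega), ho2]
  refine wp_add_eq (v := n * n + 24) (by rw [f5, f6]) (by omega) (hQ _ ?_ ?_ ?_ ?_ ?_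
    fun x hx => ?_)
  all_goals simp (disch := omega) only [Function.update_self, Function.update_of_ne]
  · rw [f2 _ (by omega), Function.update_of_ne (by omega), e1]
  · rw [f6]
  · rw [f2 _ (by omega), Function.update_of_ne (by omega), e2]
  · rw [f2 _ (by omega), Function.update_of_ne (by omega), hl2]
  · by_cases hx22 : x ≤ 22
    · rw [f4 x hx hx22, hg x hx hx22]
    · rw [f3 _ (by omega), Function.update_of_ne (by omega), e6 x (by omega)]
      split_ifs with h
      · rfl
      · exact (hI.blank x (by omega)).symm

/-- Compute the addresses of the table of visited sets and of the queue, and store the empty list as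
the only member of the queue. -/
def queueProg : RAMProg :=
  .add rVis rTab rAsc ;; .add rVis rVis rN ;; .add rU rVis rN ;; .add rU rU rOne ;;
    forLoop rC rN (.add rU rU rU) ;; .add rHead rU rZero ;; .add rBest rU rZero ;; .add rV rU rN ;;
    .add rV rV rOne ;; .add rV rV rOne ;; .store rV rN ;; .add rTail rV rOne ;;
    .sub rMain rTail rHead

theorem wp_queueProg {inp : ℕ → ℕ} (hr : PosetOn n r) (hI : IsInput n r inp)
    (hl : Layout n (n * n + 24) (2 * (n * n) + n + 24) W) (hN : n ≤ N)
    (hMn : M rN = n) (hMo : M rOne = 1) (hMz : M rZero = 0) (hMs : M rAsc = n * n)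
    (hMt : M rTab = n * n + 24) (hM : ∀ x, 1 ≤ x → M (n * n + 23 + x) = inp x)
    (hQ : ∀ M', Search n r (n * n + 24) (2 * (n * n) + n + 24) W 1 (fun _ => []) M' →
      M' rHead = slot n (2 * (n * n) + n + 24) 0 →
      M' rMain = slot n (2 * (n * n) + n + 24) 1 - slot n (2 * (n * n) + n + 24) 0 → Q M') :
    WP N W queueProg Q M := by
  set vb := 2 * (n * n) + n + 24 with hvb
  have hq0 : slot n vb 0 = queueBase n vb := by simp [slot]
  have hq1 : slot n vb 1 = slot n vb 0 + n + 3 := slot_succ 0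
  have h2 : vb + n + 1 ≤ queueBase n vb := le_queueBase
  have hW : slot n vb 1 + n + 26 ≤ W := by
    have h4 := slot_le (n := n) (vb := vb) (show 1 ≤ maxQueue n + 2 by omega)
    have := hl.le
    omega
  refine wp_seq (wp_add_eq (v := n * n + 24 + n * n) (by rw [hMt, hMs]) (by omega) (wp_seq
    (wp_add_eq (v := vb) ?_ (by omega) (wp_seq (wp_add_eq (v := vb + n) ?_ (by omega) (wp_seq
    (wp_add_eq (v := vb + n + 1) ?_ (by omega) (wp_seq ?_))))))))
  all_goals try simp (disch := omega) only [Function.update_self, Function.update_of_ne, hMn, hMo]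
  · omega
  refine wp_for (L := n) (fun k M1 => (∀ x, x < 4 ∨ n * n + 23 ≤ x → M1 x = M x) ∧ M1 rVis = vb ∧
    M1 rU = (vb + n + 1) * 2 ^ k) (by decide) ?_ ?_ hN ?_ ?_ ?_
  · simp (disch := omega) only [Function.update_self, Function.update_of_ne, hMn]
  · simp (disch := omega) only [Function.update_self, Function.update_of_ne, hMo]
  · intro g
    refine ⟨fun x hx => ?_, ?_, ?_⟩ <;>
    simp (disch := omega) only [Function.update_self, Function.update_of_ne, pow_zero, mul_one]
  · rintro k hk M1 ⟨h3, h4, h5⟩ hMk hn1 ho1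
    have : (vb + n + 1) * 2 ^ (k + 1) ≤ queueBase n vb :=
      Nat.mul_le_mul_left _ (Nat.pow_le_pow_right (by omega) hk)
    refine wp_add_eq (v := (vb + n + 1) * 2 ^ (k + 1)) (by rw [h5]; ring) (by omega)
      ⟨?_, ?_, ?_, fun g => ⟨fun x hx => ?_, ?_, ?_⟩⟩
    all_goals simp (disch := omega) only [Function.update_self, Function.update_of_ne, hMk, hn1, ho1,
      h4]
    exact h3 x hx
  rintro M1 ⟨h3, h4, h5⟩ hn1 ho1
  have h6 : M1 rZero = 0 := by rw [h3 _ (by omega), hMz]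
  change M1 rU = queueBase n vb at h5
  rw [← hq0] at h5 h2
  generalize hq : slot n vb 0 = q at *
  have hinp : ∀ x, 1 ≤ x → M1 (n * n + 23 + x) = inp x := fun x hx => by
    rw [h3 _ (by omega), hM x hx]
  refine wp_seq (wp_add_eq (v := q) ?_ (by omega) (wp_seq (wp_add_eq (v := q) ?_ (by omega) (wp_seq
    (wp_add_eq (v := q + n) ?_ (by omega) (wp_seq (wp_add_eq (v := q + n + 1) ?_ (by omega) (wp_seq
    (wp_add_eq (v := q + n + 2) ?_ (by omega) (wp_seq (wp_store_eq (k := q + n + 2) (v := n) ?_ ?_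
    (wp_seq (wp_add_eq (v := q + n + 3) ?_ (by omega) (wp_sub ?_))))))))))))))
  all_goals try simp (disch := omega) only [Function.update_self, Function.update_of_ne, h5, h6,
    hn1, ho1, add_zero]
  generalize hM2 : Function.update (_ : ℕ → ℕ) (_ : ℕ) (_ : ℕ) = M2
  have k1 : ∀ x, x < 5 ∨ (23 ≤ x ∧ x ≠ q + n + 2) → M2 x = M1 x := by
    subst hM2
    intro x hx
    simp (disch := omega) only [Function.update_of_ne]
  have k2 : M2 (q + n + 2) = n := by
    subst hM2
    simp (disch := omega) only [Function.update_self, Function.update_of_ne]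
  have k3 : M2 rHead = q := by
    subst hM2
    simp (disch := omega) only [Function.update_self, Function.update_of_ne]
  have k4 : M2 rBest = q := by
    subst hM2
    simp (disch := omega) only [Function.update_self, Function.update_of_ne]
  have k5 : M2 rTail = q + n + 3 := by
    subst hM2
    simp (disch := omega) only [Function.update_self, Function.update_of_ne]
  have k6 : M2 rMain = q + n + 3 - q := by
    subst hM2
    simp (disch := omega) only [Function.update_self, Function.update_of_ne]
  have k7 : ∀ x, 1 ≤ x → n * n + 23 + x ≠ q + n + 2 → M2 (n * n + 23 + x) = inp x := by
    intro x hx hne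
    rw [k1 _ (by omega), hinp x hx]
  have k8 : ∀ y, 2 * (n * n) + 23 < y → y ≠ q + n + 2 → M2 y = 0 := by
    intro y hy hne
    have := k7 (y - (n * n + 23)) (by omega) (by omega)
    rw [show n * n + 23 + (y - (n * n + 23)) = y by omega] at this
    rw [this]
    exact hI.blank _ (by omega)
  refine hQ M2 ⟨⟨?_, ?_, ?_, ?_, fun i j hi hj => ?_, by omega, by omega⟩, ?_, ?_, ?_, ?_, ?_,
    ⟨by omega, rfl, ?_, ?_, ?_, ?_⟩⟩ k3 ?_
  · rw [k1 _ (by omega), hn1]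
  · rw [k1 _ (by omega), ho1]
  · rw [k1 _ (by omega), h6]
  · rw [k1 _ (by omega), h3 _ (by omega), hMt]
  · have hmul : n * i ≤ n * n := Nat.mul_le_mul_left n hi
    have e : n * n + 24 + n * i + j = n * n + 23 + (1 + (n * i + j)) := by ring
    rw [e, k7 _ (by omega) (by omega)]
    rcases Nat.lt_or_eq_of_le hi with hi | rfl
    · exact hI.table i j hi hj
    · rw [hI.blank _ (by omega), if_neg]
      intro h
      exact absurd (hr.lt_left h) (lt_irrefl _)
  · rw [k1 _ (by omega), h4]
  · rw [k5, hq1]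
  · intro i hi
    obtain rfl : i = 0 := by omega
    rw [hq]
    refine ⟨fun c hc => ?_, ?_, ?_, ?_⟩
    · rw [k8 _ (by omega) (by omega)]; rfl
    · rw [k8 _ (by omega) (by omega)]; rfl
    · rw [k8 _ (by omega) (by omega)]; rfl
    · rw [k2]; rfl
  · exact ⟨0, by omega, by rw [k4, hq], fun _ _ => le_rfl⟩
  · intro s hs hsn ha
    have hc := hornerCode_mem (vb := vb) ha
    refine iff_of_true (k8 _ (by omega) (by omega)) fun i _ hk => hs ?_
    exact List.eq_nil_iff_forall_not_mem.2 fun c hc => List.not_mem_nil ((hk.2 c).2 hc)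
  · exact fun _ _ => trivial
  · simp
  · intro i _
    simpa using fewTops_empty
  · intro i hi j hj _
    omega
  · rw [k6, hq1]

/-! ### Writing the output -/

/-- Given the address `R` in cell `0`, and `1` in cell `22`, put `R + d` into the cells `d ≤ k`. -/
def pointerProg : ℕ → RAMProg
  | 0 => .skip
  | k + 1 => pointerProg k ;; .add (k + 1) k 22

/-- Replace the addresses in the cells `0, …, k` by what they point to. -/
def derefProg : ℕ → RAMProg
  | 0 => .load 0 0
  | k + 1 => derefProg k ;; .load (k + 1) (k + 1)

theorem wp_pointerProg {R k : ℕ} (hk : k ≤ 22) (h0 : M 0 = R) (h1 : M 22 = 1) (hW : R + k ≤ W)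
    (hQ : ∀ M', (∀ d, d ≤ k → M' d = R + d) → (∀ x, k < x → M' x = M x) → Q M') :
    WP N W (pointerProg k) Q M := by
  induction k generalizing Q with
  | zero => exact wp_skip (hQ M (fun d hd => by obtain rfl : d = 0 := by omega
                                                simpa using h0) fun _ _ => rfl)
  | succ k ih =>
    refine wp_seq (ih (by omega) (by omega) fun M1 g1 g2 => ?_)
    refine wp_add_eq (v := R + (k + 1)) ?_ hW (hQ _ (fun d hd => ?_) fun x hx => ?_)
    · rw [g1 k le_rfl, g2 22 (by omega), h1]; ring
    · by_cases hdk : d = k + 1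
      · simp [hdk]
      · rw [Function.update_of_ne hdk, g1 d (by omega)]
    · rw [Function.update_of_ne (by omega), g2 x (by omega)]

theorem wp_derefProg {R k : ℕ} (hR : k < R) (h0 : ∀ d, d ≤ k → M d = R + d)
    (hQ : ∀ M', (∀ d, d ≤ k → M' d = M (R + d)) → (∀ x, k < x → M' x = M x) → Q M') :
    WP N W (derefProg k) Q M := by
  induction k generalizing Q with
  | zero =>
    refine wp_load (hQ _ (fun d hd => ?_) fun x hx => ?_)
    · obtain rfl : d = 0 := by omega
      rw [Function.update_self, h0 0 le_rfl]
    · rw [Function.update_of_ne (by omega)]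
  | succ k ih =>
    refine wp_seq (ih (by omega) (fun d hd => h0 d (by omega)) fun M1 g1 g2 => ?_)
    refine wp_load (hQ _ (fun d hd => ?_) fun x hx => ?_)
    · by_cases hdk : d = k + 1
      · rw [hdk, Function.update_self, g2 (k + 1) (by omega), h0 _ le_rfl, g2 (R + (k + 1)) (by omega)]
      · rw [Function.update_of_ne hdk, g1 d (by omega)]
    · rw [Function.update_of_ne (by omega), g2 x (by omega)]

/-- Complete the best list and write out the number of its jumps and its elements. The output is
first gathered behind the completed list, because its final place is used for the variables. -/
def outputProg : RAMProg :=
  loadProg rBest ;; completeProg ;; .add rHead rTail rN ;; .sub rU rN rOne ;; .sub rU rU rAsc ;;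
    .store rHead rU ;;
    forLoop rC rN (.add rU rTail rC ;; .load rU rU ;; .add rU rU rHead ;; .store rU rC) ;;
    .const rV 23 ;;
    forLoop rC rN (.add rU rV rC ;; .add rW rU rHead ;; .load rW rW ;; .store rU rW) ;;
    .add 0 rHead rZero ;; .const 22 1 ;; pointerProg 22 ;; derefProg 22

theorem wp_outputProg {L : ℕ} {qs : ℕ → List ℕ} (hr : PosetOn n r) (hl : Layout n tb vb W)
    (hS : Search n r tb vb W L qs M) (hN : n ≤ N)
    (hQ : ∀ M' s, Ext r s → (∀ c, c ∈ s ↔ c < n) → (∀ i < L, asc r n (qs i) ≤ asc r n s) →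
      M' 0 = n - 1 - asc r n s → (∀ c < n, M' (pos s c) = c) → Q M') :
    WP N W outputProg Q M := by
  have hge := hS.static.ge
  have h1 := hl.tab_le
  have h2 : vb + n + 1 ≤ queueBase n vb := le_queueBase
  have h3 : queueBase n vb ≤ slot n vb L := Nat.le_add_right _ _
  have hW : slot n vb L + n + n + 29 ≤ W := by
    have := slot_le (n := n) (vb := vb) (hS.queue.le_maxQueue hr)
    have h4 := slot_lt (n := n) (vb := vb) (show maxQueue n < maxQueue n + 2 by omega)
    have := hl.le
    omega
  obtain ⟨b, hb, hMb, hbmax⟩ := hS.best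
  have hsb := slot_lt (n := n) (vb := vb) hb
  have hsb' : queueBase n vb ≤ slot n vb b := Nat.le_add_right _ _
  have hq : tb + n * n + n ≤ slot n vb L := by omega
  refine wp_seq (wp_loadProg hS.static (by omega) hMb (hS.stored b hb) (by omega) (by omega) hS.tail
    hq (by omega) hN fun M1 hF1 hC1 => ?_)
  have hS1 := hS.static.curFrame hF1 hq
  refine wp_seq (wp_completeProg hr hS1 hC1 hq (by omega) (hS.queue.lt b hb)
    (hS.queue.ext b hb) hN fun M2 s hS2 hC2 hext hmem hasc => ?_)
  have hbest : ∀ i < L, asc r n (qs i) ≤ asc r n s := fun i hi => (hbmax i hi).trans hasc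
  have e0 := hS2.n_eq
  have e1 := hS2.one
  have e2 := hS2.zero
  have e3 := hC2.tail
  have e4 := hC2.asc_eq
  have e5 := hC2.pos_eq
  have hlen : s.length ≤ n := length_le_of_lt hext.nodup fun c hc => (hmem c).1 hc
  have hpos : ∀ c < n, 1 ≤ pos s c ∧ pos s c ≤ n := fun c hc => by
    have := pos_le_length s c
    have h4 : pos s c ≠ 0 := fun h => pos_eq_zero.1 h ((hmem c).2 hc)
    omega
  generalize slot n vb L = q at *
  refine wp_seq (wp_add_eq (v := q + n) (by rw [e3, e0]) (by omega) (wp_seq (wp_sub (wp_seq (wp_sub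
    (wp_seq (wp_store_eq (k := q + n) (v := n - 1 - asc r n s) ?_ ?_ (wp_seq ?_))))))))
  all_goals try simp (disch := omega) only [Function.update_self, Function.update_of_ne, e0, e1, e4]
  refine wp_for (L := n) (fun k M3 => M3 rTail = q ∧ M3 rHead = q + n ∧ M3 rZero = 0 ∧
    (∀ c < n, M3 (q + c) = pos s c) ∧ M3 (q + n) = n - 1 - asc r n s ∧
    ∀ c < k, M3 (q + n + pos s c) = c) (by decide) ?_ ?_ hN ?_ ?_ ?_
  · simp (disch := omega) only [Function.update_of_ne, e0]
  · simp (disch := omega) only [Function.update_of_ne, e1]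
  · intro g
    refine ⟨?_, ?_, ?_, fun c hc => ?_, ?_, by omega⟩ <;>
    simp (disch := omega) only [Function.update_self, Function.update_of_ne, e2, e3, e5]
  · rintro k hk M3 ⟨g1, g2, g3, g4, g5, g6⟩ hMk hn3 ho3
    have hpk := hpos k hk
    refine wp_seq (wp_add_eq (v := q + k) (by rw [g1, hMk]) (by omega) (wp_seq (wp_load (wp_seq
      (wp_add_eq (v := q + n + pos s k) ?_ (by omega) (wp_store_eq (k := q + n + pos s k) (v := k)
      ?_ ?_ ⟨?_, ?_, ?_, fun g => ⟨?_, ?_, ?_, fun c hc => ?_, ?_, fun c hc => ?_⟩⟩))))))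
    all_goals try simp (disch := omega) only [Function.update_self, Function.update_of_ne, g1, g2,
      g3, hMk, hn3, ho3, g4 k hk, g5]
    · omega
    · exact g4 c hc
    · by_cases hck : c = k
      · subst hck
        simp (disch := omega) only [Function.update_self, Function.update_of_ne]
      · have hne : pos s c ≠ pos s k := fun h =>
          hck (pos_inj ((hmem c).2 (by omega)) ((hmem k).2 hk) h)
        simp (disch := omega) only [Function.update_self, Function.update_of_ne]
        exact g6 c (by omega)
  rintro M3 ⟨g1, g2, g3, g4, g5, g6⟩ hn3 ho3
  refine wp_seq (wp_const (wp_seq (wp_for (L := n) (fun k M4 => M4 rV = 23 ∧ M4 rHead = q + n ∧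
    M4 rZero = 0 ∧ (∀ x, q + n ≤ x → M4 x = M3 x) ∧ ∀ c < k, M4 (23 + c) = M3 (q + n + (23 + c)))
    (by decide) ?_ ?_ hN ?_ ?_ ?_)))
  · simp (disch := omega) only [Function.update_of_ne, hn3]
  · simp (disch := omega) only [Function.update_of_ne, ho3]
  · intro g
    refine ⟨?_, ?_, ?_, fun c hc => ?_, by omega⟩ <;>
    simp (disch := omega) only [Function.update_self, Function.update_of_ne, g2, g3]
  · rintro k hk M4 ⟨f1, f2, f3, f4, f5⟩ hMk hn4 ho4
    have f6 := f4 (q + n + (23 + k)) (by omega)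
    refine wp_seq (wp_add_eq (v := 23 + k) (by rw [f1, hMk]) (by omega) (wp_seq
      (wp_add_eq (v := q + n + (23 + k)) ?_ (by omega) (wp_seq (wp_load (wp_store_eq (k := 23 + k)
      (v := M3 (q + n + (23 + k))) ?_ ?_ ⟨?_, ?_, ?_, fun g => ⟨?_, ?_, ?_, fun c hc => ?_,
      fun c hc => ?_⟩⟩))))))
    all_goals try simp (disch := omega) only [Function.update_self, Function.update_of_ne, f1, f2,
      f3, hMk, hn4, ho4, f6]
    · omega
    · exact f4 c hc
    · by_cases hck : c = k
      · subst hck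
        simp (disch := omega) only [Function.update_self, Function.update_of_ne]
      · simp (disch := omega) only [Function.update_self, Function.update_of_ne]
        exact f5 c (by omega)
  rintro M4 ⟨f1, f2, f3, f4, f5⟩ hn4 ho4
  refine wp_seq (wp_add_eq (v := q + n) (by rw [f2, f3, add_zero]) (by omega) (wp_seq (wp_const (wp_seq
    (wp_pointerProg (R := q + n) le_rfl ?_ ?_ (by omega) fun M5 k1 k2 => wp_derefProg (R := q + n)
    (by omega) k1 fun M6 k3 k4 => ?_)))))
  · simp (disch := omega) only [Function.update_self, Function.update_of_ne, add_zero]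
  · simp (disch := omega) only [Function.update_self]
  have key : ∀ d ≤ n, M6 d = M3 (q + n + d) := by
    intro d hd
    by_cases hd22 : d ≤ 22
    · rw [k3 d hd22, k2 _ (by omega), Function.update_of_ne (by omega),
        Function.update_of_ne (by omega), f4 _ (by omega)]
    · rw [k4 d (by omega), k2 _ (by omega), Function.update_of_ne (by omega),
        Function.update_of_ne (by omega)]
      have := f5 (d - 23) (by omega)
      rwa [show 23 + (d - 23) = d by omega] at this
  refine hQ M6 s hext hmem hbest ?_ fun c hc => ?_
  · rw [key 0 (by omega), add_zero, g5]
  · rw [key _ (hpos c hc).2, g6 c hc]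

end JumpNumber

namespace JumpNumber

variable {n N W : ℕ}

/-! ### From lists to linear extensions -/

/-- A relation on `Fin n` as a relation on the natural numbers. -/
def natRel {n : ℕ} (r : Fin n → Fin n → Prop) (i j : ℕ) : Prop :=
  ∃ (hi : i < n) (hj : j < n), r ⟨i, hi⟩ ⟨j, hj⟩

theorem natRel_val {r : Fin n → Fin n → Prop} {i j : Fin n} : natRel r i j ↔ r i j :=
  ⟨fun ⟨_, _, h⟩ => h, fun h => ⟨i.2, j.2, h⟩⟩

theorem posetOn_natRel {r : Fin n → Fin n → Prop} (hr : IsStrictOrder (Fin n) r) :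
    PosetOn n (natRel r) where
  lt_left := fun ⟨h, _, _⟩ => h
  lt_right := fun ⟨_, h, _⟩ => h
  irrefl := fun _ ⟨_, _, h⟩ => hr.irrefl _ h
  trans := fun ⟨h1, _, h⟩ ⟨_, h2, h'⟩ => ⟨h1, h2, hr.trans _ _ _ h h'⟩

theorem isInput_posetInput (r : Fin n → Fin n → Prop) : IsInput n (natRel r) (posetInput r) where
  zero := by simp [posetInput]
  le_one x hx := by
    rw [posetInput, if_neg (by omega)]
    split_ifs <;> omega
  blank x hx := by
    rw [posetInput, if_neg (by omega), if_neg]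
    rintro ⟨i, j, h, -⟩
    have : n * ((i : ℕ) + 1) ≤ n * n := Nat.mul_le_mul_left n i.2
    have := j.2
    rw [Nat.mul_add] at *
    omega
  table i j hi hj := by
    rw [posetInput, if_neg (by omega)]
    congr 1
    refine propext ⟨?_, fun ⟨h1, h2, h⟩ => ⟨⟨i, h1⟩, ⟨j, h2⟩, rfl, h⟩⟩
    rintro ⟨i', j', h, hij⟩
    have h1 : n * i + j = n * (i' : ℕ) + j' := by omega
    have h2 : i = i' := by
      have := congrArg (· / n) h1
      simpa [Nat.mul_add_div (show 0 < n by omega), Nat.div_eq_of_lt hj, Nat.div_eq_of_lt j'.2]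
        using this
    have h3 : j = j' := by
      rw [h2] at h1
      omega
    subst h2 h3
    exact natRel_val.2 hij

/-- The enumeration `x` as a function on the natural numbers. -/
def natEnum {n : ℕ} (x : Fin n ≃ Fin n) (i : ℕ) : ℕ := if h : i < n then x ⟨i, h⟩ else 0

theorem natEnum_of_lt (x : Fin n ≃ Fin n) {i : ℕ} (h : i < n) : natEnum x i = x ⟨i, h⟩ :=
  dif_pos h

/-- Among the `n - 1` pairs of neighbours, those that are not jumps are comparable. -/
theorem jumpCount_eq (r : Fin n → Fin n → Prop) (x : Fin n ≃ Fin n) :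
    jumpCount r x = n - 1 - rises (natRel r) (natEnum x) n := by
  have h1 := Finset.card_filter_add_card_filter_not (s := Finset.range (n - 1))
    (fun i => natRel r (natEnum x i) (natEnum x (i + 1)))
  rw [Finset.card_range] at h1
  have h2 : jumpCount r x = ((Finset.range (n - 1)).filter
      fun i => ¬ natRel r (natEnum x i) (natEnum x (i + 1))).card := by
    rw [jumpCount, ← Set.ncard_coe_finset, ← Set.InjOn.ncard_image (f := fun p => (p.1 : ℕ))]
    · congr 1
      ext i
      simp only [Set.mem_image, Finset.coe_filter, Finset.mem_range]
      constructor
      · rintro ⟨⟨a, b⟩, ⟨hab, hr⟩, rfl⟩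
        simp only at hab hr
        have hb : (a : ℕ) + 1 < n := hab ▸ b.2
        change (a : ℕ) < n - 1 ∧ ¬ natRel r (natEnum x a) (natEnum x (a + 1))
        refine ⟨by omega, ?_⟩
        rw [natEnum_of_lt x a.2, natEnum_of_lt x hb, natRel_val]
        have : b = ⟨(a : ℕ) + 1, hb⟩ := Fin.ext hab
        rwa [this] at hr
      · rintro ⟨hi, hr⟩
        have hi' : i < n := by omega
        have hi1 : i + 1 < n := by omega
        rw [natEnum_of_lt x hi', natEnum_of_lt x hi1, natRel_val] at hr
        exact ⟨(⟨i, hi'⟩, ⟨i + 1, hi1⟩), ⟨rfl, hr⟩, rfl⟩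
    · rintro ⟨a, b⟩ ⟨hab, -⟩ ⟨c, d⟩ ⟨hcd, -⟩ h
      simp only at hab hcd h
      have h3 : a = c := Fin.ext h
      have h4 : b = d := Fin.ext (by rw [hab, hcd, h])
      rw [h3, h4]
  rw [h2]
  unfold rises
  omega

theorem asc_eq_rises {r : ℕ → ℕ → Prop} (hr : PosetOn n r) {f : ℕ → ℕ} : ∀ {s : List ℕ}, Ext r s →
    (∀ c ∈ s, c < n) → (∀ c ∈ s, f (pos s c - 1) = c) → asc r n s = rises r f s.length
  | [], _, _, _ => by simp [asc, rises]
  | [c], _, hlt, _ => by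
    simp [asc, rises, not_le_top hr (hlt c (by simp))]
  | c :: d :: s, hs, hlt, hf => by
    have hne : d ≠ c := fun e => hs.2.1 (by simp [e])
    have ih := asc_eq_rises hr (f := f) hs.1 (fun e he => hlt e (List.mem_cons_of_mem _ he))
      (fun e he => by
        have := hf e (List.mem_cons_of_mem _ he)
        rwa [pos, if_neg (fun h : e = c => hs.2.1 (h ▸ he))] at this)
    have hc : f (s.length + 1) = c := by
      have := hf c (by simp)
      simpa [pos] using this
    have hd : f s.length = d := by
      have := hf d (by simp)
      simpa [pos, hne] using this
    have hle : Le r d c ↔ r d c := ⟨fun h => h.resolve_left hne, Or.inr⟩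
    rw [List.length_cons, List.length_cons, rises_succ, hc, hd, asc, ih, List.headD_cons]
    simp only [hle, List.length_cons]

/-- A complete list with at least as many comparable neighbours as any list of a closed search
yields an optimal linear extension. -/
theorem isJumpSolution_of_list {r : Fin n → Fin n → Prop} (hr : IsStrictOrder (Fin n) r)
    {𝒬 : Set (List ℕ)} (hQ : SearchClosed (natRel r) n 𝒬) {s : List ℕ} (hs : Ext (natRel r) s)
    (hmem : ∀ c, c ∈ s ↔ c < n) (hmax : ∀ s' ∈ 𝒬, asc (natRel r) n s' ≤ asc (natRel r) n s)
    {M : ℕ → ℕ} (h0 : M 0 = n - 1 - asc (natRel r) n s) (hM : ∀ c < n, M (pos s c) = c) :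
    IsJumpSolution r M := by
  have hR := posetOn_natRel hr
  have hlen : s.length = n := by
    rw [← List.toFinset_card_of_nodup hs.nodup]
    have : s.toFinset = Finset.range n := by
      ext c
      rw [List.mem_toFinset, hmem, Finset.mem_range]
    rw [this, Finset.card_range]
  have hpos : ∀ c < n, 1 ≤ pos s c ∧ pos s c ≤ n := fun c hc => by
    have := pos_le_length s c
    have h4 : pos s c ≠ 0 := fun h => pos_eq_zero.1 h ((hmem c).2 hc)
    omega
  let e₀ : Fin n → Fin n := fun c => ⟨pos s c - 1, by have := hpos c c.2; omega⟩
  have he₀ : Function.Injective e₀ := by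
    intro c d h
    have h1 : pos s c - 1 = pos s d - 1 := congrArg Fin.val h
    have := hpos c c.2
    have := hpos d d.2
    exact Fin.ext (pos_inj ((hmem c).2 c.2) ((hmem d).2 d.2) (by omega))
  let e : Fin n ≃ Fin n := Equiv.ofBijective e₀ (Finite.injective_iff_bijective.1 he₀)
  have hev : ∀ c : Fin n, (e c : ℕ) = pos s c - 1 := fun _ => rfl
  have hf : ∀ c ∈ s, natEnum e.symm (pos s c - 1) = c := by
    intro c hc
    have hc' := (hmem c).1 hc
    have h1 := hpos c hc'
    rw [natEnum_of_lt _ (show pos s c - 1 < n by omega)]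
    have : (⟨pos s c - 1, by omega⟩ : Fin n) = e ⟨c, hc'⟩ := rfl
    rw [this, Equiv.symm_apply_apply]
  have hasc : asc (natRel r) n s = rises (natRel r) (natEnum e.symm) n := by
    rw [asc_eq_rises hR hs (fun c hc => (hmem c).1 hc) hf, hlen]
  refine ⟨e.symm, ⟨fun i j hij => ?_, fun y hy => ?_⟩, ?_, fun i => ?_⟩
  · have h1 := hs.pos_lt ((hmem _).2 (e.symm j).2) (natRel_val.2 hij)
    have h2 := hev (e.symm i)
    have h3 := hev (e.symm j)
    rw [Equiv.apply_symm_apply] at h2 h3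
    have := hpos _ (e.symm i).2
    exact Fin.lt_def.2 (by omega)
  · obtain ⟨s', hs', -, h⟩ := hQ.exists_ge hR (f := natEnum y)
      (fun i hi => by rw [natEnum_of_lt y hi]; exact (y _).2)
      (fun i j hi hj h => by
        rw [natEnum_of_lt y hi, natEnum_of_lt y hj] at h
        exact congrArg Fin.val (y.injective (Fin.ext h)))
      (fun c hc => ⟨y.symm ⟨c, hc⟩, (y.symm ⟨c, hc⟩).2, by
        rw [natEnum_of_lt y (y.symm ⟨c, hc⟩).2]; simp⟩)
      (fun i j hi hj h => by
        rw [natEnum_of_lt y hi, natEnum_of_lt y hj, natRel_val] at h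
        exact Fin.lt_def.1 (hy _ _ h)) n le_rfl
    have := hmax s' hs'
    rw [jumpCount_eq, jumpCount_eq]
    omega
  · rw [h0, hasc, jumpCount_eq]
  · have h1 := hev (e.symm i)
    rw [Equiv.apply_symm_apply] at h1
    have h2 := hpos _ (e.symm i).2
    have h3 := hM _ (e.symm i).2
    rwa [show pos s (e.symm i) = 1 + (i : ℕ) by omega] at h3

/-! ### The running time -/

/-- The program that solves the jump number problem. -/
def jumpProg : RAMProg :=
  peek 22 (fun g => tableProg g ;; queueProg ;; mainProg ;; outputProg) (fun _ => 0)

/-- A bound for all numbers that occur in the computation. -/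
def wordBound (n : ℕ) : ℕ := 2 ^ (3 * n + 7)

/-- A bound for the running time. All loops but the main one have at most `(n + 1) ^ 2` rounds. -/
noncomputable def timeBound (n : ℕ) : ℕ :=
  (cost ((n + 1) ^ 2) (tableProg fun _ => 0) + cost ((n + 1) ^ 2) queueProg +
    (maxQueue n * (cost ((n + 1) ^ 2) expandProg + 1) + 1) + cost ((n + 1) ^ 2) outputProg + 22) *
    (5 * bitLen (wordBound n))

theorem maxQueue_le (n : ℕ) : maxQueue n ≤ (n + 1) * 2 ^ n := by
  refine Nat.mul_le_mul_left _ (Nat.floor_le_of_le ?_)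
  push_cast
  exact pow_le_pow_left₀ (by norm_num) (by norm_num) n

theorem wordBound_ge (n : ℕ) : 2 * (n * n) + n + 70 ≤ wordBound n ∧
    Layout n (n * n + 24) (2 * (n * n) + n + 24) (wordBound n) := by
  have hP : n + 1 ≤ 2 ^ n := Nat.lt_two_pow_self
  have hq := maxQueue_le n
  have hW : wordBound n = 128 * (2 ^ n * 2 ^ n * 2 ^ n) := by
    rw [wordBound, pow_add, mul_comm 3 n, pow_mul]; ring
  suffices h : 2 * (n * n) + n + 70 ≤ wordBound n ∧ (2 * (n * n) + n + 24 + n + 1) * 2 ^ n +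
      (n + 3) * (maxQueue n + 2) + n + 26 ≤ wordBound n from ⟨h.1, by omega, h.2⟩
  rw [hW]
  generalize 2 ^ n = P at *
  generalize maxQueue n = m at *
  have h1 : 1 ≤ P := by omega
  have h2 : P ≤ P * P := Nat.le_mul_of_pos_left _ h1
  have h3 : P * P ≤ P * P * P := Nat.le_mul_of_pos_right _ h1
  have h4 : n * n + n ≤ P * P := by
    calc n * n + n = n * (n + 1) := by ring
      _ ≤ P * P := Nat.mul_le_mul (by omega) hP
  have h5 : (n + 1) * P ≤ P * P := Nat.mul_le_mul_right _ hP
  refine ⟨by omega, ?_⟩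
  have h6 : (2 * (n * n) + n + 24 + n + 1) * P ≤ (27 * (P * P)) * P :=
    Nat.mul_le_mul_right _ (by omega)
  have h7 : (n + 3) * (m + 2) ≤ (3 * P) * (3 * (P * P)) := Nat.mul_le_mul (by omega) (by omega)
  have h8 : (3 * P) * (3 * (P * P)) = 9 * (P * P * P) := by ring
  have h9 : (27 * (P * P)) * P = 27 * (P * P * P) := by ring
  omega

theorem maxConst_fixProg {g : ℕ → ℕ} (hg : ∀ d, 1 ≤ d → g d ≤ 1) (k : ℕ) :
    maxConst (fixProg g k) ≤ 23 := by
  induction k with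
  | zero => simp [fixProg, maxConst]
  | succ k ih =>
    have := hg (k + 1) (by omega)
    simp only [fixProg, maxConst, max_le_iff]
    omega

theorem cost_fixProg (g g' : ℕ → ℕ) (k : ℕ) : cost N (fixProg g k) = cost N (fixProg g' k) := by
  induction k with
  | zero => rfl
  | succ k ih => simp only [fixProg, cost, ih]

theorem maxConst_tableProg {g : ℕ → ℕ} (hg : ∀ d, 1 ≤ d → g d ≤ 1) : maxConst (tableProg g) ≤ 23 := by
  have := maxConst_fixProg hg 22
  simp only [tableProg, forLoop, maxConst, max_le_iff]
  omega

set_option maxRecDepth 20000 in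
theorem maxConst_le : maxConst queueProg ≤ 23 ∧ maxConst mainProg ≤ 23 ∧
    maxConst outputProg ≤ 23 :=
  ⟨Nat.le_of_ble_eq_true rfl, Nat.le_of_ble_eq_true rfl, Nat.le_of_ble_eq_true rfl⟩

theorem run_jumpProg {r : Fin n → Fin n → Prop} (hr : IsStrictOrder (Fin n) r) :
    ∃ M t, jumpProg.Run (posetInput r) M t ∧ t ≤ timeBound n ∧ IsJumpSolution r M := by
  have hR := posetOn_natRel hr
  have hI := isInput_posetInput r
  obtain ⟨hW, hl⟩ := wordBound_ge n
  obtain ⟨hc1, hc2, hc3⟩ := maxConst_le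
  set W := wordBound n
  set N := (n + 1) ^ 2 with hN
  have hnN : n * n + n ≤ N := by rw [hN]; ring_nf; omega
  have hM0 : ∀ k, posetInput r k ≤ W := by
    intro k
    rcases Nat.eq_zero_or_pos k with rfl | hk
    · rw [hI.zero]; omega
    · have := hI.le_one k hk
      omega
  have key := run_peek (M := posetInput r) (Q := IsJumpSolution r) (W := W) (k := 22)
    (f := fun g => tableProg g ;; queueProg ;; mainProg ;; outputProg)
    (τ := (cost N (tableProg fun _ => 0) + cost N queueProg +
      (maxQueue n * (cost N expandProg + 1) + 1) + cost N outputProg) * (5 * bitLen W))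
    (by omega) (fun _ => 0) (by omega) (fun d h _ => hI.le_one d h) ?_
  · obtain ⟨M, t, h1, h2, h3⟩ := key
    refine ⟨M, t, h1, h2.trans (le_of_eq ?_), h3⟩
    rw [timeBound]
    ring
  intro g hg hg'
  have hg1 : ∀ d, 1 ≤ d → g d ≤ 1 := by
    intro d hd
    by_cases h : d ≤ 22
    · rw [hg d hd h]; exact hI.le_one d hd
    · rw [hg' d (by omega)]; omega
  obtain ⟨M1, t1, r1, b1, m1, k1, k2, k3, k4, k5, k6⟩ := wp_tableProg (N := N) (W := W)
    (Q := fun M' => M' rN = n ∧ M' rOne = 1 ∧ M' rZero = 0 ∧ M' rAsc = n * n ∧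
      M' rTab = n * n + 24 ∧ ∀ x, 1 ≤ x → M' (n * n + 23 + x) = posetInput r x)
    hI hg hW hnN (fun M' h1 h2 h3 h4 h5 h6 => ⟨h1, h2, h3, h4, h5, h6⟩)
    ((maxConst_tableProg hg1).trans (by omega)) hM0
  obtain ⟨M2, t2, r2, b2, m2, k7, k8, k9⟩ := wp_queueProg (N := N) hR hI hl (by omega) k1 k2 k3 k4 k5
    k6 (Q := fun M' => Search n (natRel r) (n * n + 24) (2 * (n * n) + n + 24) W 1 (fun _ => []) M' ∧
      M' rHead = slot n (2 * (n * n) + n + 24) 0 ∧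
      M' rMain = slot n (2 * (n * n) + n + 24) 1 - slot n (2 * (n * n) + n + 24) 0)
    (fun M' h1 h2 h3 => ⟨h1, h2, h3⟩) (hc1.trans (by omega)) m1
  obtain ⟨M3, t3, r3, b3, m3, L, qs, hS, hdone⟩ := run_mainProg (N := N) hR hl k7 k8 k9 (by omega)
    (hc2.trans (by omega)) m2
  obtain ⟨M4, t4, r4, b4, m4, hsol⟩ := wp_outputProg (N := N) hR hl hS (by omega)
    (Q := IsJumpSolution r) (fun M' s h1 h2 h3 h4 h5 => by
      refine isJumpSolution_of_list hr (𝒬 := {s | ∃ i < L, qs i = s}) ⟨?_, ?_⟩ h1 h2 ?_ h4 h5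
      · exact ⟨0, hS.queue.pos, hS.queue.first⟩
      · rintro _ ⟨i, hi, rfl⟩ a t hat ha
        obtain ⟨j, hj, s', h6, h7⟩ := hdone i hi a t hat ha
        exact ⟨qs j, ⟨j, hj, rfl⟩, s', h6, h7.1, h7.2⟩
      · rintro _ ⟨i, hi, rfl⟩
        exact h3 i hi) (hc3.trans (by omega)) m3
  refine ⟨M4, _, .seq r1 (.seq r2 (.seq r3 r4)), ?_, hsol⟩
  have e : cost N (tableProg g) = cost N (tableProg fun _ => 0) := by
    simp only [tableProg, cost, cost_fixProg g (fun _ => 0)]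
  rw [e] at b1
  simp only [add_mul] at b1 b2 b3 b4 ⊢
  omega

/-! ### Asymptotics -/

/-- `f` is bounded by a polynomial. -/
def PolyBounded (f : ℕ → ℕ) : Prop := ∃ C k : ℕ, ∀ n, f n ≤ C * (n + 1) ^ k

theorem polyBounded_const (c : ℕ) : PolyBounded fun _ => c := ⟨c, 0, by simp⟩

theorem PolyBounded.add {f g : ℕ → ℕ} (hf : PolyBounded f) (hg : PolyBounded g) :
    PolyBounded fun n => f n + g n := by
  obtain ⟨C, k, hf⟩ := hf
  obtain ⟨D, l, hg⟩ := hg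
  refine ⟨C + D, k + l, fun n => ?_⟩
  have h1 : (n + 1) ^ k ≤ (n + 1) ^ (k + l) := Nat.pow_le_pow_right (by omega) (by omega)
  have h2 : (n + 1) ^ l ≤ (n + 1) ^ (k + l) := Nat.pow_le_pow_right (by omega) (by omega)
  calc f n + g n ≤ C * (n + 1) ^ k + D * (n + 1) ^ l := Nat.add_le_add (hf n) (hg n)
    _ ≤ C * (n + 1) ^ (k + l) + D * (n + 1) ^ (k + l) := by gcongr
    _ = _ := by ring

theorem PolyBounded.mul {f g : ℕ → ℕ} (hf : PolyBounded f) (hg : PolyBounded g) :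
    PolyBounded fun n => f n * g n := by
  obtain ⟨C, k, hf⟩ := hf
  obtain ⟨D, l, hg⟩ := hg
  refine ⟨C * D, k + l, fun n => (Nat.mul_le_mul (hf n) (hg n)).trans (le_of_eq ?_)⟩
  ring

theorem polyBounded_id : PolyBounded fun n => n := ⟨1, 1, fun n => by
  simp only [one_mul, pow_one, Nat.le_succ]⟩

theorem polyBounded_cost (p : RAMProg) : PolyBounded fun n => cost ((n + 1) ^ 2) p := by
  have hN : PolyBounded fun n => (n + 1) ^ 2 := ⟨1, 2, by simp⟩
  induction p with
  | seq p q hp hq => exact hp.add hq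
  | ite a p q hp hq => exact (hp.add hq).add (polyBounded_const 1)
  | loop a p hp => exact (hN.mul (hp.add (polyBounded_const 1))).add (polyBounded_const 1)
  | _ => exact polyBounded_const 1

theorem bitLen_wordBound (n : ℕ) : bitLen (wordBound n) = 3 * n + 8 := by
  rw [bitLen, wordBound, Nat.log_pow (by norm_num)]

theorem exists_timeBound_le : ∃ C k : ℕ, ∀ n, (timeBound n : ℝ) ≤ C * (n + 1) ^ k * 1.802 ^ n := by
  have hb : PolyBounded fun n => 5 * bitLen (wordBound n) := by
    simp only [bitLen_wordBound]
    exact (polyBounded_const 5).mul (((polyBounded_const 3).mul polyBounded_id).add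
      (polyBounded_const 8))
  have h1 : PolyBounded fun n => (cost ((n + 1) ^ 2) (tableProg fun _ => 0) +
      cost ((n + 1) ^ 2) queueProg + cost ((n + 1) ^ 2) outputProg + 23) *
      (5 * bitLen (wordBound n)) :=
    ((((polyBounded_cost _).add (polyBounded_cost _)).add (polyBounded_cost _)).add
      (polyBounded_const 23)).mul hb
  have h2 : PolyBounded fun n => (n + 1) * (cost ((n + 1) ^ 2) expandProg + 1) *
      (5 * bitLen (wordBound n)) :=
    ((polyBounded_id.add (polyBounded_const 1)).mul
      ((polyBounded_cost _).add (polyBounded_const 1))).mul hb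
  obtain ⟨C, k, h⟩ := h1.add h2
  refine ⟨C, k, fun n => ?_⟩
  have hfloor : (⌊(1.802 : ℝ) ^ n⌋₊ : ℝ) ≤ 1.802 ^ n := Nat.floor_le (by positivity)
  have hone : (1 : ℝ) ≤ 1.802 ^ n := one_le_pow₀ (by norm_num)
  have e : timeBound n = (cost ((n + 1) ^ 2) (tableProg fun _ => 0) +
      cost ((n + 1) ^ 2) queueProg + cost ((n + 1) ^ 2) outputProg + 23) *
      (5 * bitLen (wordBound n)) + (n + 1) * (cost ((n + 1) ^ 2) expandProg + 1) *
      (5 * bitLen (wordBound n)) * ⌊(1.802 : ℝ) ^ n⌋₊ := by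
    rw [timeBound, maxQueue]; ring
  have hn := h n
  beta_reduce at hn
  rw [e]
  generalize (cost ((n + 1) ^ 2) (tableProg fun _ => 0) + cost ((n + 1) ^ 2) queueProg +
    cost ((n + 1) ^ 2) outputProg + 23) * (5 * bitLen (wordBound n)) = A at *
  generalize (n + 1) * (cost ((n + 1) ^ 2) expandProg + 1) * (5 * bitLen (wordBound n)) = B at *
  have hn' : (A : ℝ) + B ≤ C * (n + 1) ^ k := by exact_mod_cast hn
  push_cast
  calc (A : ℝ) + B * (⌊(1.802 : ℝ) ^ n⌋₊ : ℝ) ≤ A * 1.802 ^ n + B * 1.802 ^ n := by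
        gcongr
        exact le_mul_of_one_le_right (by positivity) hone
    _ = (A + B) * 1.802 ^ n := by ring
    _ ≤ _ := by gcongr

theorem timeBound_isBigO :
    (fun n : ℕ => (timeBound n : ℝ)) =O[Filter.atTop] (fun n : ℕ => (1.824 : ℝ) ^ n) := by
  obtain ⟨C, k, h⟩ := exists_timeBound_le
  have h1 : (fun n : ℕ => (timeBound n : ℝ)) =O[Filter.atTop]
      (fun n : ℕ => (n : ℝ) ^ k * 1.802 ^ n) := by
    refine Asymptotics.IsBigO.of_bound (C * 2 ^ k) ?_
    filter_upwards [Filter.eventually_ge_atTop 1] with n hn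
    have hn' : (1 : ℝ) ≤ n := by exact_mod_cast hn
    rw [Real.norm_of_nonneg (by positivity), Real.norm_of_nonneg (by positivity)]
    calc (timeBound n : ℝ) ≤ C * (n + 1) ^ k * 1.802 ^ n := h n
      _ ≤ C * (2 * n) ^ k * 1.802 ^ n := by gcongr; linarith
      _ = _ := by rw [mul_pow]; ring
  refine h1.trans (isLittleO_pow_const_mul_const_pow_const_pow_of_norm_lt k ?_).isBigO
  rw [Real.norm_of_nonneg (by norm_num)]
  norm_num

end JumpNumber

/-- The jump number problem can be solved in time `O(1.824 ^ n)` on posets with `n` elements. -/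
theorem theorem2 :
    ∃ (p : RAMProg) (T : ℕ → ℕ), SolvesJumpNumberInTime p T ∧
      (fun n : ℕ => (T n : ℝ)) =O[Filter.atTop] (fun n : ℕ => (1.824 : ℝ) ^ n) :=
  ⟨JumpNumber.jumpProg, JumpNumber.timeBound, fun _ _ hr => JumpNumber.run_jumpProg hr,
    JumpNumber.timeBound_isBigO⟩
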